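/- **Base graph.** Let $\Gamma_0=(\mathbf V_0,\mathbf E_0)$ be a finite connected graph in the sense of Serre (each oriented edge $e$ has an initial vertex $\mathrm o(e)$ and a reversed edge $-e\neq e$, with $-(-e)=e$ and $\mathrm t(e)=\mathrm o(-e)$; loops and multiple edges are allowed). Fix an orientation $\mathbf E_0^+$ and a spanning tree $\mathbf T$. The incidence vector of a path $\xi$ is $[\xi]=\sum_{e\in\mathbf E_0^+}(\#_\xi(e)-\#_\xi(-e))\,e$. Let $\theta$ be the linear map from $1$-chains to $H_1(\Gamma_0,\mathbb Z)\cong\mathbb Z^{b}$, $b=\frac12|\mathbf E_0|-|\mathbf V_0|+1$, that vanishes on the edges of $\mathbf T$ and sends $e\in\mathbf E_0^+\setminus\mathbf E_{\mathbf T}$ to the incidence vector of the unique circuit containing $e$ whose other edges lie in $\mathbf T$. The rotation vector of $\xi$ is $\theta([\xi])$. The maximal topological crystal $\Gamma$ over $\Gamma_0$ has vertices $\mathbf V_0\times\mathbb Z^b$, edges $\mathbf E_0\times\mathbb Z^b$, $\mathrm o(e,h)=(\mathrm o(e),h)$ and $-(e,h)=(-e,h+\theta(e))$; $\mathbb Z^b$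 acts on it by translations. **Network.** A network $\mathcal N\subset\mathbb R^d$ is the union of a family $\mathcal E$ of regular simple $C^1$ arcs $\gamma:[0,1]\to\mathbb R^d$, closed under reversal $\widetilde\gamma(s)=\gamma(1-s)$, such that $\gamma([0,1])\cap\gamma'((0,1))=\emptyset$ for $\gamma'\ne\gamma,\widetilde\gamma$. Its vertices $\mathcal V$ are the endpoints of the arcs. Its underlying graph has vertex set $\mathcal V$ and edge set $\mathcal E$, with $\mathrm o(\gamma)=\gamma(0)$ and $-\gamma=\widetilde\gamma$. A curve in $\mathcal N$ is an absolutely continuous curve of $\mathbb R^d$ with values in $\mathcal N$. Let $\mathcal N$ be a periodic network over $\Gamma_0$: it is connected by curves, the lengths of its arcs are bounded from above and have a positive infimum, and its underlying graph is identified with $\Gamma$ by a graph isomorphism $\Psi=(\Psi_{\mathcal V},\Psi_{\mathcal E})$. For $z\in\mathcal V$ write $\Psi_{\mathcal V}(z)=(\pi_1(z),\pi_2(z))\in\mathbf V_0\times\mathbb Z^b$. **Hamiltonians and Lagrangians.** Let $H_\gamma:[0,1]\times\mathbb R\to\mathbb R$, $\gamma\in\mathcal E$, be continuous in $s$, and $C^1$,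 strictly convex and superlinear (as $\rho\to+\infty$, uniformly in $s$) in $\rho$, with $H_{\widetilde\gamma}(s,\rho)=H_\gamma(1-s,-\rho)$, and invariant under the translations of $\Gamma$. Put $L_\gamma(s,\lambda)=\sup_\rho(\rho\lambda-H_\gamma(s,\rho))$ and, for $z\in\mathcal V$, $\widehat c_z=\min_{\gamma(1)=z}\left[-\max_{s}\min_\rho H_\gamma(s,\rho)\right]$. The overall Lagrangian is $L(z,q)=L_\gamma\!\left(s,\frac{q\cdot\dot\gamma(s)}{|\dot\gamma(s)|^2}\right)$ if $z=\gamma(s)$ with $s\in(0,1)$; if $z\in\mathcal V$ and $q\neq0$, then $L(z,q)=\min L_\gamma\!\left(1,\frac{q\cdot\dot\gamma(1)}{|\dot\gamma(1)|^2}\right)$ over the arcs with $\gamma(1)=z$ and $q$ parallel to $\dot\gamma(1)$; and $L(z,0)=\widehat c_z$ if $z\in\mathcal V$. Let $\Phi_L(z_1,z_2,T)$ be the infimum of $\int_0^T L(\zeta,\dot\zeta)\,dt\in(-\infty,+\infty]$ over the curves $\zeta:[0,T]\to\mathcal N$ with $\zeta(0)=z_1$ and $\zeta(T)=z_2$. **Discrete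 action.** For $e\in\mathbf E_0$ let $H_e=H_\gamma$ for any $\gamma$ with $\Psi_{\mathcal E}(\gamma)=(e,h)$ for some $h$. Put $a_e=\max_s\min_\rho H_e(s,\rho)$ and, for $a\ge a_e$, $\sigma(e,a)=\int_0^1\max\{\rho : H_e(s,\rho)=a\}\,ds$. Let $\mathcal H(e,\cdot):[\sigma(e,a_e),\infty)\to[a_e,\infty)$ be the inverse of $\sigma(e,\cdot)$, and $\mathcal L(e,q)=\max_{\rho\ge\sigma(e,a_e)}(\rho q-\mathcal H(e,\rho))$ for $q\ge0$. A parametrized path is a finite sequence $(e_i,q_i,T_i)_i$ that is a concatenation, along a path of $\Gamma_0$, of edges with $q_i>0$ and $T_i=1/q_i$, and of equilibrium circuits $(e,-e)$ with both speeds equal to $0$ and arbitrary positive times. Its total time is $\sum_iT_i$ and its action is $\sum_iT_i\,\mathcal L(e_i,q_i)$. Let $\Phi_{\mathcal L}(x,y,T;h)$ be the infimum of the action over the parametrized paths from $x$ to $y$ with total time $T$ and rotation vector $h$. **Proposition.** For all vertices $z_1,z_2\in\mathcal V$ and all $T>0$, $$\Phi_L(z_1,z_2,T)=\Phi_{\mathcal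 L}\big(\pi_1(z_1),\pi_1(z_2),T;\ \pi_2(z_2)-\pi_2(z_1)\big),$$ and this common value is finite. -/

import Mathlib

open Set

noncomputable section

/-! ### Graphs, paths, first homology -/

/-- A graph in the sense of Serre: edges are oriented, `o e` is the initial vertex of `e` and
`neg e` is the same edge with the reversed orientation. Loops and multiple edges are allowed. -/
structure OGraph (V E : Type*) where
  o : E → V
  neg : E → E
  neg_ne : ∀ e, neg e ≠ e
  neg_neg : ∀ e, neg (neg e) = e

namespace OGraph

variable {V E : Type*}

/-- Terminal vertex of an edge. -/
def t (Γ : OGraph V E) (e : E) : V := Γ.o (Γ.neg e)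

/-- `Γ.IsPath x y l`: the list of edges `l` is concatenated and leads from `x` to `y`
(the empty list leads from `x` to `x`). -/
def IsPath (Γ : OGraph V E) : V → V → List E → Prop
  | x, y, [] => x = y
  | x, y, e :: l => Γ.o e = x ∧ Γ.IsPath (Γ.t e) y l

/-- Any two vertices are linked by a path. -/
def Connected (Γ : OGraph V E) : Prop := ∀ x y, ∃ l, Γ.IsPath x y l

/-- A circuit: a nonempty closed path whose edges have pairwise distinct terminal vertices. -/
def IsCircuit (Γ : OGraph V E) (l : List E) : Prop :=
  l ≠ [] ∧ (∃ x, Γ.IsPath x x l) ∧ (l.map Γ.t).Nodup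

/-- An orientation: a choice of exactly one edge in each pair `{e, -e}`. -/
structure Orientation (Γ : OGraph V E) where
  plus : Set E
  not_both : ∀ e, e ∈ plus → Γ.neg e ∉ plus
  one_of : ∀ e, e ∈ plus ∨ Γ.neg e ∈ plus

/-- An isomorphism of graphs. -/
structure Iso {V' E' : Type*} (Γ : OGraph V E) (Γ' : OGraph V' E') where
  vert : V ≃ V'
  edge : E ≃ E'
  map_o : ∀ e, Γ'.o (edge e) = vert (Γ.o e)
  map_neg : ∀ e, edge (Γ.neg e) = Γ'.neg (edge e)

variable {Γ : OGraph V E} (P : Γ.Orientation)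

/-- The boundary operator `∂ : C₁(Γ, ℤ) → C₀(Γ, ℤ)`, `∂ e = t(e) - o(e)` for `e ∈ E⁺`, where `C₁`
is the free abelian group on `E⁺` and `C₀` the one on the vertices. -/
def boundary : (P.plus →₀ ℤ) →ₗ[ℤ] (V →₀ ℤ) :=
  Finsupp.linearCombination ℤ
    (fun e : P.plus => Finsupp.single (Γ.t e) 1 - Finsupp.single (Γ.o e) 1)

/-- First homology group `H₁(Γ, ℤ) = ker ∂`; for a finite connected graph it is a free abelian
group of rank `b(Γ) = |E| / 2 - |V| + 1`. -/
abbrev H₁ : Type _ := LinearMap.ker (boundary P)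

open Classical in
/-- An edge as an element of `C₁(Γ, ℤ)`: the reversed edge is identified with the opposite. -/
def edgeVec (e : E) : P.plus →₀ ℤ :=
  if h : e ∈ P.plus then Finsupp.single ⟨e, h⟩ 1
  else -Finsupp.single ⟨Γ.neg e, (P.one_of e).resolve_left h⟩ 1

open Classical in
/-- The incidence vector `[ξ] = ∑_{e ∈ E⁺} (#_ξ(e) - #_ξ(-e)) e` of a path `ξ`, where `#_ξ(e)` is
the number of passages of `ξ` through `e`. -/
def incidence [Finite E] (l : List E) : P.plus →₀ ℤ :=
  Finsupp.equivFunOnFinite.symm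
    (fun e : P.plus => (l.count (e : E) : ℤ) - (l.count (Γ.neg e) : ℤ))

theorem edgeVec_neg (e : E) : edgeVec P (Γ.neg e) = -edgeVec P e := by
  classical
  unfold edgeVec
  by_cases h : e ∈ P.plus
  · have h' := P.not_both e h
    simp [h, h', Γ.neg_neg]
  · have h' := (P.one_of e).resolve_left h
    simp [h, h']

theorem boundary_edgeVec (e : E) :
    boundary P (edgeVec P e) = Finsupp.single (Γ.t e) 1 - Finsupp.single (Γ.o e) 1 := by
  classical
  unfold edgeVec boundary
  by_cases h : e ∈ P.plus
  · simp [h]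
  · simp [h, OGraph.t, Γ.neg_neg]

theorem incidence_nil [Finite E] : incidence P [] = 0 := by
  ext e
  simp [incidence]

theorem incidence_cons [Finite E] (e : E) (l : List E) :
    incidence P (e :: l) = edgeVec P e + incidence P l := by
  classical
  ext f
  have hf := P.not_both f f.2
  have hff := Γ.neg_ne f
  simp only [incidence, edgeVec, Finsupp.equivFunOnFinite_symm_apply_apply, Finsupp.add_apply,
    List.count_cons]
  by_cases h : e ∈ P.plus
  · have h1 : e ≠ Γ.neg f := fun hh => hf (hh ▸ h)
    simp only [h, dite_true, Finsupp.single_apply, Subtype.ext_iff]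
    by_cases h2 : e = f <;> (simp [h1, h2, hff.symm]; try ring)
  · have h1 : e ≠ f := fun hh => h (hh ▸ f.2)
    have h3 : (Γ.neg e = f) ↔ (e = Γ.neg f) :=
      ⟨fun hh => by rw [← hh, Γ.neg_neg], fun hh => by rw [hh, Γ.neg_neg]⟩
    simp only [h, dite_false, Finsupp.neg_apply, Finsupp.single_apply, Subtype.ext_iff, h3]
    by_cases h2 : e = Γ.neg f <;> (simp [h1, h2, hff]; try ring)

theorem boundary_incidence [Finite E] (x y : V) (l : List E) (h : Γ.IsPath x y l) :
    boundary P (incidence P l) = Finsupp.single y 1 - Finsupp.single x 1 := by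
  induction l generalizing x with
  | nil =>
    have hxy : x = y := h
    simp [incidence_nil, hxy]
  | cons e l ih =>
    obtain ⟨h1, h2⟩ := h
    rw [incidence_cons, map_add, boundary_edgeVec, ih _ h2, h1]
    abel

theorem incidence_mem [Finite E] (l : List E) (h : Γ.IsCircuit l) :
    incidence P l ∈ LinearMap.ker (boundary P) := by
  obtain ⟨-, ⟨x, hx⟩, -⟩ := h
  rw [LinearMap.mem_ker, boundary_incidence P x x l hx, sub_self]

/-- A spanning tree (given by its edges, its vertices being all vertices): a connected subgraph
in which every cycle is trivial, that is, has vanishing incidence vector. -/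
structure SpanningTree [Finite E] (P : Γ.Orientation) where
  edges : Set E
  neg_mem : ∀ e ∈ edges, Γ.neg e ∈ edges
  conn : ∀ x y, ∃ l, Γ.IsPath x y l ∧ ∀ e ∈ l, e ∈ edges
  trivial : ∀ x l, Γ.IsPath x x l → (∀ e ∈ l, e ∈ edges) → incidence P l = 0

variable [Finite E] {P} (S : SpanningTree P)

/-- A fundamental circuit of `e`: it contains `e`, and all its other edges lie in the tree. For
`e` outside the tree such a circuit exists and is unique up to the choice of its first edge, so
that its incidence vector is well defined. -/
def IsFundamental (e : E) (l : List E) : Prop :=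
  Γ.IsCircuit l ∧ e ∈ l ∧ ∀ f ∈ l, f = e ∨ f ∈ S.edges

open Classical in
/-- `θ` on the edges of `E⁺`: zero on the tree, and the incidence vector of the fundamental
circuit outside of the tree. -/
def thetaBasis (e : P.plus) : H₁ P :=
  if (e : E) ∈ S.edges then 0
  else if h : ∃ l, IsFundamental S (e : E) l then
    ⟨incidence P h.choose, incidence_mem P h.choose h.choose_spec.1⟩
  else 0

/-- The linear map `θ : C₁(Γ, ℤ) → H₁(Γ, ℤ)`. -/
def theta : (P.plus →₀ ℤ) →ₗ[ℤ] H₁ P :=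
  Finsupp.linearCombination ℤ (thetaBasis S)

/-- The value of `θ` on an edge. -/
def thetaEdge (e : E) : H₁ P := theta S (edgeVec P e)

theorem thetaEdge_neg (e : E) : thetaEdge S (Γ.neg e) = -thetaEdge S e := by
  rw [thetaEdge, edgeVec_neg, map_neg, thetaEdge]

/-- The rotation vector `θ([ξ])` of a path. -/
def rotation (l : List E) : H₁ P := theta S (incidence P l)

/-- The maximal topological crystal over `Γ`: its vertices are `V × H₁(Γ, ℤ)`, its edges
`E × H₁(Γ, ℤ)`, with `o(e, h) = (o(e), h)` and `-(e, h) = (-e, h + θ(e))`. -/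
def crystal : OGraph (V × H₁ P) (E × H₁ P) where
  o p := (Γ.o p.1, p.2)
  neg p := (Γ.neg p.1, p.2 + thetaEdge S p.1)
  neg_ne p h := Γ.neg_ne p.1 (congrArg Prod.fst h)
  neg_neg p := by
    ext1
    · exact Γ.neg_neg p.1
    · simp [thetaEdge_neg]

/-- The translations of the crystal by elements of `H₁(Γ, ℤ)`; they are graph automorphisms and
make up its Bravais lattice. -/
def translation (k : H₁ P) : (crystal S).Iso (crystal S) where
  vert := (Equiv.refl V).prodCongr (Equiv.addRight k)
  edge := (Equiv.refl E).prodCongr (Equiv.addRight k)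
  map_o _ := rfl
  map_neg p := by
    ext1
    · rfl
    · exact add_right_comm _ _ _

end OGraph

/-! ### Networks -/

/-- A network in `ℝᵈ` (without the requirement of connectedness): a family of regular simple `C¹`
arcs parametrized by `[0, 1]`, closed under reversal of the orientation, such that distinct arcs
(up to orientation) meet at most at their endpoints. Simple arcs are allowed to be closed. -/
structure Network (d : ℕ) (A : Type*) where
  arc : A → ℝ → EuclideanSpace ℝ (Fin d)
  rev : A → A
  rev_ne : ∀ γ, rev γ ≠ γ
  rev_rev : ∀ γ, rev (rev γ) = γ
  arc_rev : ∀ γ, ∀ s ∈ Icc (0 : ℝ) 1, arc (rev γ) s = arc γ (1 - s)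
  contDiff : ∀ γ, ContDiffOn ℝ 1 (arc γ) (Icc 0 1)
  regular : ∀ γ, ∀ s ∈ Icc (0 : ℝ) 1, derivWithin (arc γ) (Icc 0 1) s ≠ 0
  simple : ∀ γ, InjOn (arc γ) (Ico 0 1) ∧ InjOn (arc γ) (Ioc 0 1)
  disj : ∀ γ γ', γ' ≠ γ → γ' ≠ rev γ → Disjoint (arc γ '' Icc 0 1) (arc γ' '' Ioo 0 1)

namespace Network

variable {d : ℕ} {A : Type*} (N : Network d A)

/-- The subset of `ℝᵈ` covered by the arcs. -/
def carrier : Set (EuclideanSpace ℝ (Fin d)) := ⋃ γ, N.arc γ '' Icc 0 1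

/-- The vertices: initial and final points of the arcs. -/
def vertices : Set (EuclideanSpace ℝ (Fin d)) := {z | ∃ γ, z = N.arc γ 0 ∨ z = N.arc γ 1}

/-- Velocity of an arc (one-sided at the endpoints). -/
def vel (γ : A) (s : ℝ) : EuclideanSpace ℝ (Fin d) := derivWithin (N.arc γ) (Icc 0 1) s

/-- Curves in the network defined on `[0, T]`: absolutely continuous curves of `ℝᵈ` with values in
the network. -/
def IsCurve (T : ℝ) (ζ : ℝ → EuclideanSpace ℝ (Fin d)) : Prop :=
  AbsolutelyContinuousOnInterval ζ 0 T ∧ ∀ t ∈ Icc 0 T, ζ t ∈ N.carrier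

/-- Any two points of the network are linked by a curve. -/
def Connected : Prop :=
  ∀ x ∈ N.carrier, ∀ y ∈ N.carrier, ∃ ζ, N.IsCurve 1 ζ ∧ ζ 0 = x ∧ ζ 1 = y

/-- The underlying abstract graph. -/
def graph : OGraph N.vertices A where
  o γ := ⟨N.arc γ 0, γ, Or.inl rfl⟩
  neg := N.rev
  neg_ne := N.rev_ne
  neg_neg := N.rev_rev

end Network

/-- A periodic network over the finite graph `Γ₀`: a connected network whose arcs have lengths
bounded from above and away from zero, together with an identification `Ψ` of its underlying graph
with the maximal topological crystal over `Γ₀`. -/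
structure PeriodicNetwork {V₀ E₀ : Type*} [Finite E₀] {Γ₀ : OGraph V₀ E₀} {P : Γ₀.Orientation}
    (S : OGraph.SpanningTree P) (d : ℕ) (A : Type*) extends Network d A where
  connected : toNetwork.Connected
  Ψ : toNetwork.graph.Iso (OGraph.crystal S)
  length_bounds : ∃ c C : ℝ, 0 < c ∧ ∀ γ,
    ENNReal.ofReal c ≤ eVariationOn (arc γ) (Icc 0 1) ∧
      eVariationOn (arc γ) (Icc 0 1) ≤ ENNReal.ofReal C

/-! ### Hamiltonians and Lagrangians on the network -/

/-- Fenchel transform with respect to the momentum: `L_γ(s, q) = sup_ρ (ρ q - H_γ(s, ρ))`. -/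
def fenchel (h : ℝ → ℝ → ℝ) (s q : ℝ) : ℝ := ⨆ ρ : ℝ, ρ * q - h s ρ

/-- The critical value `max_{s ∈ [0, 1]} min_ρ h(s, ρ)`. -/
def critVal (h : ℝ → ℝ → ℝ) : ℝ := ⨆ s : Icc (0 : ℝ) 1, ⨅ ρ : ℝ, h s ρ

namespace Network

variable {d : ℕ} {A : Type*} (N : Network d A) (H : A → ℝ → ℝ → ℝ)

/-- The maximal flux limiter `ĉ_z = min_{γ(1) = z} (- max_s min_ρ H_γ(s, ρ))`. -/
def fluxLimiter (z : EuclideanSpace ℝ (Fin d)) : ℝ :=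
  ⨅ γ : {γ : A // N.arc γ 1 = z}, -critVal (H γ)

open Classical in
/-- The overall Lagrangian `L(z, q)` of the network. At a vertex it is the maximal flux limiter
if `q = 0`, and otherwise the minimum of the `L_γ` over the arcs `γ` ending at `z` with velocity
parallel to `q`. At an interior point `z = γ(s)` of an arc it is given by `L_γ`; the two
orientations of the arc give the same value. It is only relevant for `z` in the network and `q`
tangent to the network at `z`. -/
def lagrangian (z q : EuclideanSpace ℝ (Fin d)) : ℝ :=
  if z ∈ N.vertices then
    if q = 0 then N.fluxLimiter H z
    else ⨅ γ : {γ : A // N.arc γ 1 = z ∧ ∃ c : ℝ, q = c • N.vel γ 1},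
      fenchel (H γ) 1 (inner ℝ q (N.vel γ 1) / ‖N.vel γ 1‖ ^ 2)
  else if h : ∃ p : A × ℝ, p.2 ∈ Ioo (0 : ℝ) 1 ∧ N.arc p.1 p.2 = z then
    let γ := h.choose.1
    let s := h.choose.2
    fenchel (H γ) s (inner ℝ q (N.vel γ s) / ‖N.vel γ s‖ ^ 2)
  else 0

open Classical in
/-- The action `∫₀ᵀ L(ζ, ζ') dt` of a curve; as `L` is bounded from below, it is `+∞` when the
integrand is not integrable. -/
def action (T : ℝ) (ζ : ℝ → EuclideanSpace ℝ (Fin d)) : EReal :=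
  if IntervalIntegrable (fun t => N.lagrangian H (ζ t) (deriv ζ t)) MeasureTheory.volume 0 T then
    ((∫ t in (0 : ℝ)..T, N.lagrangian H (ζ t) (deriv ζ t) : ℝ) : EReal)
  else ⊤

/-- The minimal action functional `Φ_L(z₁, z₂, T)`: infimum of the action over the curves in the
network defined on `[0, T]` that link `z₁` to `z₂`. -/
def minAction (z₁ z₂ : EuclideanSpace ℝ (Fin d)) (T : ℝ) : EReal :=
  ⨅ (ζ : ℝ → EuclideanSpace ℝ (Fin d)) (_ : N.IsCurve T ζ ∧ ζ 0 = z₁ ∧ ζ T = z₂), N.action H T ζ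

end Network

namespace PeriodicNetwork

variable {V₀ E₀ : Type*} [Finite E₀] {Γ₀ : OGraph V₀ E₀} {P : Γ₀.Orientation}
  {S : OGraph.SpanningTree P} {d : ℕ} {A : Type*} (N : PeriodicNetwork S d A)

/-- Periodic Hamiltonians `H = (H_γ)` on the network; only the values `H_γ(s, ρ)` with
`s ∈ [0, 1]` matter. -/
structure IsHamiltonian (H : A → ℝ → ℝ → ℝ) : Prop where
  compat : ∀ γ, ∀ s ∈ Icc (0 : ℝ) 1, ∀ ρ, H (N.rev γ) s ρ = H γ (1 - s) (-ρ)
  cont : ∀ γ ρ, ContinuousOn (fun s => H γ s ρ) (Icc 0 1)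
  diff : ∀ γ, ∀ s ∈ Icc (0 : ℝ) 1, ContDiff ℝ 1 (H γ s)
  convex : ∀ γ, ∀ s ∈ Icc (0 : ℝ) 1, StrictConvexOn ℝ univ (H γ s)
  superlinear : ∀ γ, ∀ M : ℝ, ∀ᶠ ρ in Filter.atTop, ∀ s ∈ Icc (0 : ℝ) 1, M ≤ H γ s ρ / ρ
  periodic : ∀ (k : OGraph.H₁ P) (γ : A), ∀ s ∈ Icc (0 : ℝ) 1, ∀ ρ,
    H (N.Ψ.edge.symm ((OGraph.translation S k).edge (N.Ψ.edge γ))) s ρ = H γ s ρ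

/-- First component of the vertex of the crystal corresponding to `z`. -/
def π₁ (z : N.vertices) : V₀ := (N.Ψ.vert z).1

/-- Second component of the vertex of the crystal corresponding to `z`. -/
def π₂ (z : N.vertices) : OGraph.H₁ P := (N.Ψ.vert z).2

/-- The Hamiltonian `H_e` of an edge `e` of `Γ₀`: the common Hamiltonian of the arcs that
correspond to `(e, h)` for some `h`. -/
def baseHam (H : A → ℝ → ℝ → ℝ) (e : E₀) : ℝ → ℝ → ℝ := H (N.Ψ.edge.symm (e, 0))

end PeriodicNetwork

/-! ### The discrete problem on the base graph -/

section Discrete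

variable {V₀ E₀ : Type*} (He : E₀ → ℝ → ℝ → ℝ)

/-- `σ_a⁺(e, s) = max {ρ | H_e(s, ρ) = a}`. -/
def sigmaPlus (e : E₀) (a s : ℝ) : ℝ := sSup {ρ | He e s ρ = a}

/-- `σ(e, a) = ∫₀¹ σ_a⁺(e, s) ds`, for `a ≥ a_e`. -/
def sigma (e : E₀) (a : ℝ) : ℝ := ∫ s in (0 : ℝ)..1, sigmaPlus He e a s

/-- The discrete Hamiltonian `ℋ(e, ·) : [b_e, ∞) → [a_e, ∞)`, `b_e = σ(e, a_e)`: the inverse of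
`σ(e, ·) : [a_e, ∞) → [b_e, ∞)`. -/
def discHam (e : E₀) : ℝ → ℝ := Function.invFunOn (sigma He e) (Ici (critVal (He e)))

/-- The discrete Lagrangian `ℒ(e, q) = max_{ρ ≥ b_e} (ρ q - ℋ(e, ρ))`, for `q ≥ 0`. -/
def discLag (e : E₀) (q : ℝ) : ℝ :=
  ⨆ ρ : Ici (sigma He e (critVal (He e))), (ρ : ℝ) * q - discHam He e ρ

/-- `IsParamPath Γ₀ x y ξ`: the list `ξ` of triples (edge, speed, time) is a parametrized path
from `x` to `y`, that is, a concatenation of edges travelled with speed `q > 0` in time `1 / q`,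
and of equilibrium circuits `(e, -e)` with vanishing speeds and arbitrary positive times. -/
inductive IsParamPath (Γ₀ : OGraph V₀ E₀) : V₀ → V₀ → List (E₀ × ℝ × ℝ) → Prop
  | nil (x : V₀) : IsParamPath Γ₀ x x []
  | move (e : E₀) (q : ℝ) (y : V₀) (l : List (E₀ × ℝ × ℝ)) :
      0 < q → IsParamPath Γ₀ (Γ₀.t e) y l → IsParamPath Γ₀ (Γ₀.o e) y ((e, q, 1 / q) :: l)
  | rest (e : E₀) (T₁ T₂ : ℝ) (y : V₀) (l : List (E₀ × ℝ × ℝ)) :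
      0 < T₁ → 0 < T₂ → IsParamPath Γ₀ (Γ₀.o e) y l →
        IsParamPath Γ₀ (Γ₀.o e) y ((e, 0, T₁) :: (Γ₀.neg e, 0, T₂) :: l)

/-- Total time `∑ Tᵢ` of a parametrized path. -/
def totalTime (ξ : List (E₀ × ℝ × ℝ)) : ℝ := (ξ.map fun p => p.2.2).sum

/-- Discrete action `∑ Tᵢ ℒ(eᵢ, qᵢ)` of a parametrized path. -/
def discAction (ξ : List (E₀ × ℝ × ℝ)) : ℝ := (ξ.map fun p => p.2.2 * discLag He p.1 p.2.1).sum

/-- The discrete minimal action functional `Φ_ℒ(x, y, T; h)`: infimum of the discrete action over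
the parametrized paths from `x` to `y` with total time `T` and rotation vector `h`. -/
def discMinAction [Finite E₀] {Γ₀ : OGraph V₀ E₀} {P : Γ₀.Orientation} (S : OGraph.SpanningTree P)
    (x y : V₀) (T : ℝ) (h : OGraph.H₁ P) : EReal :=
  ⨅ (ξ : List (E₀ × ℝ × ℝ)) (_ : IsParamPath Γ₀ x y ξ ∧ totalTime ξ = T ∧
    OGraph.rotation S (ξ.map Prod.fst) = h), ((discAction He ξ : ℝ) : EReal)

end Discrete

end

/-!
The discrete Lagrangian of an edge is `ℒ(e, q) = sup_a (σ(e, a) q - a)`, where `a` runs over the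
levels above the critical one. Both inequalities between the two minimal actions rest on this
formula.

*Upper bound.* A curve that runs along an arc `γ` with speed `∂H_γ/∂ρ` at the largest momentum of
level `a` has `L = ρ ṡ - a`, so its action is `σ(e, a)` minus `a` times the time of the crossing.
Every time `1/q` is, up to an error as small as desired, the crossing time of some level, or it is
longer than the crossing time of a level close to the critical one, and then the remaining time is
spent at rest at a point of the arc where `min_ρ H_γ` is maximal (`Tonelli.exists_level`,
`Tonelli.exists_flow`). Concatenation gives for every parametrized path of `Γ₀`, lifted to
the crystal, curves in the network with the same endpoints, the same duration and almost the same
action. Equilibrium circuits correspond to rests at a vertex, whose cost per unit of time is the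
minimal discrete one at speed `0`.

*Lower bound.* For an absolutely continuous curve, Fenchel's inequality gives
`L + a ≥ σ_a(s) ṡ`, the right-hand side being the derivative of the potential `∫ σ_a` along the
curve. A passage through an arc within time `τ` therefore costs at least `σ(e, a) - a τ` for all
`a`, that is `τ ℒ(e, 1/τ)` (`sig_sub_le_integral`), and an excursion from a vertex `z` back to `z`
inside the star of `z` costs at least `c_z` times its duration: on each arc the potential at level
`-c_z` has zero increment (`fluxLimiter_mul_le_integral`).

*Decomposition.* It remains to cut a curve into finitely many crossings and rests. There may be
infinitely many arcs, and nothing prevents other arcs from accumulating on a given one, so that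
connectedness alone does not confine a curve. But the length of an arc is at most the variation of
a curve that covers it; as lengths are bounded from below, a curve of small variation misses an
interior point of each arc. Cutting the arcs at these points leaves countably many disjoint closed
pieces, one around each vertex, and by Sierpiński's theorem, by which a compact interval is not a
countable disjoint union of at least two nonempty closed sets, the curve stays in one of them, hence
in the open star of one vertex (`exists_mem_openStar`). Induction over a fine subdivision of the
time interval carries along the last vertex visited and a parametrized path that accounts for the
curve up to there (`Tracked`, `TrackedOnArc`). The rotation vector comes out right since the second
component of a vertex of the crystal changes by `θ(e)` along an edge; for the same reason the
crystal has no loops, so that all arcs have distinct endpoints.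

*Finiteness.* Decomposition of any curve from `z₁` to `z₂` provides a parametrized path, which can
be run in any time `T`; and `ℒ(e, q) ≥ σ(e, a) q - a`, for a level `a` at which all `σ(e, a)` are
nonnegative, bounds every action from below.
-/

noncomputable section

/-! ### Tonelli Hamiltonians on an interval -/

/-- The largest momentum `ρ` with `h(s, ρ) = a`. -/
def topRoot (h : ℝ → ℝ → ℝ) (a s : ℝ) : ℝ := sSup {ρ | h s ρ = a}

/-- Hamiltonians `h(s, ρ)` with the properties imposed on the arcs of a network, extended to all
real `s` so as to be constant outside of `[0, 1]`. Superlinearity is encoded by the finiteness,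
uniform in `s`, of the Fenchel transform. -/
structure Tonelli (h : ℝ → ℝ → ℝ) : Prop where
  cont : ∀ ρ, Continuous fun s => h s ρ
  diff : ∀ s, ContDiff ℝ 1 (h s)
  convex : ∀ s, StrictConvexOn ℝ univ (h s)
  bound : ∀ q, ∃ C, ∀ s ρ, ρ * q - h s ρ ≤ C
  clamp : ∀ s, ∃ s' ∈ Icc (0 : ℝ) 1, h s = h s'

namespace Tonelli

variable {h : ℝ → ℝ → ℝ}

/-- Joint continuity: a convex function is controlled on a small interval by its values at the
centre and at the two ends. -/
theorem continuous_uncurry (hh : Tonelli h) : Continuous fun p : ℝ × ℝ => h p.1 p.2 := by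
  rw [continuous_iff_continuousAt]
  rintro ⟨s₀, r₀⟩
  rw [ContinuousAt, Metric.tendsto_nhds]
  intro ε hε
  have hc : Continuous (h s₀) := (hh.diff s₀).continuous
  obtain ⟨δ, hδ, hδ'⟩ := Metric.continuousAt_iff.1 hc.continuousAt (ε / 4) (by positivity)
  have key : ∀ r, |r - r₀| < δ → |h s₀ r - h s₀ r₀| < ε / 4 := fun r hr => by
    simpa [Real.dist_eq] using hδ' (by simpa [Real.dist_eq] using hr)
  have k1 := key (r₀ + δ / 2) (by rw [add_sub_cancel_left, abs_of_pos (by positivity)]; linarith)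
  have k2 := key (r₀ - δ / 2) (by
    rw [sub_sub_cancel_left, abs_neg, abs_of_pos (by positivity)]; linarith)
  have ev : ∀ r, ∀ᶠ s in nhds s₀, |h s r - h s₀ r| < ε / 8 := fun r => by
    have := Metric.tendsto_nhds.1 ((hh.cont r).continuousAt (x := s₀)) (ε / 8) (by positivity)
    simpa [Real.dist_eq] using this
  have ev2 : ∀ᶠ r in nhds r₀, |r - r₀| < δ / 2 := by
    have := Metric.ball_mem_nhds r₀ (half_pos hδ)
    filter_upwards [this] with r hr
    simpa [Real.dist_eq] using hr
  rw [nhds_prod_eq]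
  filter_upwards [((ev r₀).and ((ev (r₀ + δ / 2)).and (ev (r₀ - δ / 2)))).prod_mk ev2]
  rintro ⟨s, r⟩ ⟨⟨e1, e2, e3⟩, e4⟩
  simp only at e1 e2 e3 e4
  have hup : ∀ x, |x - r₀| < δ / 2 → h s x ≤ max (h s (r₀ - δ / 2)) (h s (r₀ + δ / 2)) := by
    intro x hx
    rw [abs_lt] at hx
    exact (hh.convex s).convexOn.le_max_of_mem_Icc (mem_univ _) (mem_univ _)
      ⟨by linarith, by linarith⟩
  have hmax : max (h s (r₀ - δ / 2)) (h s (r₀ + δ / 2)) < h s₀ r₀ + 3 * ε / 8 := by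
    rw [abs_lt] at *
    exact max_lt (by linarith) (by linarith)
  have u1 := hup r e4
  have u2 := hup (2 * r₀ - r) (by rw [← abs_neg]; convert e4 using 2; ring)
  have mid : h s r₀ ≤ (1 / 2) * h s r + (1 / 2) * h s (2 * r₀ - r) := by
    have := (hh.convex s).convexOn.2 (mem_univ r) (mem_univ (2 * r₀ - r))
      (by norm_num : (0 : ℝ) ≤ 1 / 2) (by norm_num : (0 : ℝ) ≤ 1 / 2) (by norm_num)
    simp only [smul_eq_mul] at this
    rwa [show (1 : ℝ) / 2 * r + 1 / 2 * (2 * r₀ - r) = r₀ by ring] at this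
  rw [Real.dist_eq, abs_lt]
  rw [abs_lt] at e1
  constructor <;> linarith

theorem continuous_slice (hh : Tonelli h) (s : ℝ) : Continuous (h s) := (hh.diff s).continuous

theorem hasDerivAt (hh : Tonelli h) (s r : ℝ) : HasDerivAt (h s) (deriv (h s) r) r :=
  ((hh.diff s).differentiable one_ne_zero r).hasDerivAt

theorem tangent_le (hh : Tonelli h) (s r x : ℝ) : h s r + deriv (h s) r * (x - r) ≤ h s x := by
  have hc := (hh.convex s).convexOn
  have hd := hh.hasDerivAt s r
  rcases lt_trichotomy x r with hx | hx | hx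
  · have := hc.slope_le_of_hasDerivAt (mem_univ x) (mem_univ r) hx hd
    rw [slope_def_field, div_le_iff₀ (by linarith)] at this
    linarith
  · simp [hx]
  · have := hc.le_slope_of_hasDerivAt (mem_univ r) (mem_univ x) hx hd
    rw [slope_def_field, le_div_iff₀ (by linarith)] at this
    linarith

/-- The derivative in the momentum is jointly continuous, being squeezed between difference
quotients. -/
theorem continuous_deriv (hh : Tonelli h) : Continuous fun p : ℝ × ℝ => deriv (h p.1) p.2 := by
  have hj := hh.continuous_uncurry
  rw [continuous_iff_continuousAt]
  rintro ⟨s₀, r₀⟩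
  rw [ContinuousAt, Metric.tendsto_nhds]
  intro ε hε
  have hd := hh.hasDerivAt s₀ r₀
  rw [hasDerivAt_iff_tendsto_slope_zero] at hd
  have hd' := Metric.tendsto_nhds.1 hd (ε / 2) (by positivity)
  rw [eventually_nhdsWithin_iff, Metric.eventually_nhds_iff] at hd'
  obtain ⟨δ, hδ, hδ'⟩ := hd'
  have k1 := @hδ' (δ / 2) (by simp [abs_of_pos hδ]; linarith) (by simp; positivity)
  have k2 := @hδ' (-(δ / 2)) (by simp [abs_of_pos hδ]; linarith) (by simp; positivity)
  simp only [smul_eq_mul, Real.dist_eq] at k1 k2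
  have c1 : Continuous fun p : ℝ × ℝ => (δ / 2)⁻¹ * (h p.1 (p.2 + δ / 2) - h p.1 p.2) :=
    continuous_const.mul ((hj.comp (continuous_fst.prodMk
      (continuous_snd.add continuous_const))).sub hj)
  have c2 : Continuous fun p : ℝ × ℝ => (-(δ / 2))⁻¹ * (h p.1 (p.2 + -(δ / 2)) - h p.1 p.2) :=
    continuous_const.mul ((hj.comp (continuous_fst.prodMk
      (continuous_snd.add continuous_const))).sub hj)
  have d1 := Metric.tendsto_nhds.1 (c1.continuousAt (x := (s₀, r₀))) (ε / 2) (by positivity)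
  have d2 := Metric.tendsto_nhds.1 (c2.continuousAt (x := (s₀, r₀))) (ε / 2) (by positivity)
  filter_upwards [d1, d2]
  rintro ⟨s, r⟩ e1 e2
  simp only [Real.dist_eq] at e1 e2 ⊢
  have t1 := hh.tangent_le s r (r + δ / 2)
  have t2 := hh.tangent_le s r (r + -(δ / 2))
  have u1 : deriv (h s) r ≤ (δ / 2)⁻¹ * (h s (r + δ / 2) - h s r) := by
    rw [inv_mul_eq_div, le_div_iff₀ (by positivity)]; linarith
  have u2 : (-(δ / 2))⁻¹ * (h s (r + -(δ / 2)) - h s r) ≤ deriv (h s) r := by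
    rw [inv_neg, neg_mul, inv_mul_eq_div, ← neg_div, div_le_iff₀ (by positivity)]; linarith
  rw [abs_lt] at *
  constructor <;> linarith

theorem bddBelow (hh : Tonelli h) (s : ℝ) : BddBelow (range (h s)) := by
  obtain ⟨C, hC⟩ := hh.bound 0
  refine ⟨-C, ?_⟩
  rintro _ ⟨ρ, rfl⟩
  have := hC s ρ
  linarith

theorem exists_min (hh : Tonelli h) (s : ℝ) : ∃ r, h s r = ⨅ ρ, h s ρ := by
  obtain ⟨C, hC⟩ := hh.bound 1
  obtain ⟨D, hD⟩ := hh.bound (-1)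
  have ht : Filter.Tendsto (h s) (Filter.cocompact ℝ) Filter.atTop := by
    have h1 : Filter.Tendsto (fun x : ℝ => ‖x‖ - max C D) (Filter.cocompact ℝ) Filter.atTop :=
      Filter.tendsto_atTop_add_const_right _ _ tendsto_norm_cocompact_atTop
    refine Filter.tendsto_atTop_mono (fun x => ?_) h1
    have a1 := hC s x
    have a2 := hD s x
    have a3 := le_max_left C D
    have a4 := le_max_right C D
    rw [Real.norm_eq_abs]
    rcases abs_cases x with ⟨e, -⟩ | ⟨e, -⟩ <;> rw [e] <;> linarith
  obtain ⟨r, hr⟩ := (hh.continuous_slice s).exists_forall_le ht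
  exact ⟨r, le_antisymm (le_ciInf hr) (ciInf_le (hh.bddBelow s) r)⟩

theorem exists_eq_of_le (hh : Tonelli h) {s x a : ℝ} (hx : h s x ≤ a) :
    ∃ y, x ≤ y ∧ h s y = a := by
  obtain ⟨C, hC⟩ := hh.bound 1
  have h1 : a ≤ h s (max x (a + C)) := by
    have := hC s (max x (a + C))
    have := le_max_right x (a + C)
    linarith
  obtain ⟨y, hy, hy'⟩ := intermediate_value_Icc (le_max_left x (a + C))
    (hh.continuous_slice s).continuousOn ⟨hx, h1⟩
  exact ⟨y, hy.1, hy'⟩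

theorem bddAbove_level (hh : Tonelli h) (s a : ℝ) : BddAbove {ρ | h s ρ = a} := by
  obtain ⟨C, hC⟩ := hh.bound 1
  refine ⟨a + C, fun ρ hρ => ?_⟩
  have := hC s ρ
  rw [mem_ofPred_eq] at hρ
  linarith

theorem le_topRoot (hh : Tonelli h) {s x a : ℝ} (hx : h s x ≤ a) : x ≤ topRoot h a s := by
  obtain ⟨y, hy, hy'⟩ := hh.exists_eq_of_le hx
  exact hy.trans (le_csSup (hh.bddAbove_level s a) hy')

theorem apply_topRoot (hh : Tonelli h) {s a : ℝ} (ha : (⨅ ρ, h s ρ) ≤ a) :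
    h s (topRoot h a s) = a := by
  obtain ⟨r, hr⟩ := hh.exists_min s
  obtain ⟨y, -, hy'⟩ := hh.exists_eq_of_le (hr.trans_le ha)
  exact (isClosed_singleton.preimage (hh.continuous_slice s)).csSup_mem ⟨y, hy'⟩
    (hh.bddAbove_level s a)

theorem lt_of_topRoot_lt (hh : Tonelli h) {s x a : ℝ} (hx : topRoot h a s < x) : a < h s x := by
  by_contra! hc
  exact hx.not_ge (hh.le_topRoot hc)

theorem bddAbove_inf (hh : Tonelli h) :
    BddAbove (range fun s : Icc (0 : ℝ) 1 => ⨅ ρ : ℝ, h s ρ) := by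
  obtain ⟨C, hC⟩ := (isCompact_Icc (a := (0 : ℝ)) (b := 1)).bddAbove_image
    (hh.cont 0).continuousOn
  refine ⟨C, ?_⟩
  rintro _ ⟨s, rfl⟩
  exact (ciInf_le (hh.bddBelow s) 0).trans (hC ⟨s, s.2, rfl⟩)

theorem inf_le_critVal (hh : Tonelli h) (s : ℝ) : (⨅ ρ, h s ρ) ≤ critVal h := by
  obtain ⟨s', hs', he⟩ := hh.clamp s
  rw [he]
  exact le_ciSup hh.bddAbove_inf (⟨s', hs'⟩ : Icc (0 : ℝ) 1)

theorem apply_topRoot' (hh : Tonelli h) {s a : ℝ} (ha : critVal h ≤ a) :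
    h s (topRoot h a s) = a := hh.apply_topRoot ((hh.inf_le_critVal s).trans ha)

theorem topRoot_lt (hh : Tonelli h) {a b s : ℝ} (ha : critVal h ≤ a) (hab : a < b) :
    topRoot h a s < topRoot h b s := by
  have h1 := hh.apply_topRoot' (s := s) ha
  have h2 := hh.apply_topRoot' (s := s) (ha.trans hab.le)
  refine lt_of_le_of_ne (hh.le_topRoot (h1.trans_le hab.le)) fun he => ?_
  rw [he, h2] at h1
  exact hab.ne' h1

/-- Strict convexity makes `h(s, ·)` increase to the right of the largest root. -/
theorem lt_of_topRoot_le (hh : Tonelli h) {a s x y : ℝ} (ha : critVal h ≤ a)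
    (hx : topRoot h a s ≤ x) (hxy : x < y) : h s x < h s y := by
  have h1 := hh.apply_topRoot' (s := s) ha
  have h2 := hh.lt_of_topRoot_lt (hx.trans_lt hxy)
  rcases hx.eq_or_lt with he | hlt
  · rw [← he, h1]; exact h2
  · have := (hh.convex s).lt_on_openSegment (mem_univ (topRoot h a s)) (mem_univ y)
      (hlt.trans hxy).ne (by rw [openSegment_eq_Ioo (hlt.trans hxy)]; exact ⟨hlt, hxy⟩)
    rw [h1, max_eq_right h2.le] at this
    exact this

theorem continuous_topRoot (hh : Tonelli h) :
    Continuous fun p : ℝ × ℝ => topRoot h (max p.1 (critVal h)) p.2 := by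
  have hj := hh.continuous_uncurry
  rw [continuous_iff_continuousAt]
  rintro ⟨a₀, s₀⟩
  rw [ContinuousAt, Metric.tendsto_nhds]
  intro ε hε
  set c := critVal h
  have hm : ∀ a, c ≤ max a c := fun a => le_max_right _ _
  set r := topRoot h (max a₀ c) s₀ with hr
  have hr0 : h s₀ r = max a₀ c := hh.apply_topRoot' (hm a₀)
  have hcs : ∀ x, Continuous fun p : ℝ × ℝ => h p.2 x := fun x => (hh.cont x).comp continuous_snd
  have hca : Continuous fun p : ℝ × ℝ => max p.1 c := continuous_fst.max continuous_const
  have up : ∀ᶠ p in nhds (a₀, s₀), topRoot h (max p.1 c) p.2 < r + ε := by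
    have b1 : max a₀ c < h s₀ (r + ε) := hh.lt_of_topRoot_lt (by linarith)
    have e1 := (hca.continuousAt (x := (a₀, s₀))).eventually_lt
      ((hcs (r + ε)).continuousAt (x := (a₀, s₀))) b1
    have e2 := ((hcs r).continuousAt (x := (a₀, s₀))).eventually_lt
      ((hcs (r + ε)).continuousAt (x := (a₀, s₀))) (by simpa [hr0] using b1)
    filter_upwards [e1, e2] with p h1 h2
    by_contra! hc
    have h3 := hh.apply_topRoot' (s := p.2) (hm p.1)
    have := (hh.convex p.2).convexOn.le_max_of_mem_Icc (mem_univ r)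
      (mem_univ (topRoot h (max p.1 c) p.2)) (z := r + ε) ⟨by linarith, hc⟩
    rw [h3] at this
    exact (max_lt h2 h1).not_ge this
  have low : ∀ᶠ p in nhds (a₀, s₀), r - ε < topRoot h (max p.1 c) p.2 := by
    by_cases hcase : h s₀ r < h s₀ (r - ε)
    · have e1 := ((hcs r).continuousAt (x := (a₀, s₀))).eventually_lt
        ((hcs (r - ε)).continuousAt (x := (a₀, s₀))) hcase
      filter_upwards [e1] with p h1
      by_contra! hc
      exact (hh.lt_of_topRoot_le (hm p.1) hc (by linarith : r - ε < r)).not_gt h1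
    · push Not at hcase
      have := (hh.convex s₀).lt_on_openSegment (mem_univ (r - ε)) (mem_univ r)
        (by linarith) (z := r - ε / 2)
        (by rw [openSegment_eq_Ioo (by linarith)]; constructor <;> linarith)
      rw [max_eq_right hcase, hr0] at this
      have e1 := ((hcs (r - ε / 2)).continuousAt (x := (a₀, s₀))).eventually_lt
        (hca.continuousAt (x := (a₀, s₀))) this
      filter_upwards [e1] with p h1
      have := hh.le_topRoot h1.le
      linarith
  filter_upwards [up, low] with p h1 h2
  rw [Real.dist_eq, abs_lt]
  constructor <;> linarith

theorem continuous_topRoot_right (hh : Tonelli h) {a : ℝ} (ha : critVal h ≤ a) :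
    Continuous (topRoot h a) := by
  have := hh.continuous_topRoot.comp (Continuous.prodMk_right a)
  simpa only [Function.comp_def, max_eq_left ha] using this

/-! ### The functions `σ`, `ℋ` and `ℒ` -/

/-- The integral of the largest root over the arc: `σ(e, a)` for a single Hamiltonian. -/
def sig (h : ℝ → ℝ → ℝ) (a : ℝ) : ℝ := ∫ s in (0 : ℝ)..1, topRoot h a s

theorem intervalIntegrable_topRoot (hh : Tonelli h) {a : ℝ} (ha : critVal h ≤ a) (x y : ℝ) :
    IntervalIntegrable (topRoot h a) MeasureTheory.volume x y :=
  (hh.continuous_topRoot_right ha).intervalIntegrable x y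

theorem continuous_sig (hh : Tonelli h) : Continuous fun a => sig h (max a (critVal h)) :=
  intervalIntegral.continuous_parametric_intervalIntegral_of_continuous'
    (f := fun a s => topRoot h (max a (critVal h)) s) hh.continuous_topRoot 0 1

theorem sig_lt (hh : Tonelli h) {a b : ℝ} (ha : critVal h ≤ a) (hab : a < b) :
    sig h a < sig h b := by
  have hb := ha.trans hab.le
  refine intervalIntegral.integral_lt_integral_of_continuousOn_of_le_of_exists_lt zero_lt_one
    (hh.continuous_topRoot_right ha).continuousOn (hh.continuous_topRoot_right hb).continuousOn
    (fun s _ => (hh.topRoot_lt ha hab).le) ⟨0, by simp, hh.topRoot_lt ha hab⟩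

theorem exists_le_sig (hh : Tonelli h) (R : ℝ) : ∃ a, critVal h ≤ a ∧ R ≤ sig h a := by
  obtain ⟨C, hC⟩ := (isCompact_Icc (a := (0 : ℝ)) (b := 1)).bddAbove_image
    (hh.cont R).continuousOn
  refine ⟨max C (critVal h), le_max_right _ _, ?_⟩
  have : ∫ s in (0 : ℝ)..1, R ≤ sig h (max C (critVal h)) := by
    refine intervalIntegral.integral_mono_on zero_le_one (by simp)
      (hh.intervalIntegrable_topRoot (le_max_right _ _) _ _) fun s hs => ?_
    exact hh.le_topRoot ((hC ⟨s, hs, rfl⟩).trans (le_max_left _ _))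
  simpa using this

theorem exists_sig_eq (hh : Tonelli h) {ρ : ℝ} (hρ : sig h (critVal h) ≤ ρ) :
    ∃ a, critVal h ≤ a ∧ sig h a = ρ := by
  obtain ⟨b, hb, hb'⟩ := hh.exists_le_sig ρ
  obtain ⟨a, ha, ha'⟩ := intermediate_value_Icc hb hh.continuous_sig.continuousOn
    (show ρ ∈ Icc _ _ by simpa [max_eq_left hb] using ⟨hρ, hb'⟩)
  exact ⟨a, ha.1, by simpa [max_eq_left ha.1] using ha'⟩

/-- `σ` grows sublinearly. -/
theorem sig_mul_sub_le (hh : Tonelli h) (q : ℝ) :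
    ∃ C, ∀ a, critVal h ≤ a → sig h a * q - a ≤ C := by
  obtain ⟨C, hC⟩ := hh.bound q
  refine ⟨C, fun a ha => ?_⟩
  have : ∫ s in (0 : ℝ)..1, (topRoot h a s * q - a) ≤ ∫ s in (0 : ℝ)..1, C := by
    refine intervalIntegral.integral_mono_on zero_le_one
      (((hh.continuous_topRoot_right ha).mul continuous_const).sub
        continuous_const |>.intervalIntegrable _ _) (by simp) fun s hs => ?_
    have := hC s (topRoot h a s)
    rwa [hh.apply_topRoot' ha] at this
  have e : ∫ s in (0 : ℝ)..1, (topRoot h a s * q - a) = sig h a * q - a := by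
    rw [intervalIntegral.integral_sub ((hh.intervalIntegrable_topRoot ha _ _).mul_const q)
      (by simp), intervalIntegral.integral_mul_const]
    simp [sig]
  rw [e] at this
  simpa using this

/-- The speed `∂h/∂ρ` along the largest root at the level `a`. -/
def speed (h : ℝ → ℝ → ℝ) (a s : ℝ) : ℝ := deriv (h s) (topRoot h a s)

theorem speed_pos (hh : Tonelli h) {a s : ℝ} (ha : critVal h < a) : 0 < speed h a s := by
  obtain ⟨r, hr⟩ := hh.exists_min s
  have h1 := hh.apply_topRoot' (s := s) ha.le
  have h2 : h s r < a := hr.trans_lt ((hh.inf_le_critVal s).trans_lt ha)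
  have h3 := hh.le_topRoot h2.le
  have h4 := hh.tangent_le s (topRoot h a s) r
  rw [h1] at h4
  by_contra! hc
  have : 0 ≤ deriv (h s) (topRoot h a s) * (r - topRoot h a s) :=
    mul_nonneg_of_nonpos_of_nonpos hc (by linarith)
  linarith

theorem continuous_speed (hh : Tonelli h) :
    Continuous fun p : ℝ × ℝ => speed h (max p.1 (critVal h)) p.2 :=
  hh.continuous_deriv.comp (continuous_snd.prodMk hh.continuous_topRoot)

theorem continuous_speed_right (hh : Tonelli h) {a : ℝ} (ha : critVal h ≤ a) :
    Continuous (speed h a) := by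
  have := hh.continuous_speed.comp (Continuous.prodMk_right a)
  simpa only [Function.comp_def, max_eq_left ha] using this

/-- Time needed to travel along the arc at the level `a`. -/
def travelTime (h : ℝ → ℝ → ℝ) (a : ℝ) : ℝ := ∫ s in (0 : ℝ)..1, (speed h a s)⁻¹

theorem continuous_inv_speed (hh : Tonelli h) {a : ℝ} (ha : critVal h < a) :
    Continuous fun s => (speed h a s)⁻¹ :=
  (hh.continuous_speed_right ha.le).inv₀ fun _ => (hh.speed_pos ha).ne'

theorem continuousOn_travelTime (hh : Tonelli h) {a₁ : ℝ} (ha₁ : critVal h < a₁) :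
    ContinuousOn (travelTime h) (Ici a₁) := by
  have hc : Continuous fun p : ℝ × ℝ => (speed h (max p.1 a₁) p.2)⁻¹ := by
    have h1 : Continuous fun p : ℝ × ℝ => speed h (max p.1 a₁) p.2 := by
      have := hh.continuous_speed.comp
        ((continuous_fst.max continuous_const).prodMk continuous_snd :
          Continuous fun p : ℝ × ℝ => (max p.1 a₁, p.2))
      refine this.congr fun p => ?_
      simp only [Function.comp_apply]
      rw [max_eq_left (ha₁.le.trans (le_max_right p.1 a₁))]
    exact h1.inv₀ fun p => (hh.speed_pos (ha₁.trans_le (le_max_right _ _))).ne'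
  have := intervalIntegral.continuous_parametric_intervalIntegral_of_continuous'
    (μ := MeasureTheory.volume) (f := fun a s => (speed h (max a a₁) s)⁻¹) hc 0 1
  refine this.continuousOn.congr fun a ha => ?_
  simp only [travelTime, max_eq_left (mem_Ici.1 ha)]

/-- The travel time is a supergradient of the concave function `σ`. -/
theorem travelTime_mul_le (hh : Tonelli h) {a : ℝ} (ha : critVal h < a) :
    travelTime h a * (a - critVal h) ≤ sig h a - sig h (critVal h) := by
  rw [travelTime, sig, sig, ← intervalIntegral.integral_mul_const,
    ← intervalIntegral.integral_sub (hh.intervalIntegrable_topRoot ha.le _ _)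
      (hh.intervalIntegrable_topRoot le_rfl _ _)]
  refine intervalIntegral.integral_mono_on zero_le_one
    (((hh.continuous_inv_speed ha).mul continuous_const).intervalIntegrable _ _)
    ((hh.intervalIntegrable_topRoot ha.le _ _).sub (hh.intervalIntegrable_topRoot le_rfl _ _))
    fun s _ => ?_
  have h1 := hh.apply_topRoot' (s := s) ha.le
  have h2 := hh.apply_topRoot' (s := s) le_rfl
  have h3 := hh.tangent_le s (topRoot h a s) (topRoot h (critVal h) s)
  rw [h1, h2] at h3
  have h4 := hh.speed_pos (s := s) ha
  rw [inv_mul_le_iff₀ h4]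
  unfold speed
  linarith

theorem exists_travelTime_lt (hh : Tonelli h) {T : ℝ} (hT : 0 < T) :
    ∃ a, critVal h < a ∧ travelTime h a < T := by
  obtain ⟨C, hC⟩ := hh.sig_mul_sub_le (2 / T)
  set c := critVal h
  set a := max (c + 1) (C + 2 * c - sig h c * (2 / T) + 1) with ha
  have ha1 : c < a := by have := le_max_left (c + 1) (C + 2 * c - sig h c * (2 / T) + 1); linarith
  have ha2 := le_max_right (c + 1) (C + 2 * c - sig h c * (2 / T) + 1)
  rw [← ha] at ha2
  refine ⟨a, ha1, ?_⟩
  have h1 := hh.travelTime_mul_le ha1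
  have h2 := hC a ha1.le
  by_contra! hc
  have h3 : T * (a - c) ≤ sig h a - sig h c :=
    (mul_le_mul_of_nonneg_right hc (by linarith)).trans h1
  have h4 : 2 * (a - c) ≤ (sig h a - sig h c) * (2 / T) := by
    calc 2 * (a - c) = T * (a - c) * (2 / T) := by field_simp
      _ ≤ _ := mul_le_mul_of_nonneg_right h3 (by positivity)
  nlinarith

/-- Every travel time `T` is either the time of a level `a`, or exceeds the times of all levels,
and then waiting at the critical level completes it. Both cases are covered by a level whose
travel time is at most `T`, and for which the waiting costs little. -/
theorem exists_level (hh : Tonelli h) {T ε : ℝ} (hT : 0 < T) (hε : 0 < ε) :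
    ∃ a, critVal h < a ∧ travelTime h a ≤ T ∧ (a - critVal h) * (T - travelTime h a) ≤ ε := by
  by_cases hcase : ∃ a, critVal h < a ∧ T ≤ travelTime h a
  · obtain ⟨a, ha, ha'⟩ := hcase
    obtain ⟨b, hb, hb'⟩ := hh.exists_travelTime_lt hT
    have hmin : critVal h < min a b := lt_min ha hb
    have hcon := (hh.continuousOn_travelTime hmin)
    have hsub : uIcc b a ⊆ Ici (min a b) := fun x hx => by
      rw [uIcc_comm] at hx; exact hx.1
    obtain ⟨x, hx, hx'⟩ := intermediate_value_uIcc (hcon.mono hsub)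
      (show T ∈ uIcc _ _ from mem_uIcc.2 (Or.inl ⟨hb'.le, ha'⟩))
    refine ⟨x, hmin.trans_le (hsub hx), hx'.le, ?_⟩
    rw [hx', sub_self, mul_zero]
    exact hε.le
  · push Not at hcase
    refine ⟨critVal h + ε / T, by simp; positivity, (hcase _ (by simp; positivity)).le, ?_⟩
    have hpos : 0 ≤ travelTime h (critVal h + ε / T) :=
      intervalIntegral.integral_nonneg zero_le_one fun s _ =>
        inv_nonneg.2 (hh.speed_pos (by simp; positivity)).le
    rw [add_sub_cancel_left]
    calc ε / T * (T - travelTime h (critVal h + ε / T)) ≤ ε / T * T :=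
          mul_le_mul_of_nonneg_left (by linarith) (by positivity)
      _ = ε := by field_simp

theorem bddAbove_fenchel (hh : Tonelli h) (s q : ℝ) :
    BddAbove (range fun ρ : ℝ => ρ * q - h s ρ) := by
  obtain ⟨C, hC⟩ := hh.bound q
  exact ⟨C, by rintro _ ⟨ρ, rfl⟩; exact hC s ρ⟩

theorem topRoot_mul_sub_le_fenchel (hh : Tonelli h) {a : ℝ} (ha : critVal h ≤ a) (s q : ℝ) :
    topRoot h a s * q - a ≤ fenchel h s q := by
  have := le_ciSup (hh.bddAbove_fenchel s q) (topRoot h a s)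
  rwa [hh.apply_topRoot' ha] at this

theorem fenchel_speed (hh : Tonelli h) {a : ℝ} (ha : critVal h ≤ a) (s : ℝ) :
    fenchel h s (speed h a s) = topRoot h a s * speed h a s - a := by
  refine le_antisymm (ciSup_le fun ρ => ?_) (hh.topRoot_mul_sub_le_fenchel ha s _)
  have := hh.tangent_le s (topRoot h a s) ρ
  rw [hh.apply_topRoot' ha] at this
  unfold speed
  linarith

theorem fenchel_zero (h : ℝ → ℝ → ℝ) (s : ℝ) : fenchel h s 0 = -⨅ ρ, h s ρ := by
  simp only [fenchel, mul_zero, zero_sub]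
  rw [iSup, iInf, Real.sInf_def, neg_neg]
  congr 1
  ext x
  simp [neg_eq_iff_eq_neg]

/-! ### The discrete Lagrangian of a single edge -/

/-- The discrete Hamiltonian `ℋ` of a single edge, the inverse of `σ` on the levels above the
critical one. -/
def dham (h : ℝ → ℝ → ℝ) : ℝ → ℝ := Function.invFunOn (sig h) (Ici (critVal h))

/-- The discrete Lagrangian `ℒ` of a single edge, the transform of `ℋ` over its domain. -/
def dlag (h : ℝ → ℝ → ℝ) (q : ℝ) : ℝ := ⨆ ρ : Ici (sig h (critVal h)), (ρ : ℝ) * q - dham h ρ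

theorem dham_sig (hh : Tonelli h) {a : ℝ} (ha : critVal h ≤ a) : dham h (sig h a) = a := by
  have hinj : InjOn (sig h) (Ici (critVal h)) := by
    have : StrictMonoOn (sig h) (Ici (critVal h)) := fun x hx y _ hxy => hh.sig_lt hx hxy
    exact this.injOn
  exact hinj.leftInvOn_invFunOn ha

/-- The discrete Lagrangian is a supremum over the levels: `ℒ(q) = sup_{a ≥ a_e} (σ(a) q - a)`. -/
theorem dlag_le (hh : Tonelli h) {q M : ℝ} (hM : ∀ a, critVal h ≤ a → sig h a * q - a ≤ M) :
    dlag h q ≤ M := by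
  have : Nonempty (Ici (sig h (critVal h))) := ⟨⟨_, self_mem_Ici⟩⟩
  refine ciSup_le fun ρ => ?_
  obtain ⟨a, ha, ha'⟩ := hh.exists_sig_eq ρ.2
  rw [← ha', hh.dham_sig ha]
  exact hM a ha

theorem le_dlag (hh : Tonelli h) (q : ℝ) {a : ℝ} (ha : critVal h ≤ a) :
    sig h a * q - a ≤ dlag h q := by
  obtain ⟨C, hC⟩ := hh.sig_mul_sub_le q
  have hle : sig h (critVal h) ≤ sig h a := by
    rcases ha.eq_or_lt with h1 | h1
    · rw [← h1]
    · exact (hh.sig_lt le_rfl h1).le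
  have hb : BddAbove (range fun ρ : Ici (sig h (critVal h)) => (ρ : ℝ) * q - dham h ρ) := by
    refine ⟨C, ?_⟩
    rintro _ ⟨ρ, rfl⟩
    obtain ⟨a, ha, ha'⟩ := hh.exists_sig_eq ρ.2
    simp only [← ha', hh.dham_sig ha]
    exact hC a ha
  have := le_ciSup hb ⟨sig h a, hle⟩
  rwa [hh.dham_sig ha] at this

theorem dlag_zero (hh : Tonelli h) : dlag h 0 = -critVal h := by
  refine le_antisymm (hh.dlag_le fun a ha => by linarith) ?_
  have := hh.le_dlag 0 (le_refl (critVal h))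
  linarith

end Tonelli

/-! ### Curves: variation, Hausdorff measure, absolute continuity -/

theorem IsPreconnected.subset_of_iUnion_isOpen {X ι : Type*} [TopologicalSpace X] {s : Set X}
    (hs : IsPreconnected s) {U : ι → Set X} (hU : ∀ i, IsOpen (U i))
    (hd : Pairwise (Function.onFun Disjoint U)) (hsU : s ⊆ ⋃ i, U i) {i : ι}
    (hi : (s ∩ U i).Nonempty) : s ⊆ U i := by
  refine hs.subset_left_of_subset_union (hU i) (v := ⋃ j : {j // j ≠ i}, U j)
    (isOpen_iUnion fun j => hU j) ?_ ?_ hi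
  · exact disjoint_iUnion_right.2 fun j => hd j.2.symm
  · intro x hx
    obtain ⟨j, hj⟩ := mem_iUnion.1 (hsU hx)
    by_cases hji : j = i
    · exact Or.inl (hji ▸ hj)
    · exact Or.inr (mem_iUnion.2 ⟨⟨j, hji⟩, hj⟩)

/-- Sierpiński's theorem for the line: it is not the union of countably many, and at least two,
pairwise disjoint nonempty closed sets. The set `B` of points interior to no member of the family
is closed; were it nonempty, by Baire's theorem it would meet some ball within a single member, and
then this ball would lie in this member. -/
theorem exists_eq_univ_of_countable_closed {ι : Type*} [Countable ι] {F : ι → Set ℝ}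
    (hF : ∀ i, IsClosed (F i)) (hd : Pairwise (Function.onFun Disjoint F))
    (hcov : ⋃ i, F i = univ) : ∃ i, F i = univ := by
  set U : ι → Set ℝ := fun i => interior (F i) with hU
  have hUo : ∀ i, IsOpen (U i) := fun i => isOpen_interior
  have hUd : Pairwise (Function.onFun Disjoint U) := fun i j hij =>
    (hd hij).mono interior_subset interior_subset
  set B : Set ℝ := (⋃ i, U i)ᶜ with hB
  have hBc : IsClosed B := (isOpen_iUnion hUo).isClosed_compl
  by_cases hne : B.Nonempty
  · exfalso
    have : Nonempty B := hne.to_subtype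
    have : CompleteSpace B := hBc.completeSpace_coe
    obtain ⟨i, ⟨x, hxB⟩, hx⟩ := nonempty_interior_of_iUnion_of_closed
      (f := fun i => ((↑) : B → ℝ) ⁻¹' F i) (fun i => (hF i).preimage continuous_subtype_val)
      (by rw [← preimage_iUnion, hcov, preimage_univ])
    rw [mem_interior_iff_mem_nhds, Metric.mem_nhds_iff] at hx
    obtain ⟨ε, hε, hball⟩ := hx
    have hballF : Metric.ball x ε ⊆ F i := by
      intro y hy
      by_cases hyB : y ∈ B
      · exact hball (show (⟨y, hyB⟩ : B) ∈ Metric.ball (⟨x, hxB⟩ : B) ε from hy)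
      · -- `z` is the point of `B` between `x` and `y` closest to `y`
        obtain ⟨z, ⟨hzB, hzxy⟩, hz⟩ := ((isCompact_uIcc (a := x) (b := y)).inter_left
          hBc).exists_isMinOn ⟨x, hxB, left_mem_uIcc⟩
          (f := fun w => dist w y) (by fun_prop)
        have hzy : z ≠ y := fun h => hyB (h ▸ hzB)
        set S : Set ℝ := uIcc x y ∩ Metric.ball y (dist z y)
        have hSc : IsPreconnected S :=
          ((convex_uIcc x y).inter (convex_ball y _)).isPreconnected
        have hyS : y ∈ S := ⟨right_mem_uIcc, by simp [hzy]⟩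
        have hSU : S ⊆ ⋃ i, U i := by
          intro w hw
          by_contra hwB
          have h1 : dist z y ≤ dist w y := isMinOn_iff.1 hz w ⟨hwB, hw.1⟩
          exact h1.not_gt hw.2
        obtain ⟨j, hj⟩ := mem_iUnion.1 (hSU hyS)
        have hSj : S ⊆ F j :=
          (hSc.subset_of_iUnion_isOpen hUo hUd hSU ⟨y, hyS, hj⟩).trans interior_subset
        have hzcl : z ∈ closure S := by
          have h1 : openSegment ℝ z y ⊆ S := by
            intro w hw
            have hseg := openSegment_subset_segment ℝ z y hw
            refine ⟨(convex_uIcc x y).segment_subset hzxy right_mem_uIcc hseg, ?_⟩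
            obtain ⟨p, q, hp, hq, hpq, rfl⟩ := hw
            have : dist (p • z + q • y) y = p * dist z y := by
              rw [Real.dist_eq, Real.dist_eq, show p • z + q • y - y = p * (z - y) by
                simp only [smul_eq_mul]; rw [show q = 1 - p by linarith]; ring, abs_mul,
                abs_of_pos hp]
            rw [Metric.mem_ball, this]
            have := dist_pos.2 hzy
            nlinarith
          have h2 : z ∈ closure (openSegment ℝ z y) := by
            rw [closure_openSegment]; exact left_mem_segment ℝ z y
          exact closure_mono h1 h2
        have hzj : z ∈ F j := closure_minimal hSj (hF j) hzcl
        have hzi : z ∈ F i := by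
          refine hball (show (⟨z, hzB⟩ : B) ∈ Metric.ball (⟨x, hxB⟩ : B) ε from ?_)
          have hconv := (convex_ball x ε).ordConnected
          exact hconv.uIcc_subset (Metric.mem_ball_self hε) hy hzxy
        have hij : j = i := by
          by_contra hne
          exact disjoint_left.1 (hd hne) hzj hzi
        exact hij ▸ interior_subset hj
    exact hxB (mem_iUnion.2 ⟨i, mem_interior_iff_mem_nhds.2
      (Filter.mem_of_superset (Metric.ball_mem_nhds x hε) hballF)⟩)
  · rw [not_nonempty_iff_eq_empty, hB, compl_empty_iff] at hne
    obtain ⟨i, hi⟩ := mem_iUnion.1 (hne.symm ▸ mem_univ (0 : ℝ) : (0 : ℝ) ∈ ⋃ i, U i)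
    refine ⟨i, eq_univ_of_univ_subset ((isPreconnected_univ.subset_of_iUnion_isOpen hUo hUd
      hne.symm.subset ⟨0, mem_univ _, hi⟩).trans interior_subset)⟩

theorem exists_Icc_subset_of_countable_closed {ι : Type*} [Countable ι] {a b : ℝ} (hab : a ≤ b)
    {F : ι → Set ℝ} (hF : ∀ i, IsClosed (F i)) (hd : Pairwise (Function.onFun Disjoint F))
    (hcov : Icc a b ⊆ ⋃ i, F i) : ∃ i, Icc a b ⊆ F i := by
  have hc : Continuous fun x : ℝ => (projIcc a b hab x : ℝ) :=
    continuous_subtype_val.comp continuous_projIcc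
  obtain ⟨i, hi⟩ := exists_eq_univ_of_countable_closed
    (F := fun i => (fun x : ℝ => (projIcc a b hab x : ℝ)) ⁻¹' F i)
    (fun i => (hF i).preimage hc) (fun i j hij => (hd hij).preimage _)
    (eq_univ_of_forall fun x => by
      obtain ⟨i, hi⟩ := mem_iUnion.1 (hcov (projIcc a b hab x).2)
      exact mem_iUnion.2 ⟨i, hi⟩)
  refine ⟨i, fun x hx => ?_⟩
  have : x ∈ (fun x : ℝ => (projIcc a b hab x : ℝ)) ⁻¹' F i := hi ▸ mem_univ x
  simpa [projIcc_of_mem hab hx] using this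

open MeasureTheory Measure in
/-- The one-dimensional Hausdorff measure of a curve is at most its length. -/
theorem hausdorffMeasure_image_le_eVariationOn {E : Type*} [MetricSpace E] [MeasurableSpace E]
    [BorelSpace E] {f : ℝ → E} {a b : ℝ} (hab : a ≤ b) (hf : BoundedVariationOn f (Icc a b)) :
    μH[1] (f '' Icc a b) ≤ eVariationOn f (Icc a b) := by
  set s := Icc a b
  have ha : a ∈ s := left_mem_Icc.2 hab
  have hb : b ∈ s := right_mem_Icc.2 hab
  have hl := hf.locallyBoundedVariationOn
  set v := variationOnFromTo f s a
  set g := naturalParameterization f s a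
  have hg : HasUnitSpeedOn g (v '' s) := has_unit_speed_naturalParameterization f hl ha
  have hlip : LipschitzOnWith 1 g (v '' s) := by
    have key : ∀ x ∈ v '' s, ∀ y ∈ v '' s, x ≤ y → edist (g x) (g y) ≤ edist x y := by
      intro x hx y hy hxy
      have h1 := hg hx hy
      have h2 := eVariationOn.edist_le g (s := v '' s ∩ Icc x y) (x := x) (y := y)
        ⟨hx, left_mem_Icc.2 hxy⟩ ⟨hy, right_mem_Icc.2 hxy⟩
      rw [h1] at h2
      rw [edist_comm x y, edist_dist y x, Real.dist_eq, abs_of_nonneg (by linarith)]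
      simpa using h2
    intro x hx y hy
    rw [ENNReal.coe_one, one_mul]
    rcases le_total x y with h | h
    · exact key x hx y hy h
    · rw [edist_comm, edist_comm x]; exact key y hy x hx h
  have himg : f '' s = g '' (v '' s) := by
    rw [image_image]
    refine image_congr fun x hx => ?_
    have := edist_naturalParameterization_eq_zero hl ha hx
    exact (edist_eq_zero.1 this).symm
  have hsub : v '' s ⊆ Icc 0 (v b) := by
    rintro _ ⟨x, hx, rfl⟩
    have hm := variationOnFromTo.monotoneOn hl ha
    refine ⟨?_, hm hx hb hx.2⟩
    have := hm ha hx hx.1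
    rwa [variationOnFromTo.self] at this
  calc μH[1] (f '' s) ≤ (1 : NNReal) ^ (1 : ℝ) * μH[1] (v '' s) := by
        rw [himg]; exact hlip.hausdorffMeasure_image_le zero_le_one
    _ = volume (v '' s) := by simp [hausdorffMeasure_real]
    _ ≤ volume (Icc 0 (v b)) := measure_mono hsub
    _ = eVariationOn f s := by
        rw [Real.volume_Icc, sub_zero]
        simp only [v]
        rw [variationOnFromTo.eq_of_le f s hab, ENNReal.ofReal_toReal]
        · rw [inter_self]
        · rw [inter_self]; exact hf

open MeasureTheory Measure in
/-- The length of a simple arc is at most the Hausdorff measure of its interior. -/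
theorem eVariationOn_le_hausdorffMeasure {E : Type*} [MetricSpace E] [MeasurableSpace E]
    [BorelSpace E] {f : ℝ → E} {a b : ℝ} (hf : ContinuousOn f (Icc a b))
    (hinj : InjOn f (Icc a b)) : eVariationOn f (Icc a b) ≤ μH[1] (f '' Ioo a b) := by
  have hpiece : ∀ x ∈ Icc a b, ∀ y ∈ Icc a b, x ≤ y → edist (f y) (f x) ≤ μH[1] (f '' Ioo x y) := by
    intro x hx y hy hxy
    have hsub : Ioo 0 (dist (f y) (f x)) ⊆ (fun z => dist z (f x)) '' (f '' Ioo x y) := by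
      rw [image_image]
      have hm : ContinuousOn f (Icc x y) := hf.mono (Icc_subset_Icc hx.1 hy.2)
      have hc : ContinuousOn (fun t => dist (f t) (f x)) (Icc x y) := by fun_prop
      simpa using intermediate_value_Ioo hxy hc
    have hlip : LipschitzWith 1 fun z => dist z (f x) := LipschitzWith.dist_left (f x)
    calc edist (f y) (f x) = volume (Ioo 0 (dist (f y) (f x))) := by
          rw [Real.volume_Ioo, sub_zero, edist_dist]
      _ ≤ volume ((fun z => dist z (f x)) '' (f '' Ioo x y)) := measure_mono hsub
      _ = μH[1] ((fun z => dist z (f x)) '' (f '' Ioo x y)) := by rw [hausdorffMeasure_real]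
      _ ≤ (1 : NNReal) ^ (1 : ℝ) * μH[1] (f '' Ioo x y) :=
          hlip.hausdorffMeasure_image_le zero_le_one _
      _ = _ := by simp
  refine iSup_le ?_
  rintro ⟨n, u, hu, hus⟩
  simp only
  have hss : ∀ i, Ioo (u i) (u (i + 1)) ⊆ Ioo a b := fun i => Ioo_subset_Ioo (hus i).1 (hus _).2
  calc ∑ i ∈ Finset.range n, edist (f (u (i + 1))) (f (u i))
      ≤ ∑ i ∈ Finset.range n, μH[1] (f '' Ioo (u i) (u (i + 1))) :=
        Finset.sum_le_sum fun i _ => hpiece _ (hus i) _ (hus _) (hu (Nat.le_succ i))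
    _ = μH[1] (⋃ i ∈ Finset.range n, f '' Ioo (u i) (u (i + 1))) := by
        refine (measure_biUnion_finset ?_ fun i _ => ?_).symm
        · have hd := hu.pairwise_disjoint_on_Ioo_succ
          intro i _ j _ hij
          exact (hd hij).image hinj ((hss i).trans Ioo_subset_Icc_self)
            ((hss j).trans Ioo_subset_Icc_self)
        · exact measurableSet_Ioo.image_of_continuousOn_injOn
            (hf.mono ((hss i).trans Ioo_subset_Icc_self))
            (hinj.mono ((hss i).trans Ioo_subset_Icc_self))
    _ ≤ _ := measure_mono (iUnion₂_subset fun i _ => image_mono (hss i))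

/-- A curve that is shorter than a simple arc misses an interior point of it. -/
theorem exists_notMem_image_of_eVariationOn_lt {E : Type*} [MetricSpace E] {f g : ℝ → E}
    {a b c d : ℝ} (hf : ContinuousOn f (Icc a b)) (hinj : InjOn f (Icc a b)) (hcd : c ≤ d)
    (h : eVariationOn g (Icc c d) < eVariationOn f (Icc a b)) :
    ∃ s ∈ Ioo a b, f s ∉ g '' Icc c d := by
  borelize E
  by_contra! hc
  have h1 : f '' Ioo a b ⊆ g '' Icc c d := by
    rintro _ ⟨s, hs, rfl⟩
    exact hc s hs
  have h2 := (eVariationOn_le_hausdorffMeasure hf hinj).trans (MeasureTheory.measure_mono h1)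
  exact (h2.trans (hausdorffMeasure_image_le_eVariationOn hcd
    (ne_top_of_lt h))).not_gt h

namespace AbsolutelyContinuousOnInterval

/-- Short pieces of an absolutely continuous curve have small length. -/
theorem exists_eVariationOn_le {E : Type*} [PseudoMetricSpace E] {f : ℝ → E} {a b : ℝ}
    (hab : a ≤ b) (hf : AbsolutelyContinuousOnInterval f a b) {ε : ℝ} (hε : 0 < ε) :
    ∃ δ > 0, ∀ x y, a ≤ x → x ≤ y → y < x + δ → y ≤ b →
      eVariationOn f (Icc x y) ≤ ENNReal.ofReal ε := by
  rw [absolutelyContinuousOnInterval_iff] at hf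
  obtain ⟨δ, hδ, hδ'⟩ := hf ε hε
  refine ⟨δ, hδ, fun x y hx hxy hy hyb => iSup_le ?_⟩
  rintro ⟨n, u, hu, hus⟩
  simp only
  have key : ∑ i ∈ Finset.range n, dist (f (u i)) (f (u (i + 1))) < ε := by
    refine hδ' (n, fun i => (u i, u (i + 1))) ⟨fun i _ => ?_, ?_⟩ ?_
    · have hsub : Icc x y ⊆ uIcc a b := by rw [uIcc_of_le hab]; exact Icc_subset_Icc hx hyb
      exact ⟨hsub (hus _), hsub (hus _)⟩
    · intro i _ j _ hij
      have := hu.pairwise_disjoint_on_Ioc_succ hij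
      simp only [Function.onFun]
      rwa [uIoc_of_le (hu (Nat.le_succ i)), uIoc_of_le (hu (Nat.le_succ j))]
    · have : ∑ i ∈ Finset.range n, dist (u i) (u (i + 1)) = u n - u 0 := by
        rw [← Finset.sum_range_sub]
        refine Finset.sum_congr rfl fun i _ => ?_
        rw [dist_comm, Real.dist_eq, abs_of_nonneg (sub_nonneg.2 (hu (Nat.le_succ i)))]
      simp only [this]
      linarith [(hus n).2, (hus 0).1]
  calc ∑ i ∈ Finset.range n, edist (f (u (i + 1))) (f (u i))
      = ENNReal.ofReal (∑ i ∈ Finset.range n, dist (f (u i)) (f (u (i + 1)))) := by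
        rw [ENNReal.ofReal_sum_of_nonneg fun _ _ => dist_nonneg]
        refine Finset.sum_congr rfl fun i _ => ?_
        rw [edist_comm, edist_dist]
    _ ≤ _ := ENNReal.ofReal_le_ofReal key.le

/-- A function whose increments are dominated by increments of an absolutely continuous curve on
subintervals is absolutely continuous. -/
theorem of_dist_le {E F : Type*} [PseudoMetricSpace E] [PseudoMetricSpace F] {f : ℝ → F}
    {ζ : ℝ → E} {a b C : ℝ} (hab : a ≤ b) (hζ : AbsolutelyContinuousOnInterval ζ a b)
    (hC : 0 ≤ C) (h : ∀ x y, a ≤ x → x ≤ y → y ≤ b →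
      ∃ x' y', x ≤ x' ∧ x' ≤ y' ∧ y' ≤ y ∧ dist (f x) (f y) ≤ C * dist (ζ x') (ζ y')) :
    AbsolutelyContinuousOnInterval f a b := by
  rw [absolutelyContinuousOnInterval_iff] at hζ ⊢
  intro ε hε
  obtain ⟨δ, hδ, hδ'⟩ := hζ (ε / (C + 1)) (by positivity)
  refine ⟨δ, hδ, ?_⟩
  rintro ⟨n, I⟩ ⟨hI, hI'⟩ hlen
  simp only at hI hI' hlen ⊢
  have hch : ∀ i, ∃ J : ℝ × ℝ, i ∈ Finset.range n → (min (I i).1 (I i).2 ≤ J.1 ∧ J.1 ≤ J.2 ∧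
      J.2 ≤ max (I i).1 (I i).2 ∧ dist (f (I i).1) (f (I i).2) ≤ C * dist (ζ J.1) (ζ J.2)) := by
    intro i
    by_cases hi : i ∈ Finset.range n
    · obtain ⟨h1, h2⟩ := hI i hi
      rw [uIcc_of_le hab] at h1 h2
      obtain ⟨x', y', e1, e2, e3, e4⟩ := h (min (I i).1 (I i).2) (max (I i).1 (I i).2)
        (le_min h1.1 h2.1) min_le_max (max_le h1.2 h2.2)
      refine ⟨(x', y'), fun _ => ⟨e1, e2, e3, ?_⟩⟩
      rcases le_total (I i).1 (I i).2 with hle | hle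
      · rwa [min_eq_left hle, max_eq_right hle] at e4
      · rwa [min_eq_right hle, max_eq_left hle, dist_comm] at e4
    · exact ⟨(0, 0), fun h => absurd h hi⟩
  choose J hJ using hch
  have hsub : ∀ i ∈ Finset.range n, uIoc (J i).1 (J i).2 ⊆ uIoc (I i).1 (I i).2 := by
    intro i hi
    obtain ⟨e1, e2, e3, -⟩ := hJ i hi
    rw [uIoc_of_le e2]
    exact Ioc_subset_Ioc e1 e3
  have hJd := hδ' (n, J) ⟨fun i hi => ?_, fun i hi j hj hij => ?_⟩ ?_
  · calc ∑ i ∈ Finset.range n, dist (f (I i).1) (f (I i).2)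
        ≤ ∑ i ∈ Finset.range n, C * dist (ζ (J i).1) (ζ (J i).2) :=
          Finset.sum_le_sum fun i hi => (hJ i hi).2.2.2
      _ = C * ∑ i ∈ Finset.range n, dist (ζ (J i).1) (ζ (J i).2) := (Finset.mul_sum _ _ _).symm
      _ ≤ C * (ε / (C + 1)) := mul_le_mul_of_nonneg_left hJd.le hC
      _ < (C + 1) * (ε / (C + 1)) := by gcongr; linarith
      _ = ε := by field_simp
  · obtain ⟨e1, e2, e3, -⟩ := hJ i hi
    obtain ⟨h1, h2⟩ := hI i hi
    rw [uIcc_of_le hab] at h1 h2 ⊢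
    have m1 := le_min h1.1 h2.1
    have m2 := max_le h1.2 h2.2
    exact ⟨⟨m1.trans e1, (e2.trans e3).trans m2⟩, ⟨(m1.trans e1).trans e2, e3.trans m2⟩⟩
  · exact (hI' hi hj hij).mono (hsub i hi) (hsub j hj)
  · refine lt_of_le_of_lt (Finset.sum_le_sum fun i hi => ?_) hlen
    obtain ⟨e1, e2, e3, -⟩ := hJ i hi
    simp only
    rw [Real.dist_eq, abs_sub_comm, abs_of_nonneg (by linarith), Real.dist_eq, abs_sub_comm,
      ← max_sub_min_eq_abs]
    linarith

end AbsolutelyContinuousOnInterval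

/-- The derivative vanishes at all but countably many points of a level set where it exists. -/
theorem countable_setOf_deriv_ne_zero {E : Type*} [NormedAddCommGroup E] [NormedSpace ℝ E]
    (f : ℝ → E) (c : E) : {t | f t = c ∧ deriv f t ≠ 0}.Countable := by
  refine (countable_setOfPred_isolated_right_within (s := f ⁻¹' {c})).mono ?_
  rintro t ⟨ht, hd⟩
  refine ⟨ht, ?_⟩
  have h1 := (differentiableAt_of_deriv_ne_zero hd).hasDerivAt.eventually_ne hd (c := c)
  rw [← Filter.empty_mem_iff_bot]
  have h2 : ∀ᶠ z in nhdsWithin t (f ⁻¹' {c} ∩ Ioi t), f z ≠ c :=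
    h1.filter_mono (nhdsWithin_mono _ fun z hz => (ne_of_gt hz.2 : z ≠ t))
  filter_upwards [h2, self_mem_nhdsWithin] with z hz hz'
  exact hz hz'.1

/-- A regular simple arc is bi-Lipschitz onto its image. -/
theorem exists_mul_le_norm_sub {F : Type*} [NormedAddCommGroup F] [NormedSpace ℝ F] {f : ℝ → F}
    {a b : ℝ} (hab : a < b) (hf : ContDiffOn ℝ 1 f (Icc a b))
    (hreg : ∀ s ∈ Icc a b, derivWithin f (Icc a b) s ≠ 0) (hinj : InjOn f (Icc a b)) :
    ∃ c > 0, ∀ s ∈ Icc a b, ∀ t ∈ Icc a b, c * |s - t| ≤ ‖f s - f t‖ := by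
  set I := Icc a b
  have hfc : ContinuousOn f I := hf.continuousOn
  have hdc : ContinuousOn (derivWithin f I) I :=
    hf.continuousOn_derivWithin (uniqueDiffOn_Icc hab) le_rfl
  have main : ∃ c > 0, ∀ p ∈ I ×ˢ I, c * |p.1 - p.2| ≤ ‖f p.1 - f p.2‖ := by
    refine (isCompact_Icc.prod isCompact_Icc : IsCompact (I ×ˢ I)).induction_on
      (p := fun U => ∃ c > 0, ∀ p ∈ U, c * |p.1 - p.2| ≤ ‖f p.1 - f p.2‖)
      ⟨1, one_pos, by simp⟩ (fun s t hst ⟨c, hc, h⟩ => ⟨c, hc, fun p hp => h p (hst hp)⟩) ?_ ?_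
    · rintro s t ⟨c, hc, h⟩ ⟨c', hc', h'⟩
      refine ⟨min c c', lt_min hc hc', ?_⟩
      rintro p (hp | hp)
      · exact (mul_le_mul_of_nonneg_right (min_le_left _ _) (abs_nonneg _)).trans (h p hp)
      · exact (mul_le_mul_of_nonneg_right (min_le_right _ _) (abs_nonneg _)).trans (h' p hp)
    · rintro ⟨x, y⟩ ⟨hx, hy⟩
      by_cases hxy : x = y
      · subst hxy
        set w := derivWithin f I x
        have hw : 0 < ‖w‖ := norm_pos_iff.2 (hreg x hx)
        obtain ⟨δ, hδ, hδ'⟩ := Metric.continuousWithinAt_iff.1 (hdc x hx) (‖w‖ / 2) (by positivity)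
        set V := I ∩ Metric.ball x δ
        have hVc : Convex ℝ V := (convex_Icc a b).inter (convex_ball x δ)
        refine ⟨V ×ˢ V, ?_, ‖w‖ / 2, by positivity, ?_⟩
        · rw [nhdsWithin_prod_eq]
          have : V ∈ nhdsWithin x I := inter_mem_nhdsWithin I (Metric.ball_mem_nhds x hδ)
          exact Filter.prod_mem_prod this this
        · rintro ⟨s, t⟩ ⟨hs, ht⟩
          simp only at hs ht ⊢
          have hder : ∀ u ∈ V,
              HasDerivWithinAt (fun u => f u - u • w) (derivWithin f I u - w) V u := by
            intro u hu
            have h1 := ((hf.differentiableOn one_ne_zero u hu.1).hasDerivWithinAt).mono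
              (inter_subset_left : V ⊆ I)
            have h2 := ((hasDerivAt_id u).smul_const w).hasDerivWithinAt (s := V)
            rw [one_smul] at h2
            exact h1.sub h2
          have := hVc.norm_image_sub_le_of_norm_hasDerivWithin_le hder
            (C := ‖w‖ / 2) (fun u hu => by
              have := hδ' hu.1 hu.2
              rw [dist_eq_norm] at this
              exact this.le) ht hs
          have h3 : ‖(s - t) • w‖ ≤ ‖f s - f t‖ + ‖w‖ / 2 * ‖s - t‖ := by
            have e : (s - t) • w = (f s - f t) - ((f s - s • w) - (f t - t • w)) := by
              rw [sub_smul]; abel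
            rw [e]
            exact (norm_sub_le _ _).trans (by linarith)
          rw [norm_smul, Real.norm_eq_abs] at h3
          linarith
      · have hne : 0 < ‖f x - f y‖ := norm_pos_iff.2 (sub_ne_zero.2 fun h => hxy (hinj hx hy h))
        have hK : 0 < |x - y| := abs_pos.2 (sub_ne_zero.2 hxy)
        set c := ‖f x - f y‖ / (2 * |x - y|)
        have hcont : ContinuousWithinAt (fun p : ℝ × ℝ => ‖f p.1 - f p.2‖ - c * |p.1 - p.2|)
            (I ×ˢ I) (x, y) := by
          have h1 : ContinuousWithinAt (fun p : ℝ × ℝ => f p.1) (I ×ˢ I) (x, y) :=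
            (hfc x hx).comp continuousWithinAt_fst fun p hp => hp.1
          have h2 : ContinuousWithinAt (fun p : ℝ × ℝ => f p.2) (I ×ˢ I) (x, y) :=
            (hfc y hy).comp continuousWithinAt_snd fun p hp => hp.2
          exact (h1.sub h2).norm.sub (by fun_prop)
        have hpos : 0 < ‖f x - f y‖ - c * |x - y| := by
          have : c * |x - y| = ‖f x - f y‖ / 2 := by simp only [c]; field_simp
          rw [this]; linarith
        refine ⟨{p | 0 < ‖f p.1 - f p.2‖ - c * |p.1 - p.2|}, ?_, c, by positivity, ?_⟩
        · exact hcont.eventually_const_lt hpos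
        · intro p hp
          have : 0 < ‖f p.1 - f p.2‖ - c * |p.1 - p.2| := hp
          linarith
  obtain ⟨c, hc, h⟩ := main
  exact ⟨c, hc, fun s hs t ht => h (s, t) ⟨hs, ht⟩⟩

/-! ### The crystal has no loops -/

namespace OGraph

variable {V E : Type*} {Γ : OGraph V E} {P : Γ.Orientation} [Finite E] (S : SpanningTree P)

/-- The map `θ` does not vanish on a loop `e`: a loop cannot lie in the tree, and the coefficient of
`e` in the incidence vector of its fundamental circuit is positive. -/
theorem thetaEdge_ne_zero_of_loop {e : E} (he : Γ.o e = Γ.t e) : thetaEdge S e ≠ 0 := by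
  classical
  wlog hp : e ∈ P.plus generalizing e
  · have h1 := (P.one_of e).resolve_left hp
    have := this (e := Γ.neg e) (by rw [OGraph.t, Γ.neg_neg, he]; rfl) h1
    rw [thetaEdge_neg] at this
    exact fun h => this (by rw [h, neg_zero])
  have hloop : Γ.IsPath (Γ.o e) (Γ.o e) [e] := ⟨rfl, he.symm⟩
  have hnot : e ∉ S.edges := fun hmem => by
    have h1 := S.trivial _ _ hloop (by simpa using hmem)
    rw [incidence_cons, incidence_nil, add_zero, edgeVec, dif_pos hp] at h1
    simpa using DFunLike.congr_fun h1 ⟨e, hp⟩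
  have hex : ∃ l, IsFundamental S e l :=
    ⟨[e], ⟨by simp, ⟨_, hloop⟩, by simp⟩, by simp, by simp⟩
  have hval : (thetaEdge S e : H₁ P) = ⟨incidence P hex.choose,
      incidence_mem P hex.choose hex.choose_spec.1⟩ := by
    rw [thetaEdge, edgeVec, dif_pos hp, theta, Finsupp.linearCombination_single, one_smul,
      thetaBasis, if_neg hnot, dif_pos hex]
  intro h0
  rw [hval] at h0
  have h1 := DFunLike.congr_fun (congrArg Subtype.val h0) ⟨e, hp⟩
  obtain ⟨-, h2, h3⟩ := hex.choose_spec
  have h4 : Γ.neg e ∉ hex.choose := fun hm => by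
    rcases h3 _ hm with h | h
    · exact Γ.neg_ne e h
    · have := S.neg_mem _ h
      rw [Γ.neg_neg] at this
      exact hnot this
  have h5 := List.count_pos_iff.2 h2
  simp only [incidence, Finsupp.equivFunOnFinite_symm_apply_apply, List.count_eq_zero_of_not_mem h4]
    at h1
  simp at h1
  omega

theorem rotation_nil : rotation S [] = 0 := by rw [rotation, incidence_nil, map_zero]

theorem rotation_cons (e : E) (l : List E) :
    rotation S (e :: l) = thetaEdge S e + rotation S l := by
  rw [rotation, incidence_cons, map_add, thetaEdge, rotation]

theorem rotation_append (l l' : List E) :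
    rotation S (l ++ l') = rotation S l + rotation S l' := by
  induction l with
  | nil => rw [List.nil_append, rotation_nil, zero_add]
  | cons e l ih => rw [List.cons_append, rotation_cons, rotation_cons, ih, add_assoc]

end OGraph

/-! ### Arcs and vertices of a periodic network -/

namespace PeriodicNetwork

variable {V₀ E₀ : Type*} [Finite E₀] {Γ₀ : OGraph V₀ E₀} {P : Γ₀.Orientation}
  {S : OGraph.SpanningTree P} {d : ℕ} {A : Type*} (N : PeriodicNetwork S d A)

theorem arc_rev_zero (γ : A) : N.arc (N.rev γ) 0 = N.arc γ 1 := by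
  rw [N.arc_rev γ 0 (by simp), sub_zero]

theorem arc_rev_one (γ : A) : N.arc (N.rev γ) 1 = N.arc γ 0 := by
  rw [N.arc_rev γ 1 (by simp), sub_self]

theorem π₁_o (γ : A) : N.π₁ (N.graph.o γ) = Γ₀.o (N.Ψ.edge γ).1 :=
  (congrArg Prod.fst (N.Ψ.map_o γ)).symm

theorem π₂_o (γ : A) : N.π₂ (N.graph.o γ) = (N.Ψ.edge γ).2 :=
  (congrArg Prod.snd (N.Ψ.map_o γ)).symm

theorem edge_rev (γ : A) : N.Ψ.edge (N.rev γ) =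
    (Γ₀.neg (N.Ψ.edge γ).1, (N.Ψ.edge γ).2 + OGraph.thetaEdge S (N.Ψ.edge γ).1) :=
  N.Ψ.map_neg γ

theorem π₁_t (γ : A) : N.π₁ (N.graph.t γ) = Γ₀.t (N.Ψ.edge γ).1 := by
  rw [OGraph.t, π₁_o]
  exact congrArg (fun p => Γ₀.o p.1) (N.edge_rev γ)

theorem π₂_t (γ : A) :
    N.π₂ (N.graph.t γ) = (N.Ψ.edge γ).2 + OGraph.thetaEdge S (N.Ψ.edge γ).1 := by
  rw [OGraph.t, π₂_o]
  exact congrArg Prod.snd (N.edge_rev γ)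

theorem coe_graph_t (γ : A) : (N.graph.t γ : EuclideanSpace ℝ (Fin d)) = N.arc γ 1 :=
  N.arc_rev_zero γ

theorem eq_of_π {z z' : N.vertices} (h₁ : N.π₁ z = N.π₁ z') (h₂ : N.π₂ z = N.π₂ z') : z = z' :=
  N.Ψ.vert.injective (Prod.ext h₁ h₂)

theorem arc_zero_ne_one (γ : A) : N.arc γ 0 ≠ N.arc γ 1 := by
  intro h
  have h1 : N.graph.o γ = N.graph.t γ := Subtype.ext (h.trans (N.coe_graph_t γ).symm)
  have h2 := congrArg N.π₁ h1
  have h3 := congrArg N.π₂ h1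
  rw [π₁_o, π₁_t] at h2
  rw [π₂_o, π₂_t, left_eq_add] at h3
  exact OGraph.thetaEdge_ne_zero_of_loop S h2 h3

theorem arc_mem_vertices_zero (γ : A) : N.arc γ 0 ∈ N.vertices := ⟨γ, Or.inl rfl⟩

theorem arc_mem_vertices_one (γ : A) : N.arc γ 1 ∈ N.vertices := ⟨γ, Or.inr rfl⟩

theorem arc_mem_carrier (γ : A) {s : ℝ} (hs : s ∈ Icc (0 : ℝ) 1) : N.arc γ s ∈ N.carrier :=
  mem_iUnion.2 ⟨γ, s, hs, rfl⟩

theorem injOn_arc (γ : A) : InjOn (N.arc γ) (Icc 0 1) := by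
  intro s hs t ht hst
  rcases hs.2.lt_or_eq with h1 | h1
  · rcases ht.2.lt_or_eq with h2 | h2
    · exact (N.simple γ).1 ⟨hs.1, h1⟩ ⟨ht.1, h2⟩ hst
    · rcases hs.1.lt_or_eq with h3 | h3
      · exact (N.simple γ).2 ⟨h3, hs.2⟩ ⟨by rw [h2]; exact one_pos, ht.2⟩ hst
      · rw [← h3, h2] at hst
        exact absurd hst (N.arc_zero_ne_one γ)
  · rcases ht.1.lt_or_eq with h3 | h3
    · exact (N.simple γ).2 ⟨by rw [h1]; exact one_pos, hs.2⟩ ⟨h3, ht.2⟩ hst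
    · rw [← h3, h1] at hst
      exact absurd hst.symm (N.arc_zero_ne_one γ)

theorem continuousOn_arc (γ : A) : ContinuousOn (N.arc γ) (Icc 0 1) := (N.contDiff γ).continuousOn

/-- An interior point of an arc lies on no other arc. -/
theorem eq_or_eq_rev_of_arc_eq {γ γ' : A} {s s' : ℝ} (hs : s ∈ Ioo (0 : ℝ) 1)
    (hs' : s' ∈ Icc (0 : ℝ) 1) (h : N.arc γ s = N.arc γ' s') :
    γ' = γ ∧ s' = s ∨ γ' = N.rev γ ∧ s' = 1 - s := by
  by_cases h1 : γ' = γ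
  · subst h1
    exact Or.inl ⟨rfl, (N.injOn_arc γ' (Ioo_subset_Icc_self hs) hs' h).symm⟩
  by_cases h2 : γ' = N.rev γ
  · subst h2
    rw [N.arc_rev γ s' hs'] at h
    have := N.injOn_arc γ (Ioo_subset_Icc_self hs) ⟨by linarith [hs'.2], by linarith [hs'.1]⟩ h
    exact Or.inr ⟨rfl, by linarith⟩
  · exact absurd ⟨s, hs, rfl⟩ (disjoint_left.1 (N.disj γ' γ (Ne.symm h1)
      fun hh => h2 (by rw [hh, N.rev_rev])) ⟨s', hs', h.symm⟩)

theorem arc_notMem_vertices (γ : A) {s : ℝ} (hs : s ∈ Ioo (0 : ℝ) 1) : N.arc γ s ∉ N.vertices := by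
  rintro ⟨γ', h | h⟩
  · rcases N.eq_or_eq_rev_of_arc_eq hs (by simp) h with ⟨-, h1⟩ | ⟨-, h1⟩ <;> linarith [hs.1, hs.2]
  · rcases N.eq_or_eq_rev_of_arc_eq hs (by simp) h with ⟨-, h1⟩ | ⟨-, h1⟩ <;> linarith [hs.1, hs.2]

theorem exists_arc_zero_eq {z : EuclideanSpace ℝ (Fin d)} (hz : z ∈ N.vertices) :
    ∃ γ, N.arc γ 0 = z := by
  obtain ⟨γ, h | h⟩ := hz
  · exact ⟨γ, h.symm⟩
  · exact ⟨N.rev γ, (N.arc_rev_zero γ).trans h.symm⟩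

theorem exists_arc_one_eq {z : EuclideanSpace ℝ (Fin d)} (hz : z ∈ N.vertices) :
    ∃ γ, N.arc γ 1 = z := by
  obtain ⟨γ, h⟩ := N.exists_arc_zero_eq hz
  exact ⟨N.rev γ, (N.arc_rev_one γ).trans h⟩

instance finite_arc_zero_eq (z : EuclideanSpace ℝ (Fin d)) : Finite {γ : A // N.arc γ 0 = z} := by
  refine Finite.of_injective (fun γ : {γ : A // N.arc γ 0 = z} => (N.Ψ.edge γ.1).1) ?_
  rintro ⟨γ, hγ⟩ ⟨γ', hγ'⟩ h
  simp only at h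
  have h1 : N.graph.o γ = N.graph.o γ' := Subtype.ext (hγ.trans hγ'.symm)
  have h2 := congrArg N.π₂ h1
  rw [π₂_o, π₂_o] at h2
  exact Subtype.ext (N.Ψ.edge.injective (Prod.ext h h2))

instance finite_arc_one_eq (z : EuclideanSpace ℝ (Fin d)) : Finite {γ : A // N.arc γ 1 = z} := by
  refine Finite.of_injective (fun γ : {γ : A // N.arc γ 1 = z} =>
    (⟨N.rev γ.1, (N.arc_rev_zero γ.1).trans γ.2⟩ : {γ : A // N.arc γ 0 = z})) ?_
  rintro ⟨γ, hγ⟩ ⟨γ', hγ'⟩ h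
  have h1 : N.rev γ = N.rev γ' := congrArg Subtype.val h
  have h2 : γ = γ' := by rw [← N.rev_rev γ, h1, N.rev_rev]
  exact Subtype.ext h2

include N in
theorem countable_arcs : Countable A :=
  have : Countable (OGraph.H₁ P) := inferInstance
  N.Ψ.edge.injective.countable

theorem countable_vertices : Countable N.vertices := by
  have := N.countable_arcs
  have : Function.Surjective fun γ : A => N.graph.o γ := fun z => by
    obtain ⟨γ, hγ⟩ := N.exists_arc_zero_eq z.2
    exact ⟨γ, Subtype.ext hγ⟩
  exact this.countable

/-! ### Short curves stay in the star of a vertex -/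

/-- The open star of `v`: the arcs that start at `v`, without their final points. -/
def openStar (v : EuclideanSpace ℝ (Fin d)) : Set (EuclideanSpace ℝ (Fin d)) :=
  {z | ∃ γ, N.arc γ 0 = v ∧ ∃ s ∈ Ico (0 : ℝ) 1, N.arc γ s = z}

theorem eq_of_mem_openStar {v z : EuclideanSpace ℝ (Fin d)} (hz : z ∈ N.openStar v)
    (hzv : z ∈ N.vertices) : z = v := by
  obtain ⟨γ, hγ, s, hs, rfl⟩ := hz
  rcases hs.1.eq_or_lt with h | h
  · rw [← h, hγ]
  · exact absurd hzv (N.arc_notMem_vertices γ ⟨h, hs.2⟩)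

theorem isClosed_arc_image (γ : A) {a b : ℝ} (ha : 0 ≤ a) (hb : b ≤ 1) :
    IsClosed (N.arc γ '' Icc a b) :=
  (isCompact_Icc.image_of_continuousOn
    ((N.continuousOn_arc γ).mono (Icc_subset_Icc ha hb))).isClosed

/-- A connected set in the open star of `v` that avoids `v` stays inside a single arc. -/
theorem exists_subset_arc {v : EuclideanSpace ℝ (Fin d)} {C : Set (EuclideanSpace ℝ (Fin d))}
    (hC : IsPreconnected C) (hne : C.Nonempty) (hCv : C ⊆ N.openStar v) (hv : v ∉ C) :
    ∃ γ, N.arc γ 0 = v ∧ C ⊆ N.arc γ '' Ioo 0 1 := by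
  have hint : ∀ γ, N.arc γ 0 = v → C ∩ N.arc γ '' Icc 0 1 ⊆ N.arc γ '' Ioo 0 1 := by
    rintro γ hγ _ ⟨hz, s, hs, rfl⟩
    refine ⟨s, ⟨lt_of_le_of_ne hs.1 fun h => hv ?_, lt_of_le_of_ne hs.2 fun h => ?_⟩, rfl⟩
    · rw [← hγ, h]; exact hz
    · subst h
      have := N.eq_of_mem_openStar (hCv hz) (N.arc_mem_vertices_one γ)
      exact N.arc_zero_ne_one γ (hγ.trans this.symm)
  obtain ⟨z, hz⟩ := hne
  obtain ⟨γ, hγ, s, hs, hsz⟩ := hCv hz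
  refine ⟨γ, hγ, fun w hw => hint γ hγ ⟨hw, ?_⟩⟩
  have hclosed : IsClosed (⋃ γ' : {γ' : {γ' : A // N.arc γ' 0 = v} // γ'.1 ≠ γ},
      N.arc γ'.1.1 '' Icc 0 1) :=
    isClosed_iUnion_of_finite fun γ' => N.isClosed_arc_image _ le_rfl le_rfl
  refine (isPreconnected_iff_subset_of_disjoint_closed.1 hC _ _
    (N.isClosed_arc_image γ le_rfl le_rfl) hclosed ?_ ?_).resolve_right (fun hsub => ?_) hw
  · intro w hw
    obtain ⟨γ', hγ', s', hs', hw'⟩ := hCv hw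
    by_cases h : γ' = γ
    · exact Or.inl ⟨s', Ico_subset_Icc_self hs', h ▸ hw'⟩
    · exact Or.inr (mem_iUnion.2 ⟨⟨⟨γ', hγ'⟩, h⟩, s', Ico_subset_Icc_self hs', hw'⟩)
  · rw [eq_empty_iff_forall_notMem]
    rintro w ⟨hw, hw1, hw2⟩
    obtain ⟨⟨⟨γ', hγ'⟩, hne⟩, s', hs', hw'⟩ := mem_iUnion.1 hw2
    obtain ⟨s₁, hs₁, hw₁⟩ := hint γ hγ ⟨hw, hw1⟩
    rcases N.eq_or_eq_rev_of_arc_eq hs₁ hs' (hw₁.trans hw'.symm) with ⟨h, -⟩ | ⟨h, -⟩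
    · exact hne h
    · simp only at h
      subst h
      rw [N.arc_rev_zero] at hγ'
      exact N.arc_zero_ne_one γ (hγ.trans hγ'.symm)
  · obtain ⟨⟨⟨γ', hγ'⟩, hne⟩, s', hs', hw'⟩ := mem_iUnion.1 (hsub hz)
    have hz1 : z ∈ C ∩ N.arc γ '' Icc 0 1 := ⟨hz, s, Ico_subset_Icc_self hs, hsz⟩
    obtain ⟨s₁, hs₁, hw₁⟩ := hint γ hγ hz1
    rcases N.eq_or_eq_rev_of_arc_eq hs₁ hs' (hw₁.trans hw'.symm) with ⟨h, -⟩ | ⟨h, -⟩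
    · exact hne h
    · simp only at h
      subst h
      rw [N.arc_rev_zero] at hγ'
      exact N.arc_zero_ne_one γ (hγ.trans hγ'.symm)

/-- A curve shorter than all arcs stays in the open star of a single vertex. It misses an interior
point of each arc. Cutting the arcs at these points decomposes the part of the network seen by the
curve into countably many disjoint closed sets, one for each vertex, and Sierpiński's theorem
applies. Arcs may accumulate in the ambient space, so that mere connectedness is not enough. -/
theorem exists_mem_openStar {ζ : ℝ → EuclideanSpace ℝ (Fin d)} {a b : ℝ} (hab : a ≤ b)
    (hζ : ContinuousOn ζ (Icc a b)) (hN : ∀ t ∈ Icc a b, ζ t ∈ N.carrier)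
    (hlen : ∀ γ, eVariationOn ζ (Icc a b) < eVariationOn (N.arc γ) (Icc 0 1)) :
    ∃ v ∈ N.vertices, ∀ t ∈ Icc a b, ζ t ∈ N.openStar v := by
  classical
  have := N.countable_vertices
  have hmiss := fun γ => exists_notMem_image_of_eVariationOn_lt (N.continuousOn_arc γ)
    (N.injOn_arc γ) hab (hlen γ)
  choose m₀ hm₀ hm₀' using hmiss
  -- the missed points are chosen consistently with the reversal of the arcs
  set m : A → ℝ := fun γ => if (N.Ψ.edge γ).1 ∈ P.plus then m₀ γ else 1 - m₀ (N.rev γ) with hm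
  have hmI : ∀ γ, m γ ∈ Ioo (0 : ℝ) 1 := by
    intro γ
    simp only [hm]
    split_ifs
    · exact hm₀ γ
    · have := hm₀ (N.rev γ)
      exact ⟨by linarith [this.2], by linarith [this.1]⟩
  have hm' : ∀ γ, N.arc γ (m γ) ∉ ζ '' Icc a b := by
    intro γ
    simp only [hm]
    split_ifs
    · exact hm₀' γ
    · have := hm₀' (N.rev γ)
      rwa [N.arc_rev γ _ (Ioo_subset_Icc_self (hm₀ _))] at this
  have hmrev : ∀ γ, m (N.rev γ) = 1 - m γ := by
    intro γ
    have h1 : (N.Ψ.edge (N.rev γ)).1 = Γ₀.neg (N.Ψ.edge γ).1 := congrArg Prod.fst (N.edge_rev γ)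
    simp only [hm, h1, N.rev_rev]
    by_cases h : (N.Ψ.edge γ).1 ∈ P.plus
    · simp [h, P.not_both _ h]
    · simp [h, (P.one_of _).resolve_left h]
  set F : N.vertices → Set ℝ := fun v => ⋃ γ : {γ : A // N.arc γ 0 = v},
    Icc a b ∩ ζ ⁻¹' (N.arc γ.1 '' Icc 0 (m γ.1)) with hF
  have hFc : ∀ v, IsClosed (F v) := fun v => isClosed_iUnion_of_finite fun γ =>
    hζ.preimage_isClosed_of_isClosed isClosed_Icc
      (N.isClosed_arc_image _ le_rfl (hmI γ.1).2.le)
  have hFd : Pairwise (Function.onFun Disjoint F) := by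
    intro v v' hvv
    refine disjoint_left.2 fun t ht ht' => hvv ?_
    obtain ⟨⟨γ, hγ⟩, htI, s, hs, hst⟩ := mem_iUnion.1 ht
    obtain ⟨⟨γ', hγ'⟩, -, s', hs', hst'⟩ := mem_iUnion.1 ht'
    simp only at hs hst hs' hst'
    have hlt : s < m γ := lt_of_le_of_ne hs.2 fun h => hm' γ ⟨t, htI, by rw [← h, hst]⟩
    have hlt' : s' < m γ' := lt_of_le_of_ne hs'.2 fun h => hm' γ' ⟨t, htI, by rw [← h, hst']⟩
    have hm1 := (hmI γ).2
    have hm2 := (hmI γ').2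
    have hsI : s ∈ Icc (0 : ℝ) 1 := ⟨hs.1, by linarith⟩
    have hsI' : s' ∈ Icc (0 : ℝ) 1 := ⟨hs'.1, by linarith⟩
    have key : ∀ {γ γ' : A} {s s' : ℝ}, s ∈ Icc (0 : ℝ) 1 → s' ∈ Icc (0 : ℝ) 1 →
        s < m γ → s' < m γ' → N.arc γ s = N.arc γ' s' → 0 < s → N.arc γ 0 = N.arc γ' 0 := by
      intro γ γ' s s' hsI hsI' hlt hlt' h hpos
      rcases N.eq_or_eq_rev_of_arc_eq ⟨hpos, hlt.trans (hmI γ).2⟩ hsI' h with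
        ⟨h1, -⟩ | ⟨h1, h2⟩
      · rw [h1]
      · rw [h1, hmrev, h2] at hlt'
        linarith
    have hst2 : N.arc γ s = N.arc γ' s' := hst.trans hst'.symm
    refine Subtype.ext (hγ.symm.trans (Eq.trans ?_ hγ'))
    rcases hs.1.lt_or_eq with h1 | h1
    · exact key hsI hsI' hlt hlt' hst2 h1
    rcases hs'.1.lt_or_eq with h2 | h2
    · exact (key hsI' hsI hlt' hlt hst2.symm h2).symm
    · rw [h1, hst2, ← h2, h1]
  have hcov : Icc a b ⊆ ⋃ v, F v := by
    intro t ht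
    obtain ⟨γ, s, hs, hst⟩ := mem_iUnion.1 (hN t ht)
    rcases lt_or_ge (m γ) s with h | h
    · refine mem_iUnion.2 ⟨⟨N.arc (N.rev γ) 0, N.arc_mem_vertices_zero _⟩,
        mem_iUnion.2 ⟨⟨N.rev γ, rfl⟩, ht, 1 - s, ⟨by linarith [hs.2], ?_⟩, ?_⟩⟩
      · simp only [hmrev]; linarith
      · simp only
        rw [N.arc_rev γ _ ⟨by linarith [hs.2], by linarith [hs.1]⟩, sub_sub_cancel, hst]
    · exact mem_iUnion.2 ⟨⟨N.arc γ 0, N.arc_mem_vertices_zero _⟩,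
        mem_iUnion.2 ⟨⟨γ, rfl⟩, ht, s, ⟨hs.1, h⟩, hst⟩⟩
  obtain ⟨v, hv⟩ := exists_Icc_subset_of_countable_closed hab hFc hFd hcov
  refine ⟨v, v.2, fun t ht => ?_⟩
  obtain ⟨⟨γ, hγ⟩, -, s, hs, hst⟩ := mem_iUnion.1 (hv ht)
  exact ⟨γ, hγ, s, ⟨hs.1, hs.2.trans_lt (hmI γ).2⟩, hst⟩

/-! ### Hamiltonians and Lagrangians of the arcs -/

/-- The Hamiltonian of an edge of the base graph, extended to all real `s` by its values at the
endpoints of `[0, 1]`. -/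
def extHam (H : A → ℝ → ℝ → ℝ) (e : E₀) (s ρ : ℝ) : ℝ :=
  N.baseHam H e (projIcc 0 1 zero_le_one s) ρ

variable {N} {H : A → ℝ → ℝ → ℝ}

theorem extHam_of_mem {e : E₀} {s : ℝ} (hs : s ∈ Icc (0 : ℝ) 1) :
    N.extHam H e s = N.baseHam H e s := by
  funext ρ
  rw [extHam, projIcc_of_mem zero_le_one hs]

namespace IsHamiltonian

theorem eq_extHam (hH : N.IsHamiltonian H) (γ : A) {s : ℝ} (hs : s ∈ Icc (0 : ℝ) 1) :
    H γ s = N.extHam H (N.Ψ.edge γ).1 s := by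
  rw [extHam_of_mem hs, baseHam]
  funext ρ
  have h := hH.periodic (N.Ψ.edge γ).2 (N.Ψ.edge.symm ((N.Ψ.edge γ).1, 0)) s hs ρ
  rw [← h, Equiv.apply_symm_apply]
  congr 2
  rw [Equiv.eq_symm_apply]
  exact Prod.ext rfl (zero_add _).symm

theorem extHam_neg (hH : N.IsHamiltonian H) (e : E₀) {s : ℝ} (hs : s ∈ Icc (0 : ℝ) 1) (ρ : ℝ) :
    N.extHam H (Γ₀.neg e) s ρ = N.extHam H e (1 - s) (-ρ) := by
  have hs' : 1 - s ∈ Icc (0 : ℝ) 1 := ⟨by linarith [hs.2], by linarith [hs.1]⟩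
  set γ := N.Ψ.edge.symm (e, 0) with hγ
  have h1 : (N.Ψ.edge γ).1 = e := by rw [hγ, Equiv.apply_symm_apply]
  have h2 : (N.Ψ.edge (N.rev γ)).1 = Γ₀.neg e := by rw [N.edge_rev, h1]
  have h3 := hH.compat γ s hs ρ
  rwa [hH.eq_extHam _ hs, hH.eq_extHam _ hs', h1, h2] at h3

theorem tonelli (hH : N.IsHamiltonian H) (e : E₀) : Tonelli (N.extHam H e) := by
  have hpc : Continuous fun s : ℝ => (projIcc (0 : ℝ) 1 zero_le_one s : ℝ) :=
    continuous_subtype_val.comp continuous_projIcc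
  have hcont : ∀ e ρ, Continuous fun s => N.extHam H e s ρ := fun e ρ =>
    (hH.cont _ ρ).comp_continuous hpc fun s => (projIcc (0 : ℝ) 1 zero_le_one s).2
  -- the bound for momenta of one sign; the other sign is reduced to it by reversing the edge
  have hright : ∀ e q, ∃ C, ∀ s ∈ Icc (0 : ℝ) 1, ∀ ρ, 0 ≤ ρ → ρ * q - N.extHam H e s ρ ≤ C := by
    intro e q
    obtain ⟨R, hR⟩ := Filter.eventually_atTop.1 (hH.superlinear (N.Ψ.edge.symm (e, 0)) q)
    set R' := max R 1
    -- on the compact interval of small momenta, convexity bounds the Hamiltonian from below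
    obtain ⟨C₀, hC₀⟩ := (isCompact_Icc (a := (0 : ℝ)) (b := 1)).bddAbove_image
      (hcont e (-R')).continuousOn
    obtain ⟨C₁, hC₁⟩ := (isCompact_Icc (a := (0 : ℝ)) (b := 1)).bddBelow_image
      (hcont e 0).continuousOn
    refine ⟨max 0 (R' * |q| + |C₀| + 2 * |C₁|), fun s hs ρ hρ => ?_⟩
    have hR1 : 1 ≤ R' := le_max_right _ _
    rcases le_or_gt R' ρ with h | h
    · have h1 : q ≤ N.baseHam H e s ρ / ρ := hR ρ ((le_max_left _ _).trans h) s hs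
      rw [le_div_iff₀ (by linarith), ← extHam_of_mem hs] at h1
      refine le_trans ?_ (le_max_left _ _)
      linarith
    · refine le_trans ?_ (le_max_right _ _)
      have hcv : ConvexOn ℝ univ (N.extHam H e s) := by
        rw [extHam_of_mem hs]; exact (hH.convex _ s hs).convexOn
      have h1 : N.extHam H e s (-R') ≤ C₀ := hC₀ ⟨s, hs, rfl⟩
      have h2 : C₁ ≤ N.extHam H e s 0 := hC₁ ⟨s, hs, rfl⟩
      have h3 := hcv.2 (mem_univ (-R')) (mem_univ ρ)
        (show 0 ≤ ρ / (ρ + R') by positivity) (show 0 ≤ R' / (ρ + R') by positivity)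
        (by field_simp)
      have h4 : (ρ / (ρ + R')) • (-R') + (R' / (ρ + R')) • ρ = 0 := by
        simp only [smul_eq_mul]; field_simp; ring
      rw [h4] at h3
      simp only [smul_eq_mul] at h3
      have h5 : C₁ * (ρ + R') ≤ ρ * C₀ + R' * N.extHam H e s ρ := by
        have h6 : (ρ / (ρ + R')) * N.extHam H e s (-R') ≤ (ρ / (ρ + R')) * C₀ :=
          mul_le_mul_of_nonneg_left h1 (by positivity)
        have h7 := (h2.trans h3).trans (add_le_add_left h6 _)
        have h8 : C₁ ≤ (ρ * C₀ + R' * N.extHam H e s ρ) / (ρ + R') :=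
          h7.trans_eq (by ring)
        rwa [le_div_iff₀ (by positivity)] at h8
      have h6 : ρ * C₀ ≤ R' * |C₀| :=
        (mul_le_mul_of_nonneg_left (le_abs_self C₀) hρ).trans
          (mul_le_mul_of_nonneg_right h.le (abs_nonneg _))
      have h7 : -(2 * R' * |C₁|) ≤ C₁ * (ρ + R') := by
        have := neg_abs_le C₁
        have := abs_nonneg C₁
        nlinarith
      have h8 : -(|C₀| + 2 * |C₁|) ≤ N.extHam H e s ρ := by
        have : R' * (-(|C₀| + 2 * |C₁|)) ≤ R' * N.extHam H e s ρ := by linarith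
        exact le_of_mul_le_mul_left this (by linarith)
      have h9 : ρ * q ≤ R' * |q| :=
        (mul_le_mul_of_nonneg_left (le_abs_self q) hρ).trans
          (mul_le_mul_of_nonneg_right h.le (abs_nonneg _))
      linarith
  have hclamp : ∀ s, ∃ s' ∈ Icc (0 : ℝ) 1, N.extHam H e s = N.extHam H e s' := fun s =>
    ⟨projIcc (0 : ℝ) 1 zero_le_one s, (projIcc (0 : ℝ) 1 zero_le_one s).2, by
      funext ρ; simp [extHam]⟩
  refine ⟨hcont e, fun s => hH.diff _ _ (projIcc (0 : ℝ) 1 zero_le_one s).2,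
    fun s => hH.convex _ _ (projIcc (0 : ℝ) 1 zero_le_one s).2, fun q => ?_, hclamp⟩
  obtain ⟨C, hC⟩ := hright e q
  obtain ⟨D, hD⟩ := hright (Γ₀.neg e) (-q)
  refine ⟨max C D, fun s ρ => ?_⟩
  obtain ⟨s', hs', he⟩ := hclamp s
  rw [he]
  rcases le_total 0 ρ with h | h
  · exact (hC s' hs' ρ h).trans (le_max_left _ _)
  · have h1 : 1 - s' ∈ Icc (0 : ℝ) 1 := ⟨by linarith [hs'.2], by linarith [hs'.1]⟩
    have h2 := hD (1 - s') h1 (-ρ) (by linarith)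
    rw [hH.extHam_neg e h1, sub_sub_cancel, neg_neg, neg_mul_neg] at h2
    exact h2.trans (le_max_right _ _)

theorem critVal_eq (hH : N.IsHamiltonian H) (γ : A) :
    critVal (H γ) = critVal (N.extHam H (N.Ψ.edge γ).1) :=
  iSup_congr fun s => by rw [hH.eq_extHam γ s.2]

theorem critVal_neg (hH : N.IsHamiltonian H) (e : E₀) :
    critVal (N.extHam H (Γ₀.neg e)) = critVal (N.extHam H e) := by
  have hinf : ∀ s ∈ Icc (0 : ℝ) 1,
      (⨅ ρ, N.extHam H (Γ₀.neg e) s ρ) = ⨅ ρ, N.extHam H e (1 - s) ρ := fun s hs => by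
    simp_rw [hH.extHam_neg e hs]
    exact (Equiv.neg ℝ).iInf_comp (g := N.extHam H e (1 - s))
  let σ : Icc (0 : ℝ) 1 ≃ Icc (0 : ℝ) 1 := unitInterval.symmHomeomorph.toEquiv
  rw [critVal, critVal, ← σ.iSup_comp]
  refine iSup_congr fun s => ?_
  rw [hinf _ (σ s).2]
  congr 1
  simp [σ, unitInterval.symmHomeomorph]

theorem critVal_rev (hH : N.IsHamiltonian H) (γ : A) :
    critVal (H (N.rev γ)) = critVal (H γ) := by
  rw [hH.critVal_eq, hH.critVal_eq, N.edge_rev, hH.critVal_neg]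

theorem discLag_eq (e : E₀) (q : ℝ) :
    discLag (N.baseHam H) e q = Tonelli.dlag (N.extHam H e) q := by
  have h1 : critVal (N.baseHam H e) = critVal (N.extHam H e) :=
    iSup_congr fun s => by rw [extHam_of_mem s.2]
  have h2 : sigma (N.baseHam H) e = Tonelli.sig (N.extHam H e) := by
    funext a
    refine intervalIntegral.integral_congr fun s hs => ?_
    rw [uIcc_of_le zero_le_one] at hs
    simp only [sigmaPlus, topRoot, extHam_of_mem hs]
  have h3 : discHam (N.baseHam H) e = Tonelli.dham (N.extHam H e) := by
    rw [discHam, Tonelli.dham, h1, h2]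
  rw [discLag, Tonelli.dlag, h1, h2, h3]

end IsHamiltonian

theorem hasDerivAt_arc (N : PeriodicNetwork S d A) (γ : A) {s : ℝ} (hs : s ∈ Ioo (0 : ℝ) 1) :
    HasDerivAt (N.arc γ) (N.vel γ s) s :=
  (((N.contDiff γ).differentiableOn one_ne_zero s
    (Ioo_subset_Icc_self hs)).hasDerivWithinAt).hasDerivAt (Icc_mem_nhds hs.1 hs.2)

theorem vel_rev (γ : A) {s : ℝ} (hs : s ∈ Ioo (0 : ℝ) 1) :
    N.vel (N.rev γ) (1 - s) = -N.vel γ s := by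
  have hs' : 1 - s ∈ Ioo (0 : ℝ) 1 := ⟨by linarith [hs.2], by linarith [hs.1]⟩
  have h2 := HasDerivAt.comp_const_sub 1 (1 - s) (f := N.arc γ) (f' := N.vel γ s)
    (by rw [sub_sub_cancel]; exact N.hasDerivAt_arc γ hs)
  have h5 : HasDerivAt (N.arc (N.rev γ)) (-N.vel γ s) (1 - s) := by
    refine h2.congr_of_eventuallyEq ?_
    filter_upwards [Icc_mem_nhds hs'.1 hs'.2] with t ht
    exact N.arc_rev γ t ht
  exact h5.hasDerivWithinAt.derivWithin (uniqueDiffOn_Icc zero_lt_one _ (Ioo_subset_Icc_self hs'))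

/-- Along a curve `γ(s(t))` inside an arc the overall Lagrangian is `L_γ(s, s')`. -/
theorem IsHamiltonian.lagrangian_arc (hH : N.IsHamiltonian H) (γ : A) {s : ℝ}
    (hs : s ∈ Ioo (0 : ℝ) 1) (r : ℝ) :
    N.lagrangian H (N.arc γ s) (r • N.vel γ s) = fenchel (N.extHam H (N.Ψ.edge γ).1) s r := by
  have hex : ∃ p : A × ℝ, p.2 ∈ Ioo (0 : ℝ) 1 ∧ N.arc p.1 p.2 = N.arc γ s := ⟨(γ, s), hs, rfl⟩
  have hv : N.vel γ s ≠ 0 := N.regular γ s (Ioo_subset_Icc_self hs)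
  have hv' : ‖N.vel γ s‖ ^ 2 ≠ 0 := pow_ne_zero _ (norm_ne_zero_iff.2 hv)
  have hsI := Ioo_subset_Icc_self hs
  have hdiv : inner ℝ (r • N.vel γ s) (N.vel γ s) / ‖N.vel γ s‖ ^ 2 = r := by
    rw [real_inner_smul_left, real_inner_self_eq_norm_sq, mul_div_cancel_right₀ _ hv']
  rw [Network.lagrangian, if_neg (N.arc_notMem_vertices γ hs), dif_pos hex]
  simp only
  obtain ⟨h1, h2⟩ := hex.choose_spec
  have key : ∀ p : A × ℝ, p.2 ∈ Ioo (0 : ℝ) 1 → N.arc p.1 p.2 = N.arc γ s →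
      fenchel (H p.1) p.2 (inner ℝ (r • N.vel γ s) (N.vel p.1 p.2) / ‖N.vel p.1 p.2‖ ^ 2) =
        fenchel (N.extHam H (N.Ψ.edge γ).1) s r := by
    rintro ⟨γ', s'⟩ hs' h
    simp only at hs' h ⊢
    rcases N.eq_or_eq_rev_of_arc_eq hs (Ioo_subset_Icc_self hs') h.symm with ⟨rfl, rfl⟩ | ⟨rfl, rfl⟩
    · rw [hdiv, fenchel, fenchel, hH.eq_extHam _ hsI]
    · rw [vel_rev γ hs, norm_neg, inner_neg_right, neg_div, hdiv, fenchel, fenchel]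
      rw [← (Equiv.neg ℝ).iSup_comp]
      refine iSup_congr fun ρ => ?_
      rw [hH.compat γ _ (Ioo_subset_Icc_self hs'), sub_sub_cancel, hH.eq_extHam _ hsI]
      simp
  exact key _ h1 h2

theorem lagrangian_vertex {z : EuclideanSpace ℝ (Fin d)} (hz : z ∈ N.vertices) :
    N.lagrangian H z 0 = N.fluxLimiter H z := by
  rw [Network.lagrangian, if_pos hz, if_pos rfl]

theorem IsHamiltonian.fluxLimiter_le (hH : N.IsHamiltonian H) (γ : A) :
    N.fluxLimiter H (N.arc γ 0) ≤ -critVal (N.extHam H (N.Ψ.edge γ).1) := by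
  have := ciInf_le (Finite.bddBelow_range fun γ' : {γ' : A // N.arc γ' 1 = N.arc γ 0} =>
    -critVal (H γ'.1)) ⟨N.rev γ, N.arc_rev_one γ⟩
  rwa [hH.critVal_rev, hH.critVal_eq] at this

theorem IsHamiltonian.exists_fluxLimiter_eq (hH : N.IsHamiltonian H)
    {z : EuclideanSpace ℝ (Fin d)} (hz : z ∈ N.vertices) :
    ∃ γ, N.arc γ 0 = z ∧ N.fluxLimiter H z = -critVal (N.extHam H (N.Ψ.edge γ).1) := by
  obtain ⟨γ₀, hγ₀⟩ := N.exists_arc_one_eq hz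
  have : Nonempty {γ' : A // N.arc γ' 1 = z} := ⟨⟨γ₀, hγ₀⟩⟩
  obtain ⟨γ, hγ⟩ := exists_eq_ciInf_of_finite (f := fun γ' : {γ' : A // N.arc γ' 1 = z} =>
    -critVal (H γ'.1))
  refine ⟨N.rev γ.1, (N.arc_rev_zero _).trans γ.2, ?_⟩
  rw [← hH.critVal_eq, hH.critVal_rev]
  exact hγ.symm

end PeriodicNetwork

/-! ### Curves that realize the discrete action -/

theorem LipschitzOnWith.Icc_union {E : Type*} [PseudoMetricSpace E] {f : ℝ → E} {K : NNReal}
    {a b c : ℝ} (h₁ : LipschitzOnWith K f (Icc a b)) (h₂ : LipschitzOnWith K f (Icc b c)) :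
    LipschitzOnWith K f (Icc a c) := by
  have key : ∀ x ∈ Icc a c, ∀ y ∈ Icc a c, x ≤ y → dist (f x) (f y) ≤ K * dist x y := by
    intro x hx y hy hxy
    rcases le_total y b with h | h
    · exact h₁.dist_le_mul x ⟨hx.1, hxy.trans h⟩ y ⟨hy.1, h⟩
    rcases le_total b x with h' | h'
    · exact h₂.dist_le_mul x ⟨h', hx.2⟩ y ⟨h, hy.2⟩
    · have e1 := h₁.dist_le_mul x ⟨hx.1, h'⟩ b ⟨hx.1.trans h', le_rfl⟩
      have e2 := h₂.dist_le_mul b ⟨le_rfl, h.trans hy.2⟩ y ⟨h, hy.2⟩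
      have e3 := dist_triangle (f x) (f b) (f y)
      rw [Real.dist_eq, abs_sub_comm, abs_of_nonneg (by linarith)] at e1 e2 ⊢
      nlinarith
  refine LipschitzOnWith.of_dist_le_mul fun x hx y hy => ?_
  rcases le_total x y with h | h
  · exact key x hx y hy h
  · rw [dist_comm, dist_comm x]; exact key y hy x hx h

namespace Tonelli

variable {h : ℝ → ℝ → ℝ}

/-- The motion along an arc at the level `a`, obtained by inverting the time `τ(x) = ∫ 1 / speed`
needed to reach the position `x`. -/
theorem exists_flow (hh : Tonelli h) {a : ℝ} (ha : critVal h < a) (α β : ℝ) :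
    ∃ φ : ℝ → ℝ, (∃ K, LipschitzWith K φ) ∧ StrictMono φ ∧ φ 0 = α ∧
      φ (∫ s in α..β, (speed h a s)⁻¹) = β ∧ ∀ t, HasDerivAt φ (speed h a (φ t)) t := by
  have hc := hh.continuous_inv_speed ha
  have hpos : ∀ s, 0 < speed h a s := fun s => hh.speed_pos ha
  obtain ⟨M, hM⟩ : ∃ M, ∀ s, speed h a s ≤ M := by
    obtain ⟨M, hM⟩ := (isCompact_Icc (a := (0 : ℝ)) (b := 1)).bddAbove_image
      (hh.continuous_speed_right ha.le).continuousOn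
    refine ⟨M, fun s => ?_⟩
    obtain ⟨s', hs', he⟩ := hh.clamp s
    have : speed h a s = speed h a s' := by simp only [speed, topRoot, he]
    rw [this]
    exact hM ⟨s', hs', rfl⟩
  have hM0 : 0 < M := (hpos 0).trans_le (hM 0)
  set τ : ℝ → ℝ := fun x => ∫ s in α..x, (speed h a s)⁻¹ with hτ
  have hder : ∀ x, HasDerivAt τ (speed h a x)⁻¹ x := fun x =>
    intervalIntegral.integral_hasDerivAt_right (hc.intervalIntegrable _ _)
      (hc.stronglyMeasurableAtFilter _ _) hc.continuousAt
  have hτc : Continuous τ := continuous_iff_continuousAt.2 fun x => (hder x).continuousAt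
  have hgrow : ∀ x y, x ≤ y → (y - x) / M ≤ τ y - τ x := by
    intro x y hxy
    have h1 : τ y - τ x = ∫ s in x..y, (speed h a s)⁻¹ :=
      intervalIntegral.integral_interval_sub_left (hc.intervalIntegrable _ _)
        (hc.intervalIntegrable _ _)
    have h2 : ∫ s in x..y, M⁻¹ ≤ ∫ s in x..y, (speed h a s)⁻¹ :=
      intervalIntegral.integral_mono_on hxy (by simp) (hc.intervalIntegrable _ _)
        fun s _ => inv_anti₀ (hpos s) (hM s)
    rw [h1]
    simpa [div_eq_mul_inv] using h2
  have hmono : StrictMono τ := fun x y hxy => by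
    have h1 := hgrow x y hxy.le
    have h2 : 0 < (y - x) / M := div_pos (by linarith) hM0
    linarith
  have hα : τ α = 0 := by simp [hτ]
  have htop : Filter.Tendsto τ Filter.atTop Filter.atTop := by
    refine Filter.tendsto_atTop_mono' _ ?_
      ((Filter.tendsto_atTop_add_const_right _ (-α) Filter.tendsto_id).atTop_div_const hM0)
    filter_upwards [Filter.eventually_ge_atTop α] with x hx
    have := hgrow α x hx
    simp only [id]
    rw [← sub_eq_add_neg]
    linarith
  have hbot : Filter.Tendsto τ Filter.atBot Filter.atBot := by
    refine Filter.tendsto_atBot_mono' _ ?_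
      ((Filter.tendsto_atBot_add_const_right _ (-α) Filter.tendsto_id).atBot_div_const hM0)
    filter_upwards [Filter.eventually_le_atBot α] with x hx
    have := hgrow x α hx
    simp only [id]
    have e : (x + -α) / M = -((α - x) / M) := by ring
    rw [e]
    linarith
  set Φ := hmono.orderIsoOfSurjective τ (hτc.surjective htop hbot) with hΦ
  have hleft : ∀ x, Φ.symm (τ x) = x := fun x => Φ.symm_apply_apply x
  have hright : ∀ t, τ (Φ.symm t) = t := fun t => Φ.apply_symm_apply t
  have hd : ∀ t, HasDerivAt (fun t => Φ.symm t) (speed h a (Φ.symm t)) t := fun t => by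
    have := HasDerivAt.of_local_left_inverse (f := τ) (g := fun t => Φ.symm t) (a := t)
      Φ.symm.continuous.continuousAt (hder (Φ.symm t)) (inv_ne_zero (hpos _).ne')
      (Filter.Eventually.of_forall hright)
    rwa [inv_inv] at this
  refine ⟨fun t => Φ.symm t, ⟨M.toNNReal, lipschitzWith_of_nnnorm_deriv_le
    (fun t => (hd t).differentiableAt) fun t => ?_⟩, Φ.symm.strictMono, ?_, hleft β, hd⟩
  · rw [(hd t).deriv, ← NNReal.coe_le_coe, coe_nnnorm, Real.norm_eq_abs, abs_of_pos (hpos _),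
      Real.coe_toNNReal _ hM0.le]
    exact hM _
  · simp only [← hα]
    exact hleft α

end Tonelli

namespace PeriodicNetwork

variable {V₀ E₀ : Type*} [Finite E₀] {Γ₀ : OGraph V₀ E₀} {P : Γ₀.Orientation}
  {S : OGraph.SpanningTree P} {d : ℕ} {A : Type*} (N : PeriodicNetwork S d A)
  (H : A → ℝ → ℝ → ℝ)

/-- The point `w` can be reached from `z` in time `T` along a Lipschitz curve of action at most
`c`. -/
def Reach (z w : EuclideanSpace ℝ (Fin d)) (T c : ℝ) : Prop :=
  0 ≤ T ∧ ∃ (ζ : ℝ → EuclideanSpace ℝ (Fin d)) (K : NNReal), LipschitzOnWith K ζ (Icc 0 T) ∧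
    (∀ t ∈ Icc 0 T, ζ t ∈ N.carrier) ∧ ζ 0 = z ∧ ζ T = w ∧
    IntervalIntegrable (fun t => N.lagrangian H (ζ t) (deriv ζ t)) MeasureTheory.volume 0 T ∧
    ∫ t in (0 : ℝ)..T, N.lagrangian H (ζ t) (deriv ζ t) ≤ c

variable {N H}

theorem Reach.mono {z w : EuclideanSpace ℝ (Fin d)} {T c c' : ℝ} (h : N.Reach H z w T c)
    (hc : c ≤ c') : N.Reach H z w T c' := by
  obtain ⟨hT, ζ, K, h1, h2, h3, h4, h5, h6⟩ := h
  exact ⟨hT, ζ, K, h1, h2, h3, h4, h5, h6.trans hc⟩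

theorem Reach.minAction_le {z w : EuclideanSpace ℝ (Fin d)} {T c : ℝ} (h : N.Reach H z w T c) :
    N.minAction H z w T ≤ (c : EReal) := by
  obtain ⟨hT, ζ, K, h1, h2, h3, h4, h5, h6⟩ := h
  have hac : AbsolutelyContinuousOnInterval ζ 0 T := by
    rw [← uIcc_of_le hT] at h1
    exact h1.absolutelyContinuousOnInterval
  refine (iInf₂_le ζ ⟨⟨hac, h2⟩, h3, h4⟩).trans ?_
  rw [Network.action, if_pos h5]
  exact EReal.coe_le_coe_iff.2 h6

theorem Reach.trans {z w x : EuclideanSpace ℝ (Fin d)} {T₁ T₂ c₁ c₂ : ℝ}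
    (h₁ : N.Reach H z w T₁ c₁) (h₂ : N.Reach H w x T₂ c₂) :
    N.Reach H z x (T₁ + T₂) (c₁ + c₂) := by
  obtain ⟨hT₁, ζ₁, K₁, l₁, m₁, a₁, b₁, i₁, j₁⟩ := h₁
  obtain ⟨hT₂, ζ₂, K₂, l₂, m₂, a₂, b₂, i₂, j₂⟩ := h₂
  set ζ : ℝ → EuclideanSpace ℝ (Fin d) := fun t => if t ≤ T₁ then ζ₁ t else ζ₂ (t - T₁) with hζ
  have e₁ : ∀ t, t ≤ T₁ → ζ t = ζ₁ t := fun t ht => if_pos ht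
  have e₂ : ∀ t, T₁ ≤ t → ζ t = ζ₂ (t - T₁) := fun t ht => by
    rcases ht.eq_or_lt with h | h
    · rw [e₁ t h.ge, ← h, sub_self, a₂, b₁]
    · exact if_neg h.not_ge
  have f₁ : EqOn (fun t => N.lagrangian H (ζ t) (deriv ζ t))
      (fun t => N.lagrangian H (ζ₁ t) (deriv ζ₁ t)) (Ioo 0 T₁) := fun t ht => by
    have : ζ =ᶠ[nhds t] ζ₁ := by
      filter_upwards [Iio_mem_nhds ht.2] with u hu using e₁ u (le_of_lt hu)
    simp only [this.deriv_eq, this.eq_of_nhds]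
  have f₂ : EqOn (fun t => N.lagrangian H (ζ t) (deriv ζ t))
      (fun t => N.lagrangian H (ζ₂ (t - T₁)) (deriv ζ₂ (t - T₁))) (Ioo T₁ (T₁ + T₂)) :=
    fun t ht => by
      have : ζ =ᶠ[nhds t] fun u => ζ₂ (u - T₁) := by
        filter_upwards [Ioi_mem_nhds ht.1] with u hu using e₂ u (le_of_lt hu)
      simp only [this.deriv_eq, this.eq_of_nhds, deriv_comp_sub_const]
  have g₁ : IntervalIntegrable (fun t => N.lagrangian H (ζ t) (deriv ζ t))
      MeasureTheory.volume 0 T₁ :=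
    i₁.congr_uIoo (by rw [uIoo_of_le hT₁]; exact f₁.symm)
  have g₂ : IntervalIntegrable (fun t => N.lagrangian H (ζ t) (deriv ζ t))
      MeasureTheory.volume T₁ (T₁ + T₂) := by
    have := i₂.comp_sub_right T₁
    rw [zero_add, add_comm T₂] at this
    exact this.congr_uIoo (by rw [uIoo_of_le (by linarith)]; exact f₂.symm)
  refine ⟨add_nonneg hT₁ hT₂, ζ, max K₁ K₂, ?_, ?_, ?_, ?_, g₁.trans g₂, ?_⟩
  · refine LipschitzOnWith.Icc_union (b := T₁) ?_ ?_
    · intro x hx y hy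
      rw [e₁ x hx.2, e₁ y hy.2]
      exact l₁.weaken (le_max_left K₁ K₂) hx hy
    · have h3 : LipschitzOnWith (max K₁ K₂) (fun t => ζ₂ (t - T₁)) (Icc T₁ (T₁ + T₂)) := by
        refine LipschitzOnWith.of_dist_le_mul fun x hx y hy => ?_
        have := (l₂.weaken (le_max_right K₁ K₂)).dist_le_mul (x - T₁)
          ⟨by linarith [hx.1], by linarith [hx.2]⟩ (y - T₁) ⟨by linarith [hy.1], by linarith [hy.2]⟩
        simpa using this
      intro x hx y hy
      rw [e₂ x hx.1, e₂ y hy.1]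
      exact h3 hx hy
  · intro t ht
    rcases le_total t T₁ with h | h
    · rw [e₁ t h]; exact m₁ t ⟨ht.1, h⟩
    · rw [e₂ t h]; exact m₂ _ ⟨by linarith, by linarith [ht.2]⟩
  · rw [e₁ 0 hT₁, a₁]
  · rw [e₂ _ (by linarith), add_sub_cancel_left, b₂]
  · rw [← intervalIntegral.integral_add_adjacent_intervals g₁ g₂,
      intervalIntegral.integral_congr_Ioo_of_le hT₁ f₁,
      intervalIntegral.integral_congr_Ioo_of_le (by linarith) f₂,
      intervalIntegral.integral_comp_sub_right
        (fun t => N.lagrangian H (ζ₂ t) (deriv ζ₂ t)) T₁, sub_self, add_sub_cancel_left]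
    exact add_le_add j₁ j₂

/-- Waiting at a point of the network. -/
theorem Reach.wait {z : EuclideanSpace ℝ (Fin d)} (hz : z ∈ N.carrier) {T : ℝ} (hT : 0 ≤ T) :
    N.Reach H z z T (T * N.lagrangian H z 0) :=
  ⟨hT, fun _ => z, 0, LipschitzWith.const z |>.lipschitzOnWith, fun _ _ => hz, rfl, rfl, by simp,
    by simp⟩

theorem IsHamiltonian.lagrangian_arc_zero_le (hH : N.IsHamiltonian H) (γ : A) {s : ℝ}
    (hs : s ∈ Icc (0 : ℝ) 1) :
    N.lagrangian H (N.arc γ s) 0 ≤ -⨅ ρ, N.extHam H (N.Ψ.edge γ).1 s ρ := by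
  have hle := (hH.tonelli (N.Ψ.edge γ).1).inf_le_critVal s
  rcases hs.1.eq_or_lt with h0 | h0
  · rw [← h0, lagrangian_vertex (N.arc_mem_vertices_zero γ), h0]
    exact (h0 ▸ hH.fluxLimiter_le γ).trans (neg_le_neg hle)
  rcases hs.2.eq_or_lt with h1 | h1
  · have := hH.fluxLimiter_le (N.rev γ)
    rw [N.edge_rev, hH.critVal_neg, N.arc_rev_zero] at this
    rw [h1] at hle ⊢
    rw [lagrangian_vertex (N.arc_mem_vertices_one γ)]
    exact this.trans (neg_le_neg hle)
  · have := hH.lagrangian_arc γ ⟨h0, h1⟩ 0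
    rw [zero_smul] at this
    rw [this, Tonelli.fenchel_zero]

/-- Travelling along an arc at a supercritical level. -/
theorem IsHamiltonian.reach_run (hH : N.IsHamiltonian H) (γ : A) {a α β : ℝ} (hα : 0 ≤ α)
    (hαβ : α ≤ β) (hβ : β ≤ 1) (ha : critVal (N.extHam H (N.Ψ.edge γ).1) < a) :
    N.Reach H (N.arc γ α) (N.arc γ β)
      (∫ s in α..β, (Tonelli.speed (N.extHam H (N.Ψ.edge γ).1) a s)⁻¹)
      ((∫ s in α..β, topRoot (N.extHam H (N.Ψ.edge γ).1) a s) -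
        a * ∫ s in α..β, (Tonelli.speed (N.extHam H (N.Ψ.edge γ).1) a s)⁻¹) := by
  set h := N.extHam H (N.Ψ.edge γ).1
  have hh : Tonelli h := hH.tonelli _
  obtain ⟨φ, ⟨K, hK⟩, hmono, hφ0, hφT, hder⟩ := hh.exists_flow ha α β
  set T := ∫ s in α..β, (Tonelli.speed h a s)⁻¹
  have hT : 0 ≤ T := intervalIntegral.integral_nonneg hαβ fun s _ =>
    inv_nonneg.2 (hh.speed_pos ha).le
  have hφI : ∀ t ∈ Icc 0 T, φ t ∈ Icc (0 : ℝ) 1 := fun t ht => by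
    have h1 := hmono.monotone ht.1
    have h2 := hmono.monotone ht.2
    rw [hφ0] at h1
    rw [hφT] at h2
    exact ⟨hα.trans h1, h2.trans hβ⟩
  have hφc : Continuous φ := hK.continuous
  obtain ⟨K', hK'⟩ := (N.contDiff γ).exists_lipschitzOnWith one_ne_zero (convex_Icc 0 1)
    isCompact_Icc
  set U : ℝ → ℝ := fun x => ∫ s in α..x, topRoot h a s
  have hUd : ∀ x, HasDerivAt U (topRoot h a x) x := fun x => by
    have hc := hh.continuous_topRoot_right ha.le
    exact intervalIntegral.integral_hasDerivAt_right (hc.intervalIntegrable _ _)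
      (hc.stronglyMeasurableAtFilter _ _) hc.continuousAt
  have hL : EqOn (fun t => N.lagrangian H (N.arc γ (φ t)) (deriv (fun t => N.arc γ (φ t)) t))
      (fun t => topRoot h a (φ t) * Tonelli.speed h a (φ t) - a) (Ioo 0 T) := fun t ht => by
    have hI : φ t ∈ Ioo (0 : ℝ) 1 := by
      have h1 := hmono ht.1
      have h2 := hmono ht.2
      rw [hφ0] at h1
      rw [hφT] at h2
      exact ⟨hα.trans_lt h1, h2.trans_le hβ⟩
    have h1 : deriv (fun t => N.arc γ (φ t)) t = Tonelli.speed h a (φ t) • N.vel γ (φ t) :=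
      (HasDerivAt.scomp t (N.hasDerivAt_arc γ hI) (hder t)).deriv
    simp only [h1]
    rw [hH.lagrangian_arc γ hI, hh.fenchel_speed ha.le]
  have hcont : Continuous fun t => topRoot h a (φ t) * Tonelli.speed h a (φ t) - a :=
    (((hh.continuous_topRoot_right ha.le).comp hφc).mul
      ((hh.continuous_speed_right ha.le).comp hφc)).sub continuous_const
  refine ⟨hT, fun t => N.arc γ (φ t), K' * K, hK'.comp hK.lipschitzOnWith hφI,
    fun t ht => N.arc_mem_carrier γ (hφI t ht), congrArg _ hφ0, congrArg _ hφT, ?_, ?_⟩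
  · exact (hcont.intervalIntegrable 0 T).congr_uIoo (by rw [uIoo_of_le hT]; exact hL.symm)
  · rw [intervalIntegral.integral_congr_Ioo_of_le hT hL]
    have hF : ∀ t ∈ uIcc 0 T, HasDerivAt (fun t => U (φ t) - a * t)
        (topRoot h a (φ t) * Tonelli.speed h a (φ t) - a) t := fun t _ => by
      have h1 := HasDerivAt.comp t (hUd (φ t)) (hder t)
      have h2 := (hasDerivAt_id t).const_mul a
      rw [mul_one] at h2
      exact h1.sub h2
    rw [intervalIntegral.integral_eq_sub_of_hasDerivAt hF (hcont.intervalIntegrable _ _),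
      hφ0, hφT]
    simp [U]

/-- Crossing an arc in time `1 / q` costs at most `ℒ(e, q) / q`, up to an arbitrarily small error:
run at a level provided by `Tonelli.exists_level`, and spend the remaining time at a point where
the minimum of the Hamiltonian is almost critical. -/
theorem IsHamiltonian.reach_cross (hH : N.IsHamiltonian H) (γ : A) {q ε : ℝ} (hq : 0 < q)
    (hε : 0 < ε) : N.Reach H (N.arc γ 0) (N.arc γ 1) (1 / q)
      (1 / q * Tonelli.dlag (N.extHam H (N.Ψ.edge γ).1) q + ε) := by
  have hh : Tonelli (N.extHam H (N.Ψ.edge γ).1) := hH.tonelli _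
  have hrun := fun {a α β : ℝ} => hH.reach_run γ (a := a) (α := α) (β := β)
  have hwait := fun {s : ℝ} => hH.lagrangian_arc_zero_le γ (s := s)
  set h := N.extHam H (N.Ψ.edge γ).1
  have hT : 0 < 1 / q := by positivity
  obtain ⟨a, ha, haT, hae⟩ := hh.exists_level hT (half_pos hε)
  obtain ⟨⟨s, hs⟩, hs'⟩ := exists_lt_of_lt_ciSup
    (show critVal h - ε / 2 * q < critVal h by linarith [mul_pos (half_pos hε) hq])
  simp only at hs'
  have hc := hh.continuous_inv_speed ha
  have hr := hh.continuous_topRoot_right ha.le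
  have hsumT : (∫ s in (0 : ℝ)..s, (Tonelli.speed h a s)⁻¹) +
      (∫ s in s..1, (Tonelli.speed h a s)⁻¹) = Tonelli.travelTime h a :=
    intervalIntegral.integral_add_adjacent_intervals (hc.intervalIntegrable _ _)
      (hc.intervalIntegrable _ _)
  have hsumU : (∫ s in (0 : ℝ)..s, topRoot h a s) + (∫ s in s..1, topRoot h a s) =
      Tonelli.sig h a :=
    intervalIntegral.integral_add_adjacent_intervals (hr.intervalIntegrable _ _)
      (hr.intervalIntegrable _ _)
  have key := ((hrun le_rfl hs.1 hs.2 ha).trans (Reach.wait (N.arc_mem_carrier γ hs)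
    (sub_nonneg.2 haT))).trans (hrun hs.1 hs.2 le_rfl ha)
  have hdl : 1 / q * (Tonelli.sig h a * q - a) ≤ 1 / q * Tonelli.dlag h q :=
    mul_le_mul_of_nonneg_left (hh.le_dlag q ha.le) hT.le
  have hdl' : 1 / q * (Tonelli.sig h a * q - a) = Tonelli.sig h a - a * (1 / q) := by
    field_simp
  have hpos : 0 ≤ Tonelli.travelTime h a :=
    intervalIntegral.integral_nonneg zero_le_one fun s _ => inv_nonneg.2 (hh.speed_pos ha).le
  set W := 1 / q - Tonelli.travelTime h a
  have hW : 0 ≤ W := sub_nonneg.2 haT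
  have hw : W * N.lagrangian H (N.arc γ s) 0 ≤ W * (-critVal h + ε / 2 * q) :=
    mul_le_mul_of_nonneg_left (by have := hwait hs; linarith) hW
  have hW' : W * (ε / 2 * q) ≤ ε / 2 := by
    have h1 : W ≤ 1 / q := by simp only [W]; linarith
    calc W * (ε / 2 * q) ≤ 1 / q * (ε / 2 * q) :=
          mul_le_mul_of_nonneg_right h1 (by positivity)
      _ = ε / 2 := by field_simp
  have htot : (∫ s in (0 : ℝ)..s, (Tonelli.speed h a s)⁻¹) + W +
      (∫ s in s..1, (Tonelli.speed h a s)⁻¹) = 1 / q := by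
    simp only [W]; linarith
  rw [htot] at key
  refine key.mono ?_
  rw [hdl'] at hdl
  have e : a * (∫ s in (0 : ℝ)..s, (Tonelli.speed h a s)⁻¹) +
      a * (∫ s in s..1, (Tonelli.speed h a s)⁻¹) = a * (1 / q) - a * W := by
    rw [← mul_add, hsumT]; simp only [W]; ring
  nlinarith

/-- Each parametrized path lifts to curves of almost the same action. -/
theorem IsHamiltonian.exists_reach (hH : N.IsHamiltonian H) {x y : V₀} {ξ : List (E₀ × ℝ × ℝ)}
    (hξ : IsParamPath Γ₀ x y ξ) (z : N.vertices) (hz : N.π₁ z = x) {ε : ℝ} (hε : 0 < ε) :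
    ∃ w : N.vertices, N.π₁ w = y ∧ N.π₂ w = N.π₂ z + OGraph.rotation S (ξ.map Prod.fst) ∧
      N.Reach H z w (totalTime ξ) (discAction (N.baseHam H) ξ + ε) := by
  have harc : ∀ (e : E₀) (z : N.vertices), N.π₁ z = Γ₀.o e →
      ∃ γ, N.graph.o γ = z ∧ (N.Ψ.edge γ).1 = e := by
    intro e z hz
    refine ⟨N.Ψ.edge.symm (e, N.π₂ z), N.eq_of_π ?_ ?_, ?_⟩
    · rw [N.π₁_o, Equiv.apply_symm_apply, hz]
    · rw [N.π₂_o, Equiv.apply_symm_apply]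
    · rw [Equiv.apply_symm_apply]
  induction hξ generalizing z ε with
  | nil x =>
    refine ⟨z, hz, by simp [OGraph.rotation_nil], ?_⟩
    obtain ⟨γ, hγ⟩ := N.exists_arc_zero_eq z.2
    have hzc : (z : EuclideanSpace ℝ (Fin d)) ∈ N.carrier :=
      hγ ▸ N.arc_mem_carrier γ (by simp)
    have := Reach.wait (H := H) hzc le_rfl
    simp only [totalTime, discAction, List.map_nil, List.sum_nil]
    exact this.mono (by linarith)
  | move e q y l hq hl ih =>
    obtain ⟨γ, hγ, he⟩ := harc e z hz
    obtain ⟨w, hw1, hw2, hw3⟩ := ih (N.graph.t γ) (by rw [N.π₁_t, he]) (half_pos hε)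
    refine ⟨w, hw1, ?_, ?_⟩
    · rw [hw2, N.π₂_t, ← hγ, N.π₂_o, List.map_cons, OGraph.rotation_cons, he, add_assoc]
    · have h1 := hH.reach_cross γ hq (half_pos hε)
      rw [he] at h1
      rw [N.coe_graph_t] at hw3
      have h2 : N.arc γ 0 = z := congrArg Subtype.val hγ
      rw [h2] at h1
      have h3 := h1.trans hw3
      simp only [totalTime, discAction, List.map_cons, List.sum_cons, IsHamiltonian.discLag_eq]
        at h3 ⊢
      exact h3.mono (by linarith)
  | rest e T₁ T₂ y l hT₁ hT₂ hl ih =>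
    obtain ⟨γ, hγ, he⟩ := harc e z hz
    obtain ⟨w, hw1, hw2, hw3⟩ := ih z hz hε
    have h2 : N.arc γ 0 = z := congrArg Subtype.val hγ
    refine ⟨w, hw1, ?_, ?_⟩
    · rw [hw2, List.map_cons, List.map_cons, OGraph.rotation_cons,
        OGraph.rotation_cons, OGraph.thetaEdge_neg, add_neg_cancel_left]
    · have h1 := Reach.wait (H := H) (N.arc_mem_carrier γ (left_mem_Icc.2 zero_le_one))
        (add_nonneg hT₁.le hT₂.le)
      rw [h2] at h1
      have h3 := h1.trans hw3
      have h4 : N.lagrangian H z 0 ≤ -critVal (N.extHam H e) := by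
        rw [lagrangian_vertex z.2, ← h2, ← he]
        exact hH.fluxLimiter_le γ
      have h5 := mul_le_mul_of_nonneg_left h4 (add_nonneg hT₁.le hT₂.le)
      simp only [totalTime, discAction, List.map_cons, List.sum_cons, IsHamiltonian.discLag_eq,
        (hH.tonelli _).dlag_zero, hH.critVal_neg, ← add_assoc] at h3 ⊢
      exact h3.mono (by linarith)

theorem IsHamiltonian.minAction_le_discMinAction (hH : N.IsHamiltonian H) (z₁ z₂ : N.vertices)
    (T : ℝ) : N.minAction H z₁ z₂ T ≤
      discMinAction (N.baseHam H) S (N.π₁ z₁) (N.π₁ z₂) T (N.π₂ z₂ - N.π₂ z₁) := by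
  refine le_iInf₂ fun ξ hξ => ?_
  obtain ⟨h1, rfl, h3⟩ := hξ
  refine EReal.le_of_forall_lt_iff_le.1 fun c hc => ?_
  have hc' : discAction (N.baseHam H) ξ < c := EReal.coe_lt_coe_iff.1 hc
  obtain ⟨w, hw1, hw2, hw3⟩ := hH.exists_reach h1 z₁ rfl (sub_pos.2 hc')
  have hw : w = z₂ := N.eq_of_π hw1 (by rw [hw2, h3, add_sub_cancel])
  subst hw
  rw [add_sub_cancel] at hw3
  exact hw3.minAction_le

end PeriodicNetwork

/-! ### Lower bounds for the action by calibration -/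

namespace Tonelli

variable {h : ℝ → ℝ → ℝ}

/-- The chain rule for the potential `∫ σ` along an absolutely continuous motion. -/
theorem integral_topRoot_comp (hh : Tonelli h) {a : ℝ} (ha : critVal h ≤ a) {c : ℝ → ℝ} {r q : ℝ}
    (hrq : r ≤ q) (hc : AbsolutelyContinuousOnInterval c r q)
    (hI : ∀ t ∈ Icc r q, c t ∈ Icc (0 : ℝ) 1) :
    IntervalIntegrable (fun t => topRoot h a (c t) * deriv c t) MeasureTheory.volume r q ∧
      ∫ t in r..q, topRoot h a (c t) * deriv c t = ∫ s in (c r)..(c q), topRoot h a s := by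
  have hcont := hh.continuous_topRoot_right ha
  set U : ℝ → ℝ := fun x => ∫ s in (0 : ℝ)..x, topRoot h a s with hU
  have hUd : ∀ x, HasDerivAt U (topRoot h a x) x := fun x =>
    intervalIntegral.integral_hasDerivAt_right (hcont.intervalIntegrable _ _)
      (hcont.stronglyMeasurableAtFilter _ _) hcont.continuousAt
  obtain ⟨M, hM⟩ := (isCompact_Icc (a := (0 : ℝ)) (b := 1)).exists_bound_of_continuousOn
    hcont.continuousOn
  have hM0 : 0 ≤ M := (norm_nonneg _).trans (hM 0 (by simp))
  have hf : AbsolutelyContinuousOnInterval (fun t => U (c t)) r q := by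
    refine AbsolutelyContinuousOnInterval.of_dist_le hrq hc hM0 fun x y hx hxy hy =>
      ⟨x, y, le_rfl, hxy, le_rfl, ?_⟩
    have := (convex_Icc (0 : ℝ) 1).norm_image_sub_le_of_norm_hasDerivWithin_le
      (fun z _ => (hUd z).hasDerivWithinAt) (fun z hz => hM z hz)
      (hI y ⟨hx.trans hxy, hy⟩) (hI x ⟨hx, hxy.trans hy⟩)
    simpa [dist_eq_norm] using this
  have hae : ∀ᵐ t, t ∈ uIoc r q → deriv (fun t => U (c t)) t = topRoot h a (c t) * deriv c t := by
    filter_upwards [hc.ae_differentiableAt] with t ht htI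
    exact ((hUd (c t)).comp t (ht (uIoc_subset_uIcc htI)).hasDerivAt).deriv
  refine ⟨hf.intervalIntegrable_deriv.congr_ae ?_, ?_⟩
  · exact (MeasureTheory.ae_restrict_iff' measurableSet_uIoc).2 hae
  · rw [← intervalIntegral.integral_congr_ae hae, hf.integral_deriv_eq_sub]
    exact intervalIntegral.integral_interval_sub_left (hcont.intervalIntegrable _ _)
      (hcont.intervalIntegrable _ _)

end Tonelli

namespace PeriodicNetwork

variable {V₀ E₀ : Type*} [Finite E₀] {Γ₀ : OGraph V₀ E₀} {P : Γ₀.Orientation}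
  {S : OGraph.SpanningTree P} {d : ℕ} {A : Type*} (N : PeriodicNetwork S d A)
  {H : A → ℝ → ℝ → ℝ}

open Classical in
/-- The coordinate of a point along the arc `γ`; points outside of the arc have coordinate `0`, as
has the initial point. -/
def coord (γ : A) (z : EuclideanSpace ℝ (Fin d)) : ℝ :=
  if h : ∃ s ∈ Icc (0 : ℝ) 1, N.arc γ s = z then h.choose else 0

theorem coord_arc (γ : A) {s : ℝ} (hs : s ∈ Icc (0 : ℝ) 1) : N.coord γ (N.arc γ s) = s := by
  have h : ∃ s' ∈ Icc (0 : ℝ) 1, N.arc γ s' = N.arc γ s := ⟨s, hs, rfl⟩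
  rw [coord, dif_pos h]
  exact N.injOn_arc γ h.choose_spec.1 hs h.choose_spec.2

theorem coord_of_notMem (γ : A) {z : EuclideanSpace ℝ (Fin d)} (hz : z ∉ N.arc γ '' Icc 0 1) :
    N.coord γ z = 0 := dif_neg hz

theorem arc_coord (γ : A) {z : EuclideanSpace ℝ (Fin d)} (hz : z ∈ N.arc γ '' Icc 0 1) :
    N.arc γ (N.coord γ z) = z := by
  obtain ⟨s, hs, rfl⟩ := hz
  rw [N.coord_arc γ hs]

theorem coord_mem (γ : A) (z : EuclideanSpace ℝ (Fin d)) : N.coord γ z ∈ Icc (0 : ℝ) 1 := by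
  by_cases hz : z ∈ N.arc γ '' Icc 0 1
  · obtain ⟨s, hs, rfl⟩ := hz
    rwa [N.coord_arc γ hs]
  · rw [N.coord_of_notMem γ hz]
    exact left_mem_Icc.2 zero_le_one

theorem exists_dist_coord_le (γ : A) : ∃ C, 0 ≤ C ∧ ∀ z ∈ N.arc γ '' Icc 0 1,
    ∀ w ∈ N.arc γ '' Icc 0 1, dist (N.coord γ z) (N.coord γ w) ≤ C * dist z w := by
  obtain ⟨c, hc, h⟩ := exists_mul_le_norm_sub zero_lt_one (N.contDiff γ) (N.regular γ)
    (N.injOn_arc γ)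
  refine ⟨c⁻¹, by positivity, ?_⟩
  rintro _ ⟨s, hs, rfl⟩ _ ⟨t, ht, rfl⟩
  rw [N.coord_arc γ hs, N.coord_arc γ ht, dist_eq_norm (N.arc γ s), Real.dist_eq,
    inv_mul_eq_div, le_div_iff₀ hc, mul_comm]
  exact h s hs t ht

theorem absolutelyContinuous_coord {ζ : ℝ → EuclideanSpace ℝ (Fin d)} {r q : ℝ} (hrq : r ≤ q)
    (hζ : AbsolutelyContinuousOnInterval ζ r q) (γ : A)
    (h : ∀ t ∈ Icc r q, ζ t ∈ N.arc γ '' Icc 0 1) :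
    AbsolutelyContinuousOnInterval (fun t => N.coord γ (ζ t)) r q := by
  obtain ⟨C, hC, hC'⟩ := N.exists_dist_coord_le γ
  exact AbsolutelyContinuousOnInterval.of_dist_le hrq hζ hC fun x y hx hxy hy =>
    ⟨x, y, le_rfl, hxy, le_rfl, hC' _ (h x ⟨hx, hxy.trans hy⟩) _ (h y ⟨hx.trans hxy, hy⟩)⟩

variable {N}

theorem ne_rev_of_arc_zero_eq {γ γ' : A} (h : N.arc γ 0 = N.arc γ' 0) : γ ≠ N.rev γ' := by
  rintro rfl
  rw [N.arc_rev_zero] at h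
  exact N.arc_zero_ne_one γ' h.symm

theorem coord_arc_of_ne {γ γ' : A} (h0 : N.arc γ 0 = N.arc γ' 0) (hne : γ' ≠ γ) {s : ℝ}
    (hs : s ∈ Ioo (0 : ℝ) 1) : N.coord γ' (N.arc γ s) = 0 := by
  refine N.coord_of_notMem γ' ?_
  rintro ⟨s', hs', h⟩
  rcases N.eq_or_eq_rev_of_arc_eq hs hs' h.symm with ⟨h1, -⟩ | ⟨h1, -⟩
  · exact hne h1
  · exact ne_rev_of_arc_zero_eq h0.symm h1

/-- The retraction of the star of a vertex to one of its arcs maps absolutely continuous curves to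
absolutely continuous motions. It need not be Lipschitz, as the arcs may be tangent to each other
at the vertex, but a curve has to pass through the vertex in order to change the arc. -/
theorem absolutelyContinuous_coord_openStar {ζ : ℝ → EuclideanSpace ℝ (Fin d)} {r q : ℝ}
    (hrq : r ≤ q) (hζ : AbsolutelyContinuousOnInterval ζ r q) (γ : A)
    (h : ∀ t ∈ Icc r q, ζ t ∈ N.openStar (N.arc γ 0)) :
    AbsolutelyContinuousOnInterval (fun t => N.coord γ (ζ t)) r q := by
  obtain ⟨C, hC, hC'⟩ := N.exists_dist_coord_le γ
  have hcont : ContinuousOn ζ (Icc r q) := by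
    have := hζ.continuousOn
    rwa [uIcc_of_le hrq] at this
  have h0 : N.arc γ 0 ∈ N.arc γ '' Icc 0 1 := ⟨0, by simp, rfl⟩
  have hc0 : N.coord γ (N.arc γ 0) = 0 := N.coord_arc γ (by simp)
  refine AbsolutelyContinuousOnInterval.of_dist_le hrq hζ hC fun x y hx hxy hy => ?_
  have hsub : Icc x y ⊆ Icc r q := Icc_subset_Icc hx hy
  by_cases hv : N.arc γ 0 ∈ ζ '' Icc x y
  · obtain ⟨t, ht, htv⟩ := hv
    have bound : ∀ z, N.coord γ z ≤ C * dist z (ζ t) := fun z => by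
      by_cases hz : z ∈ N.arc γ '' Icc 0 1
      · have := hC' z hz _ h0
        rw [hc0, Real.dist_eq, sub_zero, abs_of_nonneg (N.coord_mem γ z).1] at this
        rwa [htv]
      · rw [N.coord_of_notMem γ hz]
        positivity
    have n1 := (N.coord_mem γ (ζ x)).1
    have n2 := (N.coord_mem γ (ζ y)).1
    rcases le_total (N.coord γ (ζ x)) (N.coord γ (ζ y)) with hle | hle
    · refine ⟨t, y, ht.1, ht.2, le_rfl, ?_⟩
      rw [dist_comm (ζ t), Real.dist_eq, abs_sub_comm, abs_of_nonneg (by linarith)]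
      linarith [bound (ζ y)]
    · refine ⟨x, t, le_rfl, ht.1, ht.2, ?_⟩
      rw [Real.dist_eq, abs_of_nonneg (by linarith)]
      linarith [bound (ζ x)]
  · refine ⟨x, y, le_rfl, hxy, le_rfl, ?_⟩
    obtain ⟨γ', hγ', himg⟩ := N.exists_subset_arc
      (isPreconnected_Icc.image ζ (hcont.mono hsub)) ⟨_, mem_image_of_mem ζ (left_mem_Icc.2 hxy)⟩
      (by rintro _ ⟨t, ht, rfl⟩; exact h t (hsub ht)) hv
    have hx' := himg (mem_image_of_mem ζ (left_mem_Icc.2 hxy))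
    have hy' := himg (mem_image_of_mem ζ (right_mem_Icc.2 hxy))
    by_cases hγγ : γ = γ'
    · subst hγγ
      exact hC' _ (image_mono Ioo_subset_Icc_self hx') _ (image_mono Ioo_subset_Icc_self hy')
    · obtain ⟨s, hs, hsx⟩ := hx'
      obtain ⟨s', hs', hsy⟩ := hy'
      rw [← hsx, ← hsy, coord_arc_of_ne hγ' hγγ hs, coord_arc_of_ne hγ' hγγ hs', dist_self]
      positivity

/-- The calibration inequality `L(ζ, ζ') ≥ σ_a(s) s' - a` at an interior point of an arc. -/
theorem IsHamiltonian.topRoot_mul_deriv_sub_le (hH : N.IsHamiltonian H) (γ : A) {a : ℝ}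
    (ha : critVal (N.extHam H (N.Ψ.edge γ).1) ≤ a) {ζ : ℝ → EuclideanSpace ℝ (Fin d)} {t : ℝ}
    (hd : DifferentiableAt ℝ (fun t => N.coord γ (ζ t)) t) (ht : ζ t ∈ N.arc γ '' Ioo 0 1) :
    topRoot (N.extHam H (N.Ψ.edge γ).1) a (N.coord γ (ζ t)) *
      deriv (fun t => N.coord γ (ζ t)) t - a ≤ N.lagrangian H (ζ t) (deriv ζ t) := by
  have hI : N.coord γ (ζ t) ∈ Ioo (0 : ℝ) 1 := by
    obtain ⟨s, hs, h⟩ := ht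
    rwa [← h, N.coord_arc γ (Ioo_subset_Icc_self hs)]
  have hnear : ζ =ᶠ[nhds t] fun u => N.arc γ (N.coord γ (ζ u)) := by
    filter_upwards [hd.continuousAt.eventually_ne hI.1.ne'] with u hu
    refine (N.arc_coord γ ?_).symm
    by_contra hc
    exact hu (N.coord_of_notMem γ hc)
  have hder : deriv ζ t = deriv (fun t => N.coord γ (ζ t)) t • N.vel γ (N.coord γ (ζ t)) := by
    rw [hnear.deriv_eq]
    exact (HasDerivAt.scomp t (N.hasDerivAt_arc γ hI) hd.hasDerivAt).deriv
  have := hH.lagrangian_arc γ hI (deriv (fun t => N.coord γ (ζ t)) t)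
  rw [N.arc_coord γ (image_mono Ioo_subset_Icc_self ht), ← hder] at this
  rw [this]
  exact (hH.tonelli _).topRoot_mul_sub_le_fenchel ha _ _

/-- Crossing an arc in time `p - r` costs at least `σ(e, a) - a (p - r)`, for each level `a`. -/
theorem IsHamiltonian.sig_sub_le_integral (hH : N.IsHamiltonian H) (γ : A) {a : ℝ}
    (ha : critVal (N.extHam H (N.Ψ.edge γ).1) ≤ a) {ζ : ℝ → EuclideanSpace ℝ (Fin d)} {r p : ℝ}
    (hrp : r ≤ p) (hζ : AbsolutelyContinuousOnInterval ζ r p) (hr : ζ r = N.arc γ 0)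
    (hp : ζ p = N.arc γ 1) (hin : ∀ t ∈ Ioo r p, ζ t ∈ N.arc γ '' Ioo 0 1)
    (hint : IntervalIntegrable (fun t => N.lagrangian H (ζ t) (deriv ζ t))
      MeasureTheory.volume r p) :
    Tonelli.sig (N.extHam H (N.Ψ.edge γ).1) a - a * (p - r) ≤
      ∫ t in r..p, N.lagrangian H (ζ t) (deriv ζ t) := by
  have hIcc : ∀ t ∈ Icc r p, ζ t ∈ N.arc γ '' Icc 0 1 := by
    intro t ht
    rcases ht.1.eq_or_lt with h | h
    · exact ⟨0, by simp, by rw [← h, hr]⟩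
    rcases ht.2.eq_or_lt with h' | h'
    · exact ⟨1, by simp, by rw [h', hp]⟩
    · exact image_mono Ioo_subset_Icc_self (hin t ⟨h, h'⟩)
  have hc := N.absolutelyContinuous_coord hrp hζ γ hIcc
  obtain ⟨h1, h2⟩ := (hH.tonelli (N.Ψ.edge γ).1).integral_topRoot_comp ha hrp hc
    fun t _ => N.coord_mem γ _
  rw [hr, hp, N.coord_arc γ (by simp), N.coord_arc γ (by simp)] at h2
  have h3 : ∫ t in r..p, (topRoot (N.extHam H (N.Ψ.edge γ).1) a (N.coord γ (ζ t)) *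
      deriv (fun t => N.coord γ (ζ t)) t - a) = Tonelli.sig (N.extHam H (N.Ψ.edge γ).1) a -
        a * (p - r) := by
    rw [intervalIntegral.integral_sub h1 (by simp), h2, intervalIntegral.integral_const,
      smul_eq_mul, mul_comm a]
    rfl
  rw [← h3]
  refine intervalIntegral.integral_mono_ae_restrict hrp (h1.sub (by simp)) hint ?_
  rw [Filter.EventuallyLE, ← MeasureTheory.restrict_Ioo_eq_restrict_Icc,
    MeasureTheory.ae_restrict_iff' measurableSet_Ioo]
  filter_upwards [hc.ae_differentiableAt] with t ht htI
  rw [uIcc_of_le hrp] at ht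
  exact hH.topRoot_mul_deriv_sub_le γ ha (ht (Ioo_subset_Icc_self htI)) (hin t htI)

/-- A curve that returns to a vertex `v` and meanwhile stays in its star costs at least as much as
waiting at `v`. The calibration consists of the potentials of all arcs at `v`, at the common level
given by the flux limiter. -/
theorem IsHamiltonian.fluxLimiter_mul_le_integral (hH : N.IsHamiltonian H)
    {v : EuclideanSpace ℝ (Fin d)} (hv : v ∈ N.vertices) {ζ : ℝ → EuclideanSpace ℝ (Fin d)}
    {r q : ℝ} (hrq : r ≤ q) (hζ : AbsolutelyContinuousOnInterval ζ r q) (hr : ζ r = v)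
    (hq : ζ q = v) (hin : ∀ t ∈ Icc r q, ζ t ∈ N.openStar v)
    (hint : IntervalIntegrable (fun t => N.lagrangian H (ζ t) (deriv ζ t))
      MeasureTheory.volume r q) :
    (q - r) * N.fluxLimiter H v ≤ ∫ t in r..q, N.lagrangian H (ζ t) (deriv ζ t) := by
  classical
  have := Fintype.ofFinite {γ : A // N.arc γ 0 = v}
  set a := -N.fluxLimiter H v with ha
  have hcrit : ∀ γ : {γ : A // N.arc γ 0 = v}, critVal (N.extHam H (N.Ψ.edge γ.1).1) ≤ a :=
    fun γ => by
      have := hH.fluxLimiter_le γ.1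
      rw [γ.2] at this
      linarith
  have hc : ∀ γ : {γ : A // N.arc γ 0 = v},
      AbsolutelyContinuousOnInterval (fun t => N.coord γ.1 (ζ t)) r q := fun γ =>
    absolutelyContinuous_coord_openStar hrq hζ γ.1 (by rw [γ.2]; exact hin)
  set g : {γ : A // N.arc γ 0 = v} → ℝ → ℝ := fun γ t =>
    topRoot (N.extHam H (N.Ψ.edge γ.1).1) a (N.coord γ.1 (ζ t)) *
      deriv (fun t => N.coord γ.1 (ζ t)) t with hg
  have hcv : ∀ γ : {γ : A // N.arc γ 0 = v}, N.coord γ.1 v = 0 := fun γ =>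
    (congrArg _ γ.2.symm).trans (N.coord_arc γ.1 (by simp))
  have hgi : ∀ γ, IntervalIntegrable (g γ) MeasureTheory.volume r q ∧ ∫ t in r..q, g γ t = 0 := by
    intro γ
    obtain ⟨h1, h2⟩ := (hH.tonelli (N.Ψ.edge γ.1).1).integral_topRoot_comp (hcrit γ) hrq (hc γ)
      fun t _ => N.coord_mem γ.1 _
    refine ⟨h1, h2.trans ?_⟩
    rw [hr, hq, intervalIntegral.integral_same]
  have hsum : IntervalIntegrable (fun t => ∑ γ, g γ t) MeasureTheory.volume r q := by
    have := IntervalIntegrable.sum Finset.univ (f := g) fun γ _ => (hgi γ).1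
    convert! this using 1
    ext t
    simp
  have h3 : ∫ t in r..q, (∑ γ, g γ t - a) = (q - r) * N.fluxLimiter H v := by
    rw [intervalIntegral.integral_sub hsum (by simp),
      intervalIntegral.integral_finsetSum fun γ _ => (hgi γ).1,
      Finset.sum_eq_zero fun γ _ => (hgi γ).2, intervalIntegral.integral_const, smul_eq_mul]
    simp only [ha]
    ring
  rw [← h3]
  refine intervalIntegral.integral_mono_ae_restrict hrq (hsum.sub (by simp)) hint ?_
  rw [Filter.EventuallyLE, MeasureTheory.ae_restrict_iff' measurableSet_Icc]
  have hdiff : ∀ᵐ t, ∀ γ : {γ : A // N.arc γ 0 = v}, t ∈ uIcc r q →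
      DifferentiableAt ℝ (fun t => N.coord γ.1 (ζ t)) t :=
    MeasureTheory.ae_all_iff.2 fun γ => (hc γ).ae_differentiableAt
  have hzero : ∀ᵐ t, ∀ γ : {γ : A // N.arc γ 0 = v}, N.coord γ.1 (ζ t) = 0 →
      deriv (fun t => N.coord γ.1 (ζ t)) t = 0 :=
    MeasureTheory.ae_all_iff.2 fun γ => by
      filter_upwards [(countable_setOf_deriv_ne_zero (fun t => N.coord γ.1 (ζ t)) 0).ae_notMem
        MeasureTheory.volume] with t ht h0
      by_contra hne
      exact ht ⟨h0, hne⟩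
  filter_upwards [hdiff, hzero, (countable_setOf_deriv_ne_zero ζ v).ae_notMem
    MeasureTheory.volume] with t h1 h2 h4 htI
  have hgz : ∀ γ, N.coord γ.1 (ζ t) = 0 → g γ t = 0 := fun γ h => by
    simp only [hg, h2 γ h, mul_zero]
  obtain ⟨γ, hγ, s, hs, hst⟩ := hin t htI
  rcases hs.1.eq_or_lt with h0 | h0
  · have htv : ζ t = v := by rw [← hst, ← h0, hγ]
    have hd : deriv ζ t = 0 := by
      by_contra hne
      exact h4 ⟨htv, hne⟩
    rw [Finset.sum_eq_zero fun γ _ => hgz γ (by rw [htv, hcv]), hd, htv, lagrangian_vertex hv]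
    simp [ha]
  · have hsI : s ∈ Ioo (0 : ℝ) 1 := ⟨h0, hs.2⟩
    rw [Finset.sum_eq_single (⟨γ, hγ⟩ : {γ : A // N.arc γ 0 = v})
      (fun γ' _ hne => hgz γ' (by
        rw [← hst]
        exact coord_arc_of_ne (hγ.trans γ'.2.symm) (fun h => hne (Subtype.ext h)) hsI))
      (fun h => absurd (Finset.mem_univ _) h)]
    exact hH.topRoot_mul_deriv_sub_le γ (hcrit ⟨γ, hγ⟩)
      (h1 ⟨γ, hγ⟩ (by rwa [uIcc_of_le hrq])) ⟨s, hsI, hst⟩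

end PeriodicNetwork

/-! ### Parametrized paths -/

section ParamPath

variable {V₀ E₀ : Type*} {Γ₀ : OGraph V₀ E₀}

theorem IsParamPath.append {x y z : V₀} {ξ ξ' : List (E₀ × ℝ × ℝ)} (h : IsParamPath Γ₀ x y ξ)
    (h' : IsParamPath Γ₀ y z ξ') : IsParamPath Γ₀ x z (ξ ++ ξ') := by
  induction h with
  | nil => exact h'
  | move e q y l hq _ ih => exact IsParamPath.move e q z _ hq (ih h')
  | rest e T₁ T₂ y l h₁ h₂ _ ih => exact IsParamPath.rest e T₁ T₂ z _ h₁ h₂ (ih h')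

/-- Parametrized paths can be travelled more slowly or faster. -/
theorem IsParamPath.exists_rescale {x y : V₀} {ξ : List (E₀ × ℝ × ℝ)} (h : IsParamPath Γ₀ x y ξ)
    {T : ℝ} (hT : 0 < T) : ∃ ξ', IsParamPath Γ₀ x y ξ' ∧ totalTime ξ' = T * totalTime ξ ∧
      ξ'.map Prod.fst = ξ.map Prod.fst := by
  induction h with
  | nil x => exact ⟨[], IsParamPath.nil x, by simp [totalTime], rfl⟩
  | move e q y l hq _ ih =>
    obtain ⟨ξ', h1, h2, h3⟩ := ih
    refine ⟨_, IsParamPath.move e (q / T) y ξ' (by positivity) h1, ?_, by simp [h3]⟩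
    simp only [totalTime, List.map_cons, List.sum_cons] at h2 ⊢
    rw [h2]
    field_simp
  | rest e T₁ T₂ y l h₁ h₂ _ ih =>
    obtain ⟨ξ', h1, h2, h3⟩ := ih
    refine ⟨_, IsParamPath.rest e (T * T₁) (T * T₂) y ξ' (by positivity) (by positivity) h1, ?_,
      by simp [h3]⟩
    simp only [totalTime, List.map_cons, List.sum_cons] at h2 ⊢
    rw [h2]
    ring

theorem totalTime_append (ξ ξ' : List (E₀ × ℝ × ℝ)) :
    totalTime (ξ ++ ξ') = totalTime ξ + totalTime ξ' := by
  simp [totalTime]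

theorem discAction_append (He : E₀ → ℝ → ℝ → ℝ) (ξ ξ' : List (E₀ × ℝ × ℝ)) :
    discAction He (ξ ++ ξ') = discAction He ξ + discAction He ξ' := by
  simp [discAction]

end ParamPath

/-! ### Decomposition of curves into rests and crossings -/

namespace PeriodicNetwork

variable {V₀ E₀ : Type*} [Finite E₀] {Γ₀ : OGraph V₀ E₀} {P : Γ₀.Orientation}
  {S : OGraph.SpanningTree P} {d : ℕ} {A : Type*} (N : PeriodicNetwork S d A)
  (H : A → ℝ → ℝ → ℝ)

/-- The vertex `v`, occupied at time `r` by the curve `ζ` defined on `[0, T]`, is joined to `z₁` by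
a parametrized path of total time `r` that lifts to a path from `z₁` to `v`. If the action of the
curve is finite, then the discrete action is at most the action of the curve up to time `r`. -/
def Tracked (T : ℝ) (ζ : ℝ → EuclideanSpace ℝ (Fin d)) (z₁ : N.vertices) (r : ℝ)
    (v : N.vertices) : Prop :=
  ∃ ξ, IsParamPath Γ₀ (N.π₁ z₁) (N.π₁ v) ξ ∧ totalTime ξ = r ∧
    OGraph.rotation S (ξ.map Prod.fst) = N.π₂ v - N.π₂ z₁ ∧
    (IntervalIntegrable (fun t => N.lagrangian H (ζ t) (deriv ζ t)) MeasureTheory.volume 0 T →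
      discAction (N.baseHam H) ξ ≤ ∫ t in (0 : ℝ)..r, N.lagrangian H (ζ t) (deriv ζ t))

variable {N H} {T : ℝ} {ζ : ℝ → EuclideanSpace ℝ (Fin d)} {z₁ : N.vertices}

theorem tracked_extend {r q : ℝ} {v w : N.vertices}
    (hr : 0 ≤ r) (hrq : r ≤ q) (hqT : q ≤ T) (hv : N.Tracked H T ζ z₁ r v)
    (ξ' : List (E₀ × ℝ × ℝ)) (h₁ : IsParamPath Γ₀ (N.π₁ v) (N.π₁ w) ξ')
    (h₂ : totalTime ξ' = q - r)
    (h₃ : OGraph.rotation S (ξ'.map Prod.fst) = N.π₂ w - N.π₂ v)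
    (h₄ : IntervalIntegrable (fun t => N.lagrangian H (ζ t) (deriv ζ t)) MeasureTheory.volume r q →
      discAction (N.baseHam H) ξ' ≤ ∫ t in r..q, N.lagrangian H (ζ t) (deriv ζ t)) :
    N.Tracked H T ζ z₁ q w := by
  obtain ⟨ξ, k1, k2, k3, k4⟩ := hv
  refine ⟨ξ ++ ξ', k1.append h₁, ?_, ?_, fun hint => ?_⟩
  · rw [totalTime_append, k2, h₂, add_sub_cancel]
  · rw [List.map_append, OGraph.rotation_append, k3, h₃]
    abel
  · have i1 := hint.mono_set (uIcc_subset_uIcc (a₁ := 0) (b₁ := r) left_mem_uIcc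
      (by rw [uIcc_of_le (by linarith)]; exact ⟨hr, hrq.trans hqT⟩))
    have i2 := hint.mono_set (uIcc_subset_uIcc (a₁ := r) (b₁ := q)
      (by rw [uIcc_of_le (by linarith)]; exact ⟨hr, hrq.trans hqT⟩)
      (by rw [uIcc_of_le (by linarith)]; exact ⟨hr.trans hrq, hqT⟩))
    rw [discAction_append, ← intervalIntegral.integral_add_adjacent_intervals i1 i2]
    exact add_le_add (k4 hint) (h₄ i2)

theorem absolutelyContinuous_sub (hT : 0 ≤ T) (hζ : N.IsCurve T ζ) {r q : ℝ} (hr : 0 ≤ r)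
    (hrq : r ≤ q) (hq : q ≤ T) : AbsolutelyContinuousOnInterval ζ r q :=
  hζ.1.mono (by rw [uIcc_of_le hrq, uIcc_of_le hT]; exact Icc_subset_Icc hr hq)

/-- An excursion in the star of a vertex is replaced by a rest. -/
theorem IsHamiltonian.tracked_rest (hH : N.IsHamiltonian H) (hT : 0 ≤ T) (hζ : N.IsCurve T ζ)
    {r q : ℝ} {v : N.vertices} (hr : 0 ≤ r) (hrq : r ≤ q) (hqT : q ≤ T)
    (hv : N.Tracked H T ζ z₁ r v) (hζr : ζ r = v) (hζq : ζ q = v)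
    (hin : ∀ t ∈ Icc r q, ζ t ∈ N.openStar v) : N.Tracked H T ζ z₁ q v := by
  rcases hrq.eq_or_lt with rfl | hlt
  · exact hv
  obtain ⟨γ, hγ, hflux⟩ := hH.exists_fluxLimiter_eq v.2
  have hγv : N.graph.o γ = v := Subtype.ext hγ
  have hoe : N.π₁ v = Γ₀.o (N.Ψ.edge γ).1 := by rw [← hγv, N.π₁_o]
  have hpos : 0 < (q - r) / 2 := by linarith
  refine tracked_extend hr hrq hqT hv [((N.Ψ.edge γ).1, 0, (q - r) / 2),
    (Γ₀.neg (N.Ψ.edge γ).1, 0, (q - r) / 2)] ?_ ?_ ?_ fun hint => ?_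
  · rw [hoe]
    exact IsParamPath.rest _ _ _ _ _ hpos hpos (IsParamPath.nil _)
  · simp [totalTime]
  · simp only [List.map_cons, List.map_nil, OGraph.rotation_cons, OGraph.rotation_nil,
      OGraph.thetaEdge_neg]
    abel
  · have := hH.fluxLimiter_mul_le_integral v.2 hrq (absolutelyContinuous_sub hT hζ hr hrq hqT)
      hζr hζq hin hint
    rw [hflux] at this
    simp only [discAction, List.map_cons, List.map_nil, List.sum_cons, List.sum_nil,
      IsHamiltonian.discLag_eq, (hH.tonelli _).dlag_zero, hH.critVal_neg]
    linarith

/-- A crossing of an arc becomes an edge travelled in the same time. -/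
theorem IsHamiltonian.tracked_cross (hH : N.IsHamiltonian H) (hT : 0 ≤ T) (hζ : N.IsCurve T ζ)
    {r p : ℝ} {γ : A} (hr : 0 ≤ r) (hrp : r < p) (hpT : p ≤ T)
    (hv : N.Tracked H T ζ z₁ r (N.graph.o γ)) (hζr : ζ r = N.arc γ 0) (hζp : ζ p = N.arc γ 1)
    (hin : ∀ t ∈ Ioo r p, ζ t ∈ N.arc γ '' Ioo 0 1) :
    N.Tracked H T ζ z₁ p (N.graph.t γ) := by
  have hpos : 0 < p - r := sub_pos.2 hrp
  have hq : 1 / (1 / (p - r)) = p - r := one_div_one_div _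
  refine tracked_extend hr hrp.le hpT hv [((N.Ψ.edge γ).1, 1 / (p - r), 1 / (1 / (p - r)))]
    ?_ ?_ ?_ fun hint => ?_
  · rw [N.π₁_o, N.π₁_t]
    exact IsParamPath.move _ _ _ _ (by positivity) (IsParamPath.nil _)
  · simp [totalTime]
  · rw [List.map_singleton, OGraph.rotation_cons, OGraph.rotation_nil, N.π₂_o, N.π₂_t]
    abel
  · simp only [discAction, List.map_cons, List.map_nil, List.sum_cons, List.sum_nil,
      IsHamiltonian.discLag_eq, hq, add_zero]
    rw [mul_comm, ← le_div_iff₀ hpos]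
    refine (hH.tonelli _).dlag_le fun a ha => ?_
    have := hH.sig_sub_le_integral γ ha hrp.le (absolutelyContinuous_sub hT hζ hr hrp.le hpT)
      hζr hζp hin hint
    rw [le_div_iff₀ hpos]
    calc _ = _ := by field_simp
      _ ≤ _ := this

variable (N H T ζ z₁) in
/-- The state of the curve at time `t`: it was last tracked at time `r`, at the initial point of
an arc `γ`, and since then it has not left `γ([0, 1))`. -/
def TrackedOnArc (t : ℝ) : Prop :=
  ∃ r γ, 0 ≤ r ∧ r ≤ t ∧ ζ r = N.arc γ 0 ∧ (∀ u ∈ Icc r t, ζ u ∈ N.arc γ '' Ico 0 1) ∧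
    N.Tracked H T ζ z₁ r (N.graph.o γ)

/-- A connected piece of a curve in the open star of `w` that avoids `w` and has a point in
`γ([0, 1))` stays inside `γ`. -/
theorem image_subset_arc_of_avoid {w : EuclideanSpace ℝ (Fin d)} {I : Set ℝ}
    (hI : IsPreconnected I) (hζ : ContinuousOn ζ I) {t : ℝ} (ht : t ∈ I) {γ : A}
    (hγ : ζ t ∈ N.arc γ '' Ico 0 1) (hin : ∀ u ∈ I, ζ u ∈ N.openStar w)
    (hw : ∀ u ∈ I, ζ u ≠ w) : ζ '' I ⊆ N.arc γ '' Ioo 0 1 := by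
  obtain ⟨γ', hγ', himg⟩ := N.exists_subset_arc (hI.image ζ hζ) ⟨_, mem_image_of_mem ζ ht⟩
    (by rintro _ ⟨u, hu, rfl⟩; exact hin u hu) (by rintro ⟨u, hu, h⟩; exact hw u hu h)
  obtain ⟨s', hs', h'⟩ := himg (mem_image_of_mem ζ ht)
  obtain ⟨s, hs, h⟩ := hγ
  rcases N.eq_or_eq_rev_of_arc_eq hs' (Ico_subset_Icc_self hs) (h'.trans h.symm) with
    ⟨h1, -⟩ | ⟨h1, -⟩
  · rwa [h1]
  · refine himg.trans ?_
    rintro _ ⟨x, hx, rfl⟩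
    refine ⟨1 - x, ⟨by linarith [hx.2], by linarith [hx.1]⟩, ?_⟩
    rw [h1, N.arc_rev γ' _ ⟨by linarith [hx.2], by linarith [hx.1]⟩, sub_sub_cancel]

theorem arc_Ico_subset_openStar (γ : A) : N.arc γ '' Ico 0 1 ⊆ N.openStar (N.arc γ 0) := by
  rintro _ ⟨s, hs, rfl⟩
  exact ⟨γ, rfl, s, hs, rfl⟩

/-- When the curve first meets the centre `w` of a star, it either has returned to the vertex where
it was last tracked, or has just crossed the arc. -/
theorem IsHamiltonian.tracked_of_first_visit (hH : N.IsHamiltonian H) (hT : 0 ≤ T)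
    (hζ : N.IsCurve T ζ) {r p : ℝ} {γ : A} {w : N.vertices} (hr : 0 ≤ r) (hrp : r ≤ p)
    (hpT : p ≤ T) (hv : N.Tracked H T ζ z₁ r (N.graph.o γ)) (hζr : ζ r = N.arc γ 0)
    (hζp : ζ p = w) (hin : ∀ u ∈ Ico r p, ζ u ∈ N.arc γ '' Ico 0 1) :
    N.Tracked H T ζ z₁ p w := by
  have hcont : ContinuousOn ζ (Icc r p) := by
    have := (absolutelyContinuous_sub hT hζ hr hrp hpT).continuousOn
    rwa [uIcc_of_le hrp] at this
  rcases hrp.eq_or_lt with rfl | hlt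
  · have : N.graph.o γ = w := Subtype.ext (hζr.symm.trans hζp)
    rwa [← this]
  have hpcl : ζ p ∈ N.arc γ '' Icc 0 1 := by
    have h1 : ContinuousWithinAt ζ (Ico r p) p :=
      (hcont p (right_mem_Icc.2 hrp)).mono Ico_subset_Icc_self
    have h2 : p ∈ closure (Ico r p) := by
      rw [closure_Ico hlt.ne]; exact right_mem_Icc.2 hrp
    refine closure_minimal ?_ (N.isClosed_arc_image γ le_rfl le_rfl) (h1.mem_closure_image h2)
    rintro _ ⟨u, hu, rfl⟩
    exact image_mono Ico_subset_Icc_self (hin u hu)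
  obtain ⟨s, hs, hsp⟩ := hpcl
  have hs01 : s = 0 ∨ s = 1 := by
    by_contra! h
    refine N.arc_notMem_vertices γ ⟨lt_of_le_of_ne hs.1 h.1.symm, lt_of_le_of_ne hs.2 h.2⟩ ?_
    rw [hsp, hζp]
    exact w.2
  rcases hs01 with rfl | rfl
  · have hw : N.graph.o γ = w := Subtype.ext (hsp.trans hζp)
    subst hw
    refine hH.tracked_rest hT hζ hr hrp hpT hv hζr hζp fun u hu => ?_
    refine arc_Ico_subset_openStar γ ?_
    rcases hu.2.eq_or_lt with h | h
    · exact ⟨0, by simp, by rw [hsp, h]⟩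
    · exact hin u ⟨hu.1, h⟩
  · have hw : N.graph.t γ = w := Subtype.ext ((N.coe_graph_t γ).trans (hsp.trans hζp))
    subst hw
    obtain ⟨r', ⟨hr'I, hr'v⟩, hr'max⟩ := (isCompact_Icc.of_isClosed_subset
      (hcont.preimage_isClosed_of_isClosed isClosed_Icc (isClosed_singleton (x := N.arc γ 0)))
      inter_subset_left).exists_isGreatest ⟨r, left_mem_Icc.2 hrp, hζr⟩
    have hr'v : ζ r' = N.arc γ 0 := hr'v
    have hlt' : r' < p := lt_of_le_of_ne hr'I.2 fun h => by
      rw [h, ← hsp] at hr'v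
      exact N.arc_zero_ne_one γ hr'v.symm
    have h1 : N.Tracked H T ζ z₁ r' (N.graph.o γ) :=
      hH.tracked_rest hT hζ hr hr'I.1 (hr'I.2.trans hpT) hv hζr hr'v fun u hu =>
        arc_Ico_subset_openStar γ (hin u ⟨hu.1, hu.2.trans_lt hlt'⟩)
    refine hH.tracked_cross hT hζ (hr.trans hr'I.1) hlt' hpT h1 hr'v hsp.symm fun u hu => ?_
    obtain ⟨x, hx, hxu⟩ := hin u ⟨hr'I.1.trans hu.1.le, hu.2⟩
    refine ⟨x, ⟨lt_of_le_of_ne hx.1 fun h => ?_, hx.2⟩, hxu⟩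
    have := hr'max ⟨⟨hr'I.1.trans hu.1.le, hu.2.le⟩, show ζ u = N.arc γ 0 by rw [← hxu, h]⟩
    exact hu.1.not_ge this

/-- Tracking continues as long as the curve stays in the open star of a vertex. -/
theorem IsHamiltonian.trackedOnArc_step (hH : N.IsHamiltonian H) (hT : 0 ≤ T)
    (hζ : N.IsCurve T ζ) {t t' : ℝ} (htt : t ≤ t') (ht'T : t' ≤ T)
    (h : N.TrackedOnArc H T ζ z₁ t) {w : EuclideanSpace ℝ (Fin d)} (hw : w ∈ N.vertices)
    (hin : ∀ u ∈ Icc t t', ζ u ∈ N.openStar w) : N.TrackedOnArc H T ζ z₁ t' := by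
  obtain ⟨r, γ, hr, hrt, hζr, hγ, htr⟩ := h
  have ht0 : 0 ≤ t := hr.trans hrt
  have hcont : ContinuousOn ζ (Icc t t') := by
    have := (absolutelyContinuous_sub hT hζ ht0 htt ht'T).continuousOn
    rwa [uIcc_of_le htt] at this
  have hγt : ζ t ∈ N.arc γ '' Ico 0 1 := hγ t ⟨hrt, le_rfl⟩
  by_cases hvisit : ∃ u ∈ Icc t t', ζ u = w
  · have hZ : IsCompact (Icc t t' ∩ ζ ⁻¹' {w}) := isCompact_Icc.of_isClosed_subset
      (hcont.preimage_isClosed_of_isClosed isClosed_Icc isClosed_singleton) inter_subset_left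
    obtain ⟨p, ⟨hpI, hpw⟩, hpmin⟩ := hZ.exists_isLeast hvisit
    obtain ⟨q, ⟨hqI, hqw⟩, hqmax⟩ := hZ.exists_isGreatest hvisit
    have hpq : p ≤ q := hpmin ⟨hqI, hqw⟩
    have hrp : ∀ u ∈ Ico r p, ζ u ∈ N.arc γ '' Ico 0 1 := by
      intro u hu
      rcases le_total u t with hut | hut
      · exact hγ u ⟨hu.1, hut⟩
      · have hsub : Ico t p ⊆ Icc t t' := Ico_subset_Icc_self.trans (Icc_subset_Icc_right hpI.2)
        refine image_mono Ioo_subset_Ico_self (image_subset_arc_of_avoid isPreconnected_Ico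
          (hcont.mono hsub) ⟨le_rfl, hut.trans_lt hu.2⟩ hγt (fun x hx => hin x (hsub hx))
          (fun x hx hxw => ?_) (mem_image_of_mem ζ ⟨hut, hu.2⟩))
        exact hx.2.not_ge (hpmin ⟨hsub hx, hxw⟩)
    have h1 : N.Tracked H T ζ z₁ p ⟨w, hw⟩ :=
      hH.tracked_of_first_visit hT hζ hr (hrt.trans hpI.1) (hpI.2.trans ht'T) htr hζr hpw hrp
    have h2 : N.Tracked H T ζ z₁ q ⟨w, hw⟩ :=
      hH.tracked_rest hT hζ (ht0.trans hpI.1) hpq (hqI.2.trans ht'T) h1 hpw hqw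
        fun u hu => hin u ⟨hpI.1.trans hu.1, hu.2.trans hqI.2⟩
    -- the arc along which the curve finally leaves `w`; any arc will do if it does not leave
    obtain ⟨γ', hγ'w, hγ'⟩ : ∃ γ', N.arc γ' 0 = w ∧ ∀ u ∈ Ioc q t', ζ u ∈ N.arc γ' '' Ico 0 1 := by
      rcases hqI.2.eq_or_lt with hqt | hqt
      · obtain ⟨γ', hγ'⟩ := N.exists_arc_zero_eq hw
        exact ⟨γ', hγ', fun u hu => absurd hu (by rw [hqt, Ioc_self]; exact notMem_empty u)⟩
      · have hsub : Ioc q t' ⊆ Icc t t' := Ioc_subset_Icc_self.trans (Icc_subset_Icc_left hqI.1)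
        obtain ⟨γ', hγ', himg⟩ := N.exists_subset_arc
          (isPreconnected_Ioc.image ζ (hcont.mono hsub))
          ⟨_, mem_image_of_mem ζ (right_mem_Ioc.2 hqt)⟩
          (by rintro _ ⟨u, hu, rfl⟩; exact hin u (hsub hu))
          (by rintro ⟨u, hu, h⟩; exact hu.1.not_ge (hqmax ⟨hsub hu, h⟩))
        exact ⟨γ', hγ', fun u hu => image_mono Ioo_subset_Ico_self
          (himg (mem_image_of_mem ζ hu))⟩
    have hqw' : ζ q = w := hqw
    refine ⟨q, γ', ht0.trans hqI.1, hqI.2, hqw'.trans hγ'w.symm, fun u hu => ?_, ?_⟩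
    · rcases hu.1.eq_or_lt with h | h
      · exact ⟨0, by simp, by rw [hγ'w, ← h, hqw']⟩
      · exact hγ' u ⟨h, hu.2⟩
    · have : N.graph.o γ' = ⟨w, hw⟩ := Subtype.ext hγ'w
      rwa [this]
  · push Not at hvisit
    refine ⟨r, γ, hr, hrt.trans htt, hζr, fun u hu => ?_, htr⟩
    rcases le_total u t with hut | hut
    · exact hγ u ⟨hu.1, hut⟩
    · exact image_mono Ioo_subset_Ico_self (image_subset_arc_of_avoid isPreconnected_Icc hcont
        (left_mem_Icc.2 htt) hγt hin hvisit (mem_image_of_mem ζ ⟨hut, hu.2⟩))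

/-- Every curve of the network that joins two vertices is followed by a parametrized path, whose
action is not larger. -/
theorem IsHamiltonian.tracked_end (hH : N.IsHamiltonian H) (hT : 0 < T) (hζ : N.IsCurve T ζ)
    {z₂ : N.vertices} (h0 : ζ 0 = z₁) (h1 : ζ T = z₂) : N.Tracked H T ζ z₁ T z₂ := by
  obtain ⟨c, C, hc, hlen⟩ := N.length_bounds
  obtain ⟨δ, hδ, hδ'⟩ := hζ.1.exists_eVariationOn_le hT.le (half_pos hc)
  have hcont : ContinuousOn ζ (Icc 0 T) := by
    have := hζ.1.continuousOn
    rwa [uIcc_of_le hT.le] at this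
  obtain ⟨n, hn⟩ := exists_nat_gt (T / δ)
  have hnpos : (0 : ℝ) < n := (div_pos hT hδ).trans hn
  have hstep : T / n < δ := by
    rw [div_lt_iff₀ hnpos]
    rwa [div_lt_iff₀ hδ, mul_comm] at hn
  have main : ∀ k : ℕ, k ≤ n → N.TrackedOnArc H T ζ z₁ (k * (T / n)) := by
    intro k
    induction k with
    | zero =>
      intro _
      obtain ⟨γ, hγ⟩ := N.exists_arc_zero_eq z₁.2
      have ho : N.graph.o γ = z₁ := Subtype.ext hγ
      refine ⟨0, γ, le_rfl, by simp, h0.trans hγ.symm, fun u hu => ?_, ?_⟩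
      · have hu0 : u = 0 := by simpa using hu
        exact ⟨0, by simp, by rw [hu0, h0, hγ]⟩
      · rw [ho]
        exact ⟨[], IsParamPath.nil _, by simp [totalTime], by simp [OGraph.rotation_nil],
          fun _ => by simp [discAction]⟩
    | succ k ih =>
      intro hk
      have hle : (k : ℝ) * (T / n) ≤ ((k + 1 : ℕ) : ℝ) * (T / n) := by
        gcongr
        exact Nat.le_succ k
      have hleT : ((k + 1 : ℕ) : ℝ) * (T / n) ≤ T := by
        calc ((k + 1 : ℕ) : ℝ) * (T / n) ≤ n * (T / n) := by gcongr
          _ = T := by field_simp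
      have hk0 : 0 ≤ (k : ℝ) * (T / n) := by positivity
      have hvar := hδ' _ _ hk0 hle (by push_cast; linarith) hleT
      obtain ⟨w, hw, hin⟩ := N.exists_mem_openStar hle
        (hcont.mono (Icc_subset_Icc hk0 hleT))
        (fun u hu => hζ.2 u ⟨hk0.trans hu.1, hu.2.trans hleT⟩)
        (fun γ => hvar.trans_lt (lt_of_lt_of_le
          ((ENNReal.ofReal_lt_ofReal_iff hc).2 (half_lt_self hc)) (hlen γ).1))
      exact hH.trackedOnArc_step hT.le hζ hle hleT (ih (by omega)) hw hin
  obtain ⟨r, γ, hr, hrT, hζr, hγ, htr⟩ := main n le_rfl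
  rw [show (n : ℝ) * (T / n) = T by field_simp] at hrT hγ
  have ho : N.graph.o γ = z₂ := by
    have := N.eq_of_mem_openStar (arc_Ico_subset_openStar γ (hγ T ⟨hrT, le_rfl⟩))
      (by rw [h1]; exact z₂.2)
    exact Subtype.ext (this.symm.trans h1)
  subst ho
  exact hH.tracked_rest hT.le hζ hr hrT le_rfl htr hζr h1
    fun u hu => arc_Ico_subset_openStar γ (hγ u hu)

theorem IsHamiltonian.discMinAction_le_minAction (hH : N.IsHamiltonian H) (z₁ z₂ : N.vertices)
    (hT : 0 < T) : discMinAction (N.baseHam H) S (N.π₁ z₁) (N.π₁ z₂) T (N.π₂ z₂ - N.π₂ z₁) ≤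
      N.minAction H z₁ z₂ T := by
  refine le_iInf₂ fun ζ hζ => ?_
  obtain ⟨hζ, h0, h1⟩ := hζ
  rw [Network.action]
  split_ifs with hint
  · obtain ⟨ξ, k1, k2, k3, k4⟩ := hH.tracked_end hT hζ h0 h1
    exact (iInf₂_le ξ ⟨k1, k2, k3⟩).trans (EReal.coe_le_coe_iff.2 (k4 hint))
  · exact le_top

/-! ### Finiteness -/

/-- Connectedness of the network provides a parametrized path, which can be rescaled to any total
time. -/
theorem IsHamiltonian.discMinAction_ne_top (hH : N.IsHamiltonian H) (z₁ z₂ : N.vertices)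
    (hT : 0 < T) :
    discMinAction (N.baseHam H) S (N.π₁ z₁) (N.π₁ z₂) T (N.π₂ z₂ - N.π₂ z₁) ≠ ⊤ := by
  have hmem : ∀ z : N.vertices, (z : EuclideanSpace ℝ (Fin d)) ∈ N.carrier := fun z => by
    obtain ⟨γ, hγ⟩ := N.exists_arc_zero_eq z.2
    exact hγ ▸ N.arc_mem_carrier γ (by simp)
  obtain ⟨ζ, hζ, h0, h1⟩ := N.connected z₁ (hmem z₁) z₂ (hmem z₂)
  obtain ⟨ξ, k1, k2, k3, -⟩ := hH.tracked_end one_pos hζ h0 h1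
  obtain ⟨ξ', m1, m2, m3⟩ := k1.exists_rescale hT
  refine ne_top_of_le_ne_top (EReal.coe_ne_top _) (iInf₂_le ξ' ⟨m1, ?_, ?_⟩)
  · rw [m2, k2, mul_one]
  · rw [m3, k3]

/-- At a level `a` with `σ(e, a) ≥ 0` for all edges, the action is at least `-a` per unit of
time. -/
theorem IsHamiltonian.discMinAction_ne_bot (hH : N.IsHamiltonian H) (x y : V₀) (T : ℝ)
    (k : OGraph.H₁ P) : discMinAction (N.baseHam H) S x y T k ≠ ⊥ := by
  choose a ha ha' using fun e => (hH.tonelli (N := N) e).exists_le_sig 0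
  obtain ⟨B, hB⟩ := (finite_range a).bddAbove
  have hBa : ∀ e, a e ≤ B := fun e => hB ⟨e, rfl⟩
  have hBc : ∀ e, critVal (N.extHam H e) ≤ B := fun e => (ha e).trans (hBa e)
  have hBs : ∀ e, 0 ≤ Tonelli.sig (N.extHam H e) B := fun e => by
    rcases (hBa e).eq_or_lt with h | h
    · rw [← h]; exact ha' e
    · exact (ha' e).trans ((hH.tonelli e).sig_lt (ha e) h).le
  have key : ∀ {x y : V₀} {ξ : List (E₀ × ℝ × ℝ)}, IsParamPath Γ₀ x y ξ →
      -(B * totalTime ξ) ≤ discAction (N.baseHam H) ξ := by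
    intro x y ξ hξ
    induction hξ with
    | nil => simp [totalTime, discAction]
    | move e q y l hq _ ih =>
      have h1 := mul_le_mul_of_nonneg_left ((hH.tonelli e).le_dlag q (hBc e))
        (one_div_pos.2 hq).le
      have h2 : 1 / q * (Tonelli.sig (N.extHam H e) B * q - B) =
          Tonelli.sig (N.extHam H e) B - B * (1 / q) := by field_simp
      simp only [totalTime, discAction, List.map_cons, List.sum_cons,
        IsHamiltonian.discLag_eq] at ih ⊢
      linarith [hBs e]
    | rest e T₁ T₂ y l h₁ h₂ _ ih =>
      have h3 := mul_le_mul_of_nonneg_left (hBc e) (add_pos h₁ h₂).le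
      simp only [totalTime, discAction, List.map_cons, List.sum_cons, IsHamiltonian.discLag_eq,
        (hH.tonelli _).dlag_zero, hH.critVal_neg] at ih ⊢
      linarith
  refine ne_bot_of_le_ne_bot (EReal.coe_ne_bot (-(B * T))) (le_iInf₂ fun ξ hξ => ?_)
  obtain ⟨h1, rfl, -⟩ := hξ
  exact EReal.coe_le_coe_iff.2 (key h1)

end PeriodicNetwork

end

theorem mainTheorem6 {V₀ E₀ : Type*} [Finite V₀] [Finite E₀] {Γ₀ : OGraph V₀ E₀}
    (hΓ₀ : Γ₀.Connected) {P : Γ₀.Orientation} (S : OGraph.SpanningTree P)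
    {d : ℕ} {A : Type*} (N : PeriodicNetwork S d A)
    (H : A → ℝ → ℝ → ℝ) (hH : N.IsHamiltonian H)
    (z₁ z₂ : N.vertices) (T : ℝ) (hT : 0 < T) :
    N.minAction H z₁ z₂ T =
        discMinAction (N.baseHam H) S (N.π₁ z₁) (N.π₁ z₂) T (N.π₂ z₂ - N.π₂ z₁) ∧
      N.minAction H z₁ z₂ T ≠ ⊤ ∧ N.minAction H z₁ z₂ T ≠ ⊥ := by
  have h : N.minAction H z₁ z₂ T =
      discMinAction (N.baseHam H) S (N.π₁ z₁) (N.π₁ z₂) T (N.π₂ z₂ - N.π₂ z₁) :=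
    le_antisymm (hH.minAction_le_discMinAction z₁ z₂ T) (hH.discMinAction_le_minAction z₁ z₂ hT)
  rw [h]
  exact ⟨rfl, hH.discMinAction_ne_top z₁ z₂ hT, hH.discMinAction_ne_bot _ _ T _⟩
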